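/- Let $X$ be a compact connected smooth $n$-manifold and let $I=[t_0,\infty)$ or $I=(t_0,\infty)$. Let $(L,h,K)$ be a smooth expanding CMC Einstein flow on $X$: smooth families, for $t\in I$, of nonnegative functions $L(t)$, Riemannian metrics $h(t)$ and symmetric covariant $2$-tensor fields $K(t)$ on $X$ which, with $H=h^{ij}K_{ij}$, $K^0=K-\frac{H}{n}h$ and $R_{ij}$, $R$ the Ricci and scalar curvature of $h(t)$, satisfy $$R-|K^0|^2+\left(1-\tfrac1n\right)H^2=0,\qquad \nabla_iK^i{}_j-\nabla_jH=0,$$ $$\frac{\partial h_{ij}}{\partial t}=-2LK_{ij},\qquad \frac{\partial K_{ij}}{\partial t}=LHK_{ij}-2L\,h^{kl}K_{ik}K_{lj}-L_{;ij}+LR_{ij},$$ such that $H$ depends only on $t$, is negative and increasing in $t$, and takes all values in $[H_0,0)$ for some $H_0<0$. Assume that $t$ is the Hubble time, $t=-n/H$. For $s>0$ put $h_s(u)=s^{-2}h(su)$. Then the limit $\operatorname{dvol}_\infty=\lim_{t\to\infty}t^{-n}\operatorname{dvol}(X,h(t))$ exists as a measure on $X$ (setwise on Borel sets). Let $\Lambda>1$.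 For $s$ large and $x\in X$ let $H_{s,\Lambda}(x)\in\operatorname{End}(T_xX)$ be an endomorphism of positive determinant with $$h_s(x,\Lambda)=H_{s,\Lambda}(x)^*\,h_s(x,1)\,H_{s,\Lambda}(x),$$ i.e. $h_s(\Lambda)(v,w)=h_s(1)(H_{s,\Lambda}v,H_{s,\Lambda}w)$ on $T_xX$; it is unique up to left multiplication by orientation-preserving isometries of $(T_xX,h_s(x,1))$. Let $H^1_{s,\Lambda}(x)=\det(H_{s,\Lambda}(x))^{-1/n}H_{s,\Lambda}(x)$ be its rescaling of determinant one. In an orthonormal basis of $(T_xX,h_s(x,1))$, it defines a point of $\operatorname{SO}(n)\backslash\operatorname{SL}(n)$, which is identified with the space of positive definite symmetric $n\times n$ matrices of determinant one through $\operatorname{SO}(n)G\mapsto G^TG$. Let $d_{symm}$ be the distance of the $\operatorname{SL}(n)$-invariant Riemannian metric $\langle V,V\rangle_P=\operatorname{Tr}((P^{-1}V)^2)$ on this space, which is $\operatorname{Tr}(V^2)$ for a traceless symmetric matrix $V$ at the basepoint $I_n$. Then, for every such choice of the endomorphisms and bases, the function $x\mapsto d_{symm}(H^1_{s,\Lambda}(x),I_n)$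 lies in $L^2(X,\operatorname{dvol}_\infty)$ for all large $s$, and $$\lim_{s\to\infty}d_{symm}(H^1_{s,\Lambda},I_n)=0\quad\text{in } L^2(X,\operatorname{dvol}_\infty).$$ -/

import Mathlib

open Set Filter Topology MeasureTheory Bundle
open scoped Manifold ContDiff Matrix

noncomputable section

/-! ### Tensor calculus in a coordinate domain of `ℝⁿ` -/

namespace Coord

/-- The partial derivative `∂ₖ f` at `y`. -/
def pd {n : ℕ} (k : Fin n) (f : EuclideanSpace ℝ (Fin n) → ℝ) (y : EuclideanSpace ℝ (Fin n)) : ℝ :=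
  fderiv ℝ f y (EuclideanSpace.single k 1)

/-- The Christoffel symbol `Γᵏᵢⱼ` of the metric with components `g`. -/
def christoffel {n : ℕ} (g : EuclideanSpace ℝ (Fin n) → Matrix (Fin n) (Fin n) ℝ)
    (k i j : Fin n) (y : EuclideanSpace ℝ (Fin n)) : ℝ :=
  (1 / 2 : ℝ) * ∑ l, (g y)⁻¹ k l *
    (pd i (fun z => g z j l) y + pd j (fun z => g z i l) y - pd l (fun z => g z i j) y)

/-- The Ricci curvature `Rᵢⱼ = ∂ₖΓᵏᵢⱼ - ∂ⱼΓᵏᵢₖ + ΓᵏₖₗΓˡᵢⱼ - ΓᵏⱼₗΓˡᵢₖ`. -/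
def ricci {n : ℕ} (g : EuclideanSpace ℝ (Fin n) → Matrix (Fin n) (Fin n) ℝ)
    (i j : Fin n) (y : EuclideanSpace ℝ (Fin n)) : ℝ :=
  ∑ k, (pd k (christoffel g k i j) y - pd j (christoffel g k i k) y +
    ∑ l, (christoffel g k k l y * christoffel g l i j y -
      christoffel g k j l y * christoffel g l i k y))

/-- The trace `gⁱʲ Tᵢⱼ` of a covariant 2-tensor. -/
def tr {n : ℕ} (g T : Matrix (Fin n) (Fin n) ℝ) : ℝ :=
  ∑ i, ∑ j, g⁻¹ i j * T i j

/-- The scalar curvature `R = gⁱʲ Rᵢⱼ`. -/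
def scalarCurv {n : ℕ} (g : EuclideanSpace ℝ (Fin n) → Matrix (Fin n) (Fin n) ℝ)
    (y : EuclideanSpace ℝ (Fin n)) : ℝ :=
  tr (g y) (Matrix.of fun i j => ricci g i j y)

/-- The traceless part `T⁰ = T - (gᵏˡTₖₗ / n) g`. -/
def tracelessPart {n : ℕ} (g T : Matrix (Fin n) (Fin n) ℝ) : Matrix (Fin n) (Fin n) ℝ :=
  T - (tr g T / n) • g

/-- The squared norm `|T|² = gⁱᵏ gʲˡ Tᵢⱼ Tₖₗ` of a covariant 2-tensor. -/
def normSq {n : ℕ} (g T : Matrix (Fin n) (Fin n) ℝ) : ℝ :=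
  ∑ i, ∑ j, ∑ k, ∑ l, g⁻¹ i k * g⁻¹ j l * T i j * T k l

/-- The covariant Hessian `f_{;ij} = ∂ᵢ∂ⱼf - Γᵏᵢⱼ ∂ₖf`. -/
def hessian {n : ℕ} (g : EuclideanSpace ℝ (Fin n) → Matrix (Fin n) (Fin n) ℝ)
    (f : EuclideanSpace ℝ (Fin n) → ℝ) (i j : Fin n) (y : EuclideanSpace ℝ (Fin n)) : ℝ :=
  pd i (pd j f) y - ∑ k, christoffel g k i j y * pd k f y

/-- The covariant derivative `∇ₖTᵢⱼ = ∂ₖTᵢⱼ - ΓˡₖᵢTₗⱼ - ΓˡₖⱼTᵢₗ`. -/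
def covDeriv {n : ℕ} (g T : EuclideanSpace ℝ (Fin n) → Matrix (Fin n) (Fin n) ℝ)
    (k i j : Fin n) (y : EuclideanSpace ℝ (Fin n)) : ℝ :=
  pd k (fun z => T z i j) y
    - ∑ l, (christoffel g l k i y * T y l j + christoffel g l k j y * T y i l)

/-- The divergence `∇ᵢTⁱⱼ = gⁱᵏ ∇ₖTᵢⱼ`. -/
def divergence {n : ℕ} (g T : EuclideanSpace ℝ (Fin n) → Matrix (Fin n) (Fin n) ℝ)
    (j : Fin n) (y : EuclideanSpace ℝ (Fin n)) : ℝ :=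
  ∑ i, ∑ k, (g y)⁻¹ i k * covDeriv g T k i j y

end Coord

/-! ### Tensors on a manifold -/

/-- Covariant 2-tensor fields on an `n`-manifold. -/
abbrev Cov2Tensor (n : ℕ) (X : Type*) [TopologicalSpace X]
    [ChartedSpace (EuclideanSpace ℝ (Fin n)) X] : Type _ :=
  ∀ x : X, TangentSpace (𝓡 n) x →L[ℝ] TangentSpace (𝓡 n) x →L[ℝ] ℝ

/-- Smooth Riemannian metrics on an `n`-manifold. -/
abbrev SmoothMetric (n : ℕ) (X : Type*) [TopologicalSpace X]
    [ChartedSpace (EuclideanSpace ℝ (Fin n)) X] [IsManifold (𝓡 n) ∞ X] : Type _ :=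
  ContMDiffRiemannianMetric (𝓡 n) ∞ (EuclideanSpace ℝ (Fin n))
    (fun x : X => TangentSpace (𝓡 n) x)

/-- The components `Tᵢⱼ(y) = T(∂ᵢ, ∂ⱼ)` of a covariant 2-tensor field in the chart `e`, at the
point with coordinates `y`; here `∂ᵢ` is the image of the `i`-th basis vector of `ℝⁿ` under the
differential of `e⁻¹`. -/
def components {n : ℕ} {X : Type*} [TopologicalSpace X]
    [ChartedSpace (EuclideanSpace ℝ (Fin n)) X]
    (e : OpenPartialHomeomorph X (EuclideanSpace ℝ (Fin n))) (T : Cov2Tensor n X)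
    (y : EuclideanSpace ℝ (Fin n)) : Matrix (Fin n) (Fin n) ℝ :=
  Matrix.of fun i j =>
    T (e.symm y) (mfderiv (𝓡 n) (𝓡 n) e.symm y (EuclideanSpace.single i (1 : ℝ)))
      (mfderiv (𝓡 n) (𝓡 n) e.symm y (EuclideanSpace.single j (1 : ℝ)))

/-- The Riemannian measure `dvol(X, h)`: the smallest measure on `X` that dominates, for each
chart of the atlas, the measure `√(det hᵢⱼ) dy` on the chart domain. (These local measures agree on
overlaps, so the supremum restricts to each of them.) -/
def riemannianVolume {n : ℕ} {X : Type*} [TopologicalSpace X]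
    [ChartedSpace (EuclideanSpace ℝ (Fin n)) X] [MeasurableSpace X]
    (h : Cov2Tensor n X) : Measure X :=
  ⨆ e ∈ atlas (EuclideanSpace ℝ (Fin n)) X,
    ((volume.restrict e.target).withDensity
      (fun y => ENNReal.ofReal (Real.sqrt (components e h y).det))).map e.symm

/-! ### Einstein flows -/

/-- `(L, h, K)`, restricted to times in the interval `I`, is a smooth Einstein flow on `X`: the
constraint and the evolution equations hold in all charts of the atlas. Values at times outside `I`
play no role. -/
structure IsEinsteinFlow {n : ℕ} {X : Type*} [TopologicalSpace X]
    [ChartedSpace (EuclideanSpace ℝ (Fin n)) X] [IsManifold (𝓡 n) ∞ X]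
    (I : Set ℝ) (L : ℝ → X → ℝ) (h : ℝ → SmoothMetric n X) (K : ℝ → Cov2Tensor n X) : Prop where
  interval : I.OrdConnected
  lapse_nonneg : ∀ t ∈ I, ∀ x, 0 ≤ L t x
  symm : ∀ t ∈ I, ∀ (x : X) (v w : TangentSpace (𝓡 n) x), K t x v w = K t x w v
  smooth_L : ∀ e ∈ atlas (EuclideanSpace ℝ (Fin n)) X,
    ContDiffOn ℝ ∞ (fun p : ℝ × EuclideanSpace ℝ (Fin n) => L p.1 (e.symm p.2)) (I ×ˢ e.target)
  smooth_h : ∀ e ∈ atlas (EuclideanSpace ℝ (Fin n)) X, ∀ i j,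
    ContDiffOn ℝ ∞ (fun p : ℝ × EuclideanSpace ℝ (Fin n) =>
      components e (h p.1).inner p.2 i j) (I ×ˢ e.target)
  smooth_K : ∀ e ∈ atlas (EuclideanSpace ℝ (Fin n)) X, ∀ i j,
    ContDiffOn ℝ ∞ (fun p : ℝ × EuclideanSpace ℝ (Fin n) =>
      components e (K p.1) p.2 i j) (I ×ˢ e.target)
  /-- `R - |K⁰|² + (1 - 1/n) H² = 0`. -/
  hamiltonian_constraint : ∀ e ∈ atlas (EuclideanSpace ℝ (Fin n)) X, ∀ t ∈ I, ∀ y ∈ e.target,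
    Coord.scalarCurv (components e (h t).inner) y
      - Coord.normSq (components e (h t).inner y)
          (Coord.tracelessPart (components e (h t).inner y) (components e (K t) y))
      + (1 - 1 / (n : ℝ)) * Coord.tr (components e (h t).inner y) (components e (K t) y) ^ 2 = 0
  /-- `∇ᵢKⁱⱼ - ∇ⱼH = 0`. -/
  momentum_constraint : ∀ e ∈ atlas (EuclideanSpace ℝ (Fin n)) X, ∀ t ∈ I, ∀ y ∈ e.target, ∀ j,
    Coord.divergence (components e (h t).inner) (components e (K t)) j y
      - Coord.pd j (fun z => Coord.tr (components e (h t).inner z) (components e (K t) z)) y = 0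
  /-- `∂hᵢⱼ/∂t = - 2 L Kᵢⱼ`. -/
  evolution_h : ∀ e ∈ atlas (EuclideanSpace ℝ (Fin n)) X, ∀ t ∈ I, ∀ y ∈ e.target, ∀ i j,
    HasDerivWithinAt (fun τ => components e (h τ).inner y i j)
      (-2 * L t (e.symm y) * components e (K t) y i j) I t
  /-- `∂Kᵢⱼ/∂t = L H Kᵢⱼ - 2 L hᵏˡ Kᵢₖ Kₗⱼ - L_{;ij} + L Rᵢⱼ`. -/
  evolution_K : ∀ e ∈ atlas (EuclideanSpace ℝ (Fin n)) X, ∀ t ∈ I, ∀ y ∈ e.target, ∀ i j,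
    HasDerivWithinAt (fun τ => components e (K τ) y i j)
      (L t (e.symm y) * Coord.tr (components e (h t).inner y) (components e (K t) y)
          * components e (K t) y i j
        - 2 * L t (e.symm y) * ∑ k, ∑ l, (components e (h t).inner y)⁻¹ k l
            * components e (K t) y i k * components e (K t) y l j
        - Coord.hessian (components e (h t).inner) (fun z => L t (e.symm z)) i j y
        + L t (e.symm y) * Coord.ricci (components e (h t).inner) i j y) I t

/-- `(L, h, K)` is an expanding CMC Einstein flow on the time interval `I`, with mean curvature
function `H = hⁱʲKᵢⱼ` depending only on time. -/
structure IsExpandingCMCEinsteinFlow {n : ℕ} {X : Type*} [TopologicalSpace X]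
    [ChartedSpace (EuclideanSpace ℝ (Fin n)) X] [IsManifold (𝓡 n) ∞ X]
    (I : Set ℝ) (L : ℝ → X → ℝ) (h : ℝ → SmoothMetric n X) (K : ℝ → Cov2Tensor n X)
    (H : ℝ → ℝ) : Prop extends IsEinsteinFlow I L h K where
  cmc : ∀ e ∈ atlas (EuclideanSpace ℝ (Fin n)) X, ∀ t ∈ I, ∀ y ∈ e.target,
    Coord.tr (components e (h t).inner y) (components e (K t) y) = H t
  half_line : ∃ t₀ : ℝ, I = Ici t₀ ∨ I = Ioi t₀
  monotone : MonotoneOn H I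
  neg : ∀ t ∈ I, H t < 0
  values : ∃ H₀ < 0, Ico H₀ 0 ⊆ H '' I

/-- The rescaled metric `h_s(u) = s⁻² h(su)`. -/
def rescaledMetric {n : ℕ} {X : Type*} [TopologicalSpace X]
    [ChartedSpace (EuclideanSpace ℝ (Fin n)) X] [IsManifold (𝓡 n) ∞ X]
    (h : ℝ → SmoothMetric n X) (s u : ℝ) : Cov2Tensor n X :=
  fun x => (s ^ 2)⁻¹ • (h (s * u)).inner x

/-- `μ = lim_{t → ∞} t⁻ⁿ dvol(X, h(t))`, as a limit of measures on every measurable set. -/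
def IsLimitVolume {n : ℕ} {X : Type*} [TopologicalSpace X]
    [ChartedSpace (EuclideanSpace ℝ (Fin n)) X] [IsManifold (𝓡 n) ∞ X] [MeasurableSpace X]
    (h : ℝ → SmoothMetric n X) (μ : Measure X) : Prop :=
  ∀ A : Set X, MeasurableSet A →
    Tendsto (fun t : ℝ => ENNReal.ofReal ((t ^ n)⁻¹) * riemannianVolume (h t).inner A)
      atTop (𝓝 (μ A))

/-! ### The symmetric space `SO(n) \ SL(n)` -/

/-- The point of the space of positive definite symmetric matrices of determinant one that
corresponds to the coset `SO(n) G`, for `G ∈ SL(n)`. -/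
def cosetPoint {n : ℕ} (G : Matrix (Fin n) (Fin n) ℝ) : Matrix (Fin n) (Fin n) ℝ := Gᵀ * G

/-- `γ : [0,1] → SO(n) \ SL(n)` is a `C¹` curve from `P` to `Q`. -/
structure IsSymmCurve {n : ℕ} (P Q : Matrix (Fin n) (Fin n) ℝ)
    (γ : ℝ → Matrix (Fin n) (Fin n) ℝ) : Prop where
  smooth : ∀ i j, ContDiffOn ℝ 1 (fun τ => γ τ i j) (Icc 0 1)
  posDef : ∀ τ ∈ Icc (0 : ℝ) 1, (γ τ).PosDef
  det_one : ∀ τ ∈ Icc (0 : ℝ) 1, (γ τ).det = 1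
  source : γ 0 = P
  target : γ 1 = Q

/-- The velocity of a curve of matrices on `[0,1]`. -/
def velocity {n : ℕ} (γ : ℝ → Matrix (Fin n) (Fin n) ℝ) (τ : ℝ) : Matrix (Fin n) (Fin n) ℝ :=
  Matrix.of fun i j => derivWithin (fun σ => γ σ i j) (Icc 0 1) τ

/-- The length of a curve for the `SL(n)`-invariant Riemannian metric `⟨V, V⟩_P = Tr((P⁻¹V)²)`,
which at the basepoint `P = Iₙ` is `Tr(V²)`. -/
def symmLength {n : ℕ} (γ : ℝ → Matrix (Fin n) (Fin n) ℝ) : ENNReal :=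
  ∫⁻ τ in Icc (0 : ℝ) 1,
    ENNReal.ofReal (Real.sqrt (Matrix.trace (((γ τ)⁻¹ * velocity γ τ) ^ 2)))

/-- The Riemannian distance on `SO(n) \ SL(n)`: the infimum of the lengths of curves. -/
def symmDist {n : ℕ} (P Q : Matrix (Fin n) (Fin n) ℝ) : ENNReal :=
  ⨅ (γ : ℝ → Matrix (Fin n) (Fin n) ℝ) (_ : IsSymmCurve P Q γ), symmLength γ

/-! ### The endomorphism relating two inner products -/

/-- `k = A^* g A`, that is, `k(v, w) = g(Av, Aw)`; among the endomorphisms with this property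
we take those that preserve the orientation. -/
def Relates {V : Type*} [AddCommGroup V] [Module ℝ V] [TopologicalSpace V]
    (g k : V →L[ℝ] V →L[ℝ] ℝ) (A : V →ₗ[ℝ] V) : Prop :=
  (∀ v w, k v w = g (A v) (A w)) ∧ 0 < LinearMap.det A

/-- The rescaling of an endomorphism `A` of positive determinant of an `n`-dimensional space to
have determinant one. -/
def unimodularPart {V : Type*} [AddCommGroup V] [Module ℝ V] (n : ℕ) (A : V →ₗ[ℝ] V) :
    V →ₗ[ℝ] V :=
  (LinearMap.det A ^ (-(1 / (n : ℝ)))) • A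

/-- The basis `b` is orthonormal for the inner product `g`. -/
def IsOrthonormalBasis {n : ℕ} {V : Type*} [AddCommGroup V] [Module ℝ V] [TopologicalSpace V]
    (g : V →L[ℝ] V →L[ℝ] ℝ) (b : Module.Basis (Fin n) ℝ V) : Prop :=
  ∀ i j, g (b i) (b j) = if i = j then 1 else 0

end

/-! In the Hubble time `H = -n/t`. Differentiating the identity `tr_h K = -n/t` along the flow and
eliminating `R` by the Hamiltonian constraint gives the elliptic equation `ΔL = L|K⁰|² - (n/t²)(1 -
L)` (`lapse_equation`). Two consequences drive the proof. At a maximum of `L` the equation forces `L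
≤ 1` (`lapse_le_one`). Integrating it over the compact manifold, where the integral of a Laplacian
vanishes, gives `∫ t L|K⁰|² dvol = ∫ (n/t)(1 - L) dvol` (`lintegral_lapse_mul_shearSq`).

The right-hand side is a rate of volume loss: the density of `t⁻ⁿ dvol(h(t))` has logarithmic
derivative `-(n/t)(1 - L) ≤ 0` (`sqrt_det_eq`). Hence the rescaled volumes decrease. Relative to a
fixed time `T` they have the density `exp(-∫_T^t (n/τ)(1 - L) dτ)` (`smul_riemannianVolume_eq`), and
dominated convergence yields the limit measure (`isLimitVolume_limitVolume`). The limit is smaller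
than every later rescaled volume, so by Tonelli the space-time energy `∫∫ τ L|K⁰|² dτ dvol_∞` over
`[s, Λs]` is at most the rescaled volume lost between `s` and `Λs` (`lintegral_energy_le`), which
tends to zero (`tendsto_volume_loss`).

It remains to bound the distance by the energy. By invariance of the metric on the symmetric space,
the distance in question is the one between the determinant-one multiples of `h(Λs)` and `h(s)` in
any chart, whatever endomorphisms and bases are chosen (`symmDist_relates`). The path of the
normalized metrics joins them with speed `2L|K⁰|` (`symmDist_metric_le`). Cauchy–Schwarz with the
weight `τ` and `L² ≤ L` then give `d² ≤ 4 log Λ · ∫ τ L|K⁰|² dτ` (`sq_symmDist_metric_le`), and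
integration against the limit measure finishes the estimate.

Two foundational points are needed as well. The distance is an infimum over curves, and its
measurability comes from upper semicontinuity (`eventually_symmDist_lt`,
`measurable_of_eq_symmDist`). The Riemannian measure is a supremum over charts, and its local
formula comes from the change of variables and a partition of unity
(`riemannianVolume_apply_of_subset`). -/

/-! ### Calculus of matrix-valued functions -/

section MatrixCalculus

variable {m : Type*} [Fintype m] [DecidableEq m]

/-- Jacobi's formula for the derivative of a determinant. -/
theorem hasDerivWithinAt_det {M : ℝ → Matrix m m ℝ} {M' : Matrix m m ℝ} {s : Set ℝ} {t : ℝ}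
    (hM : ∀ i j, HasDerivWithinAt (fun τ => M τ i j) (M' i j) s t) :
    HasDerivWithinAt (fun τ => (M τ).det) (((M t).adjugate * M').trace) s t := by
  have h1 : HasDerivWithinAt (fun τ => (M τ).det)
      (∑ σ : Equiv.Perm m, Equiv.Perm.sign σ •
        ∑ i, (∏ j ∈ Finset.univ.erase i, M t (σ j) j) • M' (σ i) i) s t := by
    simp only [Matrix.det_apply]
    refine HasDerivWithinAt.fun_sum fun σ _ => ?_
    have := (HasDerivWithinAt.fun_finsetProd (u := Finset.univ)
      (fun i _ => hM (σ i) i)).const_mul (((Equiv.Perm.sign σ : ℤ) : ℝ))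
    simpa [Units.smul_def, zsmul_eq_mul] using this
  convert h1 using 1
  -- Cramer's rule: the `i`-th diagonal entry of the product is the determinant with column `i`
  -- replaced by its derivative, which is what the product rule produces in the Leibniz expansion.
  have h2 : ((M t).adjugate * M').trace = ∑ i, ((M t).updateCol i fun k => M' k i).det := by
    simp only [Matrix.trace, Matrix.diag]
    refine Finset.sum_congr rfl fun i _ => ?_
    rw [← Matrix.cramer_apply, Matrix.cramer_eq_adjugate_mulVec]
    rfl
  rw [h2]
  simp only [Matrix.det_apply, Finset.smul_sum]
  rw [Finset.sum_comm]
  refine Finset.sum_congr rfl fun σ _ => Finset.sum_congr rfl fun i _ => ?_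
  congr 1
  rw [← Finset.mul_prod_erase _ _ (Finset.mem_univ i), Matrix.updateCol_self, smul_eq_mul, mul_comm]
  congr 1
  refine Finset.prod_congr rfl fun j hj => ?_
  rw [Matrix.updateCol_ne (Finset.ne_of_mem_erase hj)]

/-- The derivative of a determinant, at an invertible matrix. -/
theorem hasDerivWithinAt_det_of_ne_zero {M : ℝ → Matrix m m ℝ} {M' : Matrix m m ℝ} {s : Set ℝ}
    {t : ℝ} (hM : ∀ i j, HasDerivWithinAt (fun τ => M τ i j) (M' i j) s t)
    (h0 : (M t).det ≠ 0) :
    HasDerivWithinAt (fun τ => (M τ).det) ((M t).det * ((M t)⁻¹ * M').trace) s t := by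
  convert hasDerivWithinAt_det hM using 1
  rw [Matrix.inv_def, Matrix.smul_mul, Matrix.trace_smul, smul_eq_mul, ← mul_assoc,
    Ring.inverse_eq_inv', mul_inv_cancel₀ h0, one_mul]

theorem contDiffOn_det {E : Type*} [NormedAddCommGroup E] [NormedSpace ℝ E]
    {M : E → Matrix m m ℝ} {s : Set E} {k : WithTop ℕ∞}
    (hM : ∀ i j, ContDiffOn ℝ k (fun z => M z i j) s) :
    ContDiffOn ℝ k (fun z => (M z).det) s := by
  simp only [Matrix.det_apply]
  refine ContDiffOn.sum fun σ _ => ?_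
  simp only [Units.smul_def, zsmul_eq_mul]
  exact contDiffOn_const.mul (contDiffOn_prod fun i _ => hM _ _)

theorem contDiffOn_inv_apply {E : Type*} [NormedAddCommGroup E] [NormedSpace ℝ E]
    {M : E → Matrix m m ℝ} {s : Set E} {k : WithTop ℕ∞}
    (hM : ∀ i j, ContDiffOn ℝ k (fun z => M z i j) s) (h0 : ∀ z ∈ s, (M z).det ≠ 0) (i j : m) :
    ContDiffOn ℝ k (fun z => (M z)⁻¹ i j) s := by
  simp only [Matrix.inv_def, Matrix.smul_apply, smul_eq_mul, Ring.inverse_eq_inv',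
    Matrix.adjugate_apply]
  refine ((contDiffOn_det hM).inv h0).mul (contDiffOn_det fun a b => ?_)
  by_cases h : a = j
  · subst h; simpa using contDiffOn_const
  · simpa [Matrix.updateRow_ne h] using hM a b

/-- An entry of the adjugate is the determinant of the matrix with one row made constant. -/
theorem differentiableWithinAt_adjugate_apply {M : ℝ → Matrix m m ℝ} {M' : Matrix m m ℝ} {s : Set ℝ}
    {t : ℝ} (hM : ∀ i j, HasDerivWithinAt (fun τ => M τ i j) (M' i j) s t) (i j : m) :
    DifferentiableWithinAt ℝ (fun τ => (M τ).adjugate i j) s t := by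
  simp only [Matrix.adjugate_apply]
  refine (hasDerivWithinAt_det (M' := M'.updateRow j 0) fun a b => ?_).differentiableWithinAt
  by_cases h : a = j
  · subst h; simpa using hasDerivWithinAt_const t s _
  · simpa [Matrix.updateRow_ne h] using hM a b

theorem hasDerivWithinAt_mul_apply {m : Type*} [Fintype m] {M N : ℝ → Matrix m m ℝ}
    {M' N' : Matrix m m ℝ} {s : Set ℝ}
    {t : ℝ} (hM : ∀ i j, HasDerivWithinAt (fun τ => M τ i j) (M' i j) s t)
    (hN : ∀ i j, HasDerivWithinAt (fun τ => N τ i j) (N' i j) s t) (i j : m) :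
    HasDerivWithinAt (fun τ => (M τ * N τ) i j) ((M' * N t + M t * N') i j) s t := by
  simp only [Matrix.mul_apply, Matrix.add_apply, ← Finset.sum_add_distrib]
  exact HasDerivWithinAt.fun_sum fun k _ => (hM i k).mul (hN k j)

/-- The derivative of the inverse of a matrix. -/
theorem hasDerivWithinAt_inv_apply {M : ℝ → Matrix m m ℝ} {M' : Matrix m m ℝ} {s : Set ℝ} {t : ℝ}
    (hM : ∀ i j, HasDerivWithinAt (fun τ => M τ i j) (M' i j) s t) (h0 : (M t).det ≠ 0)
    (hu : UniqueDiffWithinAt ℝ s t) (i j : m) :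
    HasDerivWithinAt (fun τ => (M τ)⁻¹ i j) (-((M t)⁻¹ * M' * (M t)⁻¹) i j) s t := by
  have hd := hasDerivWithinAt_det hM
  have hdiff : ∀ i j, DifferentiableWithinAt ℝ (fun τ => (M τ)⁻¹ i j) s t := fun i j => by
    simp only [Matrix.inv_def, Matrix.smul_apply, smul_eq_mul, Ring.inverse_eq_inv']
    exact (hd.differentiableWithinAt.inv h0).mul (differentiableWithinAt_adjugate_apply hM i j)
  set N' : Matrix m m ℝ := Matrix.of fun i j => derivWithin (fun τ => (M τ)⁻¹ i j) s t with hN'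
  have hN : ∀ i j, HasDerivWithinAt (fun τ => (M τ)⁻¹ i j) (N' i j) s t :=
    fun i j => (hdiff i j).hasDerivWithinAt
  -- Once the inverse is known to be differentiable, its derivative is found by differentiating `M *
  -- M⁻¹ = 1`, an identity available only where the determinant is nonzero, hence near `t`.
  have hne : ∀ᶠ τ in 𝓝[s] t, (M τ).det ≠ 0 := hd.continuousWithinAt.eventually_ne h0
  have key : M' * (M t)⁻¹ + M t * N' = 0 := by
    ext a b
    have h1 := hasDerivWithinAt_mul_apply hM hN a b
    have h2 : HasDerivWithinAt (fun τ => (M τ * (M τ)⁻¹) a b) 0 s t := by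
      refine (hasDerivWithinAt_const t s ((1 : Matrix m m ℝ) a b)).congr_of_eventuallyEq ?_ ?_
      · filter_upwards [hne] with τ hτ
        rw [Matrix.mul_nonsing_inv _ (isUnit_iff_ne_zero.2 hτ)]
      · rw [Matrix.mul_nonsing_inv _ (isUnit_iff_ne_zero.2 h0)]
    exact hu.eq_deriv _ h1 h2
  have : N' = -((M t)⁻¹ * M' * (M t)⁻¹) := by
    have h3 : (M t)⁻¹ * (M t * N') = N' :=
      Matrix.nonsing_inv_mul_cancel_left _ _ (isUnit_iff_ne_zero.2 h0)
    rw [← h3, eq_neg_of_add_eq_zero_right key, Matrix.mul_neg, Matrix.mul_assoc]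
  rw [← Matrix.neg_apply, ← this]
  exact hN i j

end MatrixCalculus

/-! ### Algebra of covariant 2-tensors on an inner product space -/

namespace Coord

variable {n : ℕ}

theorem tr_eq_trace (g T : Matrix (Fin n) (Fin n) ℝ) : tr g T = (g⁻¹ * Tᵀ).trace := by
  simp [tr, Matrix.trace, Matrix.mul_apply]

theorem normSq_eq_trace (g T : Matrix (Fin n) (Fin n) ℝ) :
    normSq g T = ((g⁻¹)ᵀ * T * g⁻¹ * Tᵀ).trace := by
  simp only [normSq, Matrix.trace, Matrix.diag, Matrix.mul_apply, Matrix.transpose_apply,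
    Finset.sum_mul]
  rw [show (∑ i, ∑ j, ∑ k, ∑ l, g⁻¹ i k * g⁻¹ j l * T i j * T k l) =
    ∑ i, ∑ k, ∑ j, ∑ l, g⁻¹ i k * g⁻¹ j l * T i j * T k l from
    Finset.sum_congr rfl fun i _ => Finset.sum_comm, Finset.sum_comm]
  refine Finset.sum_congr rfl fun k _ => ?_
  rw [show (∑ i, ∑ j, ∑ l, g⁻¹ i k * g⁻¹ j l * T i j * T k l) =
    ∑ i, ∑ l, ∑ j, g⁻¹ i k * g⁻¹ j l * T i j * T k l from
    Finset.sum_congr rfl fun i _ => Finset.sum_comm, Finset.sum_comm]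
  refine Finset.sum_congr rfl fun l _ => ?_
  rw [Finset.sum_comm]
  exact Finset.sum_congr rfl fun j _ => Finset.sum_congr rfl fun i _ => by ring

theorem _root_.Matrix.PosDef.transpose_eq {g : Matrix (Fin n) (Fin n) ℝ} (hg : g.PosDef) :
    gᵀ = g := by
  simpa using hg.isHermitian.eq

theorem _root_.Matrix.PosDef.exists_transpose_mul_self {g : Matrix (Fin n) (Fin n) ℝ}
    (hg : g.PosDef) : ∃ B : Matrix (Fin n) (Fin n) ℝ, g = Bᵀ * B := by
  open scoped MatrixOrder in
  obtain ⟨B, hB⟩ := CStarAlgebra.nonneg_iff_eq_star_mul_self.mp hg.posSemidef.nonneg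
  exact ⟨B, by simpa [Matrix.star_eq_conjTranspose] using hB⟩

theorem _root_.Matrix.trace_mul_transpose_self_nonneg (A : Matrix (Fin n) (Fin n) ℝ) :
    0 ≤ (A * Aᵀ).trace := by
  simp only [Matrix.trace, Matrix.diag, Matrix.mul_apply, Matrix.transpose_apply]
  exact Finset.sum_nonneg fun i _ => Finset.sum_nonneg fun j _ => mul_self_nonneg _

/-- With `g⁻¹ = BᵀB` the expression is the squared Frobenius norm of `B T Bᵀ`. -/
theorem normSq_nonneg {g : Matrix (Fin n) (Fin n) ℝ} (hg : g.PosDef)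
    (T : Matrix (Fin n) (Fin n) ℝ) : 0 ≤ normSq g T := by
  obtain ⟨B, hB⟩ := hg.inv.exists_transpose_mul_self
  rw [normSq_eq_trace, hg.inv.transpose_eq, hB]
  convert Matrix.trace_mul_transpose_self_nonneg (B * T * Bᵀ) using 1
  rw [Matrix.mul_assoc Bᵀ, Matrix.mul_assoc Bᵀ, Matrix.mul_assoc Bᵀ, Matrix.trace_mul_comm]
  simp only [Matrix.transpose_mul, Matrix.transpose_transpose, Matrix.mul_assoc]

theorem tr_of_symm (g : Matrix (Fin n) (Fin n) ℝ) {T : Matrix (Fin n) (Fin n) ℝ} (hT : Tᵀ = T) :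
    tr g T = (g⁻¹ * T).trace := by
  rw [tr_eq_trace, hT]

theorem normSq_of_symm {g T : Matrix (Fin n) (Fin n) ℝ} (hg : g.PosDef) (hT : Tᵀ = T) :
    normSq g T = ((g⁻¹ * T) ^ 2).trace := by
  rw [normSq_eq_trace, hg.inv.transpose_eq, hT, pow_two, Matrix.mul_assoc]

theorem tracelessPart_transpose {g T : Matrix (Fin n) (Fin n) ℝ} (hg : g.PosDef) (hT : Tᵀ = T) :
    (tracelessPart g T)ᵀ = tracelessPart g T := by
  simp [tracelessPart, hT, hg.transpose_eq]

theorem inv_mul_tracelessPart {g T : Matrix (Fin n) (Fin n) ℝ} (hg : g.PosDef) (hT : Tᵀ = T) :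
    g⁻¹ * tracelessPart g T = g⁻¹ * T - ((g⁻¹ * T).trace / n) • (1 : Matrix (Fin n) (Fin n) ℝ) := by
  rw [tracelessPart, Matrix.mul_sub, Matrix.mul_smul, tr_of_symm g hT,
    Matrix.nonsing_inv_mul _ (isUnit_iff_ne_zero.2 hg.det_pos.ne')]

/-- This form depends only on traces of powers of `g⁻¹T`; it makes invariance under a change of
basis and continuity in `g` and `T` visible. -/
theorem normSq_tracelessPart {g T : Matrix (Fin n) (Fin n) ℝ} (hn : n ≠ 0) (hg : g.PosDef)
    (hT : Tᵀ = T) :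
    normSq g (tracelessPart g T) = ((g⁻¹ * T) ^ 2).trace - (g⁻¹ * T).trace ^ 2 / n := by
  have hn' : (n : ℝ) ≠ 0 := Nat.cast_ne_zero.2 hn
  rw [normSq_of_symm hg (tracelessPart_transpose hg hT), inv_mul_tracelessPart hg hT]
  set M := g⁻¹ * T
  simp only [pow_two, Matrix.mul_sub, Matrix.sub_mul, Matrix.mul_smul, Matrix.smul_mul,
    Matrix.mul_one, Matrix.one_mul, Matrix.trace_sub, Matrix.trace_smul, Matrix.trace_one,
    smul_eq_mul, Fintype.card_fin]
  field_simp
  ring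

/-- The norm of the traceless part does not depend on the basis. -/
theorem normSq_tracelessPart_congr {g T J : Matrix (Fin n) (Fin n) ℝ} (hn : n ≠ 0) (hg : g.PosDef)
    (hT : Tᵀ = T) (hJ : J.det ≠ 0) :
    normSq (Jᵀ * g * J) (tracelessPart (Jᵀ * g * J) (Jᵀ * T * J)) =
      normSq g (tracelessPart g T) := by
  have hJu : IsUnit J.det := isUnit_iff_ne_zero.2 hJ
  have hJt : IsUnit Jᵀ.det := by rwa [Matrix.det_transpose]
  have hpos : (Jᵀ * g * J).PosDef := by
    simpa using hg.conjTranspose_mul_mul_same (B := J)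
      (Matrix.mulVec_injective_of_isUnit ((Matrix.isUnit_iff_isUnit_det _).2 hJu))
  have hsym : (Jᵀ * T * J)ᵀ = Jᵀ * T * J := by
    simp [Matrix.transpose_mul, hT, Matrix.mul_assoc]
  -- A change of basis conjugates the endomorphism `g⁻¹T`, so that the traces of its powers are
  -- unchanged.
  have h1 : (Jᵀ * g * J)⁻¹ * (Jᵀ * T * J) = J⁻¹ * (g⁻¹ * T) * J := by
    rw [Matrix.mul_inv_rev, Matrix.mul_inv_rev]
    simp only [Matrix.mul_assoc]
    rw [Matrix.nonsing_inv_mul_cancel_left _ _ hJt]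
  have h2 : (J⁻¹ * (g⁻¹ * T) * J) ^ 2 = J⁻¹ * (g⁻¹ * T) ^ 2 * J := by
    simp only [pow_two, Matrix.mul_assoc]
    rw [Matrix.mul_nonsing_inv_cancel_left _ _ hJu]
  have h3 : ∀ A : Matrix (Fin n) (Fin n) ℝ, (J⁻¹ * A * J).trace = A.trace := fun A => by
    rw [Matrix.trace_mul_comm, ← Matrix.mul_assoc, Matrix.mul_nonsing_inv _ hJu, Matrix.one_mul]
  rw [normSq_tracelessPart hn hpos hsym, normSq_tracelessPart hn hg hT, h1, h2, h3, h3]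

end Coord

/-! ### Curves in the symmetric space -/

section SymmetricSpace

variable {n : ℕ}

/-- The multiple of determinant one of a positive definite matrix. -/
noncomputable def detNormalize (P : Matrix (Fin n) (Fin n) ℝ) : Matrix (Fin n) (Fin n) ℝ :=
  (P.det ^ (-(1 / (n : ℝ)))) • P

theorem posDef_detNormalize {P : Matrix (Fin n) (Fin n) ℝ} (hP : P.PosDef) :
    (detNormalize P).PosDef :=
  hP.smul (Real.rpow_pos_of_pos hP.det_pos _)

theorem det_detNormalize {P : Matrix (Fin n) (Fin n) ℝ} (hn : n ≠ 0) (hP : P.PosDef) :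
    (detNormalize P).det = 1 := by
  rw [detNormalize, Matrix.det_smul, Fintype.card_fin, ← Real.rpow_natCast, ← Real.rpow_mul
    hP.det_pos.le, ← Real.rpow_add_one hP.det_pos.ne']
  have : (n : ℝ) ≠ 0 := Nat.cast_ne_zero.2 hn
  field_simp
  simp

theorem detNormalize_of_det_eq_one {P : Matrix (Fin n) (Fin n) ℝ} (hP : P.det = 1) :
    detNormalize P = P := by
  simp [detNormalize, hP]

/-- Thus `detNormalize` sees only the conformal class, and the factors `s⁻²` and `det(H)^(-1/n)`
disappear. -/
theorem detNormalize_smul {P : Matrix (Fin n) (Fin n) ℝ} (hn : n ≠ 0) (hP : P.PosDef) {c : ℝ}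
    (hc : 0 < c) : detNormalize (c • P) = detNormalize P := by
  have hn' : (n : ℝ) ≠ 0 := Nat.cast_ne_zero.2 hn
  rw [detNormalize, detNormalize, Matrix.det_smul, Fintype.card_fin, smul_smul,
    Real.mul_rpow (by positivity) hP.det_pos.le, ← Real.rpow_natCast, ← Real.rpow_mul hc.le,
    mul_right_comm, ← Real.rpow_add_one hc.ne']
  field_simp
  simp

/-- Differentiating the factor `det^(-1/n)` contributes `-tr/n` times the metric, which is exactly
the trace part to be removed from `V`. -/
theorem hasDerivWithinAt_detNormalize_apply {γ : ℝ → Matrix (Fin n) (Fin n) ℝ}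
    {V : Matrix (Fin n) (Fin n) ℝ} {s : Set ℝ} {t : ℝ} (hsym : Vᵀ = V) (hpos : (γ t).PosDef)
    (hγ : ∀ i j, HasDerivWithinAt (fun τ => γ τ i j) (V i j) s t) (i j : Fin n) :
    HasDerivWithinAt (fun τ => detNormalize (γ τ) i j)
      (((γ t).det ^ (-(1 / (n : ℝ))) • Coord.tracelessPart (γ t) V) i j) s t := by
  have hd := hasDerivWithinAt_det_of_ne_zero hγ hpos.det_pos.ne'
  have h1 := (hd.rpow_const (p := -(1 / (n : ℝ))) (Or.inl hpos.det_pos.ne')).mul (hγ i j)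
  refine h1.congr_deriv ?_
  simp only [Coord.tracelessPart, Matrix.smul_apply, Matrix.sub_apply, smul_eq_mul,
    Coord.tr_of_symm _ hsym]
  rw [Real.rpow_sub_one hpos.det_pos.ne']
  field_simp [hpos.det_pos.ne']
  ring

theorem contDiffOn_detNormalize_apply {γ : ℝ → Matrix (Fin n) (Fin n) ℝ} {s : Set ℝ}
    (hγ : ∀ i j, ContDiffOn ℝ 1 (fun τ => γ τ i j) s) (hpos : ∀ τ ∈ s, (γ τ).PosDef)
    (i j : Fin n) : ContDiffOn ℝ 1 (fun τ => detNormalize (γ τ) i j) s :=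
  ((contDiffOn_det hγ).rpow_const_of_ne fun τ hτ => (hpos τ hτ).det_pos.ne').mul (hγ i j)

theorem transpose_eq_of_hasDerivWithinAt {γ : ℝ → Matrix (Fin n) (Fin n) ℝ}
    {V : Matrix (Fin n) (Fin n) ℝ} {s : Set ℝ} {t : ℝ} (hs : UniqueDiffWithinAt ℝ s t)
    (ht : t ∈ s) (hpos : ∀ τ ∈ s, (γ τ).PosDef)
    (hγ : ∀ i j, HasDerivWithinAt (fun τ => γ τ i j) (V i j) s t) : Vᵀ = V := by
  ext i j
  refine hs.eq_deriv _ (hγ j i) ((hγ i j).congr (fun τ hτ => ?_) ?_)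
  · exact congrFun (congrFun (hpos τ hτ).transpose_eq i) j
  · exact congrFun (congrFun (hpos t ht).transpose_eq i) j

/-- The distance between the normalizations of the end points of a curve of positive definite
matrices is at most the integral of the norm of the traceless part of the velocity. -/
theorem symmDist_detNormalize_le (hn : n ≠ 0) {γ V : ℝ → Matrix (Fin n) (Fin n) ℝ}
    (hγ : ∀ i j, ContDiffOn ℝ 1 (fun τ => γ τ i j) (Icc 0 1))
    (hpos : ∀ τ ∈ Icc (0 : ℝ) 1, (γ τ).PosDef)
    (hV : ∀ τ ∈ Icc (0 : ℝ) 1, ∀ i j,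
      HasDerivWithinAt (fun σ => γ σ i j) (V τ i j) (Icc 0 1) τ) :
    symmDist (detNormalize (γ 0)) (detNormalize (γ 1)) ≤
      ∫⁻ τ in Icc (0 : ℝ) 1, ENNReal.ofReal
        (Real.sqrt (Coord.normSq (γ τ) (Coord.tracelessPart (γ τ) (V τ)))) := by
  -- The normalized curve competes in the infimum. In `P⁻¹V` the factors `det^(-1/n)` of position
  -- and velocity cancel, so its speed is the norm of the traceless part of `V`.
  have hcurve : IsSymmCurve (detNormalize (γ 0)) (detNormalize (γ 1))
      (fun τ => detNormalize (γ τ)) :=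
    ⟨contDiffOn_detNormalize_apply hγ hpos, fun τ hτ => posDef_detNormalize (hpos τ hτ),
      fun τ hτ => det_detNormalize hn (hpos τ hτ), rfl, rfl⟩
  refine (iInf₂_le _ hcurve).trans (le_of_eq ?_)
  refine setLIntegral_congr_fun measurableSet_Icc fun τ hτ => ?_
  have hu : UniqueDiffWithinAt ℝ (Icc (0 : ℝ) 1) τ := uniqueDiffOn_Icc one_pos τ hτ
  have hsym := transpose_eq_of_hasDerivWithinAt hu hτ hpos (hV τ hτ)
  have hvel : velocity (fun τ => detNormalize (γ τ)) τ =
      (γ τ).det ^ (-(1 / (n : ℝ))) • Coord.tracelessPart (γ τ) (V τ) := by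
    ext i j
    exact (hasDerivWithinAt_detNormalize_apply hsym (hpos τ hτ) (hV τ hτ) i j).derivWithin hu
  have hc : (γ τ).det ^ (-(1 / (n : ℝ))) ≠ 0 :=
    (Real.rpow_pos_of_pos (hpos τ hτ).det_pos _).ne'
  have := invertibleOfNonzero hc
  simp only
  rw [hvel, detNormalize, Matrix.inv_smul _ _ (isUnit_iff_ne_zero.2 (hpos τ hτ).det_pos.ne')]
  rw [Coord.normSq_of_symm (hpos τ hτ) (Coord.tracelessPart_transpose (hpos τ hτ) hsym)]
  congr 4
  rw [Matrix.smul_mul, Matrix.mul_smul, smul_smul, invOf_mul_self, one_smul]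

/-- The action of matrices of determinant `±1` does not increase distances. -/
theorem symmDist_congr_le {P Q C : Matrix (Fin n) (Fin n) ℝ} (hC : C.det ^ 2 = 1) :
    symmDist (Cᵀ * P * C) (Cᵀ * Q * C) ≤ symmDist P Q := by
  have hC0 : C.det ≠ 0 := fun h => by simp [h] at hC
  have hCu : IsUnit C.det := isUnit_iff_ne_zero.2 hC0
  have hCt : IsUnit Cᵀ.det := by rwa [Matrix.det_transpose]
  refine le_iInf₂ fun γ hγ => ?_
  have hentry : ∀ τ i j, (Cᵀ * γ τ * C) i j = ∑ b, ∑ a, C a i * γ τ a b * C b j := fun τ i j => by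
    simp [Matrix.mul_apply, Finset.sum_mul]
  have hcurve : IsSymmCurve (Cᵀ * P * C) (Cᵀ * Q * C) (fun τ => Cᵀ * γ τ * C) := by
    refine ⟨fun i j => ?_, fun τ hτ => ?_, fun τ hτ => ?_, by rw [hγ.source], by rw [hγ.target]⟩
    · simp only [hentry]
      exact ContDiffOn.sum fun b _ => ContDiffOn.sum fun a _ =>
        (contDiffOn_const.mul (hγ.smooth a b)).mul contDiffOn_const
    · simpa using (hγ.posDef τ hτ).conjTranspose_mul_mul_same (B := C)
        (Matrix.mulVec_injective_of_isUnit ((Matrix.isUnit_iff_isUnit_det _).2 hCu))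
    · rw [Matrix.det_mul, Matrix.det_mul, Matrix.det_transpose, hγ.det_one τ hτ, mul_one, ← pow_two,
        hC]
  refine (iInf₂_le _ hcurve).trans (le_of_eq ?_)
  refine setLIntegral_congr_fun measurableSet_Icc fun τ hτ => ?_
  have hu : UniqueDiffWithinAt ℝ (Icc (0 : ℝ) 1) τ := uniqueDiffOn_Icc one_pos τ hτ
  have hvel : velocity (fun τ => Cᵀ * γ τ * C) τ = Cᵀ * velocity γ τ * C := by
    ext i j
    refine HasDerivWithinAt.derivWithin ?_ hu
    have : (Cᵀ * velocity γ τ * C) i j = ∑ b, ∑ a, C a i * velocity γ τ a b * C b j := by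
      simp [Matrix.mul_apply, Finset.sum_mul]
    rw [this]
    simp only [hentry]
    refine HasDerivWithinAt.fun_sum fun b _ => HasDerivWithinAt.fun_sum fun a _ => ?_
    exact ((((hγ.smooth a b).differentiableOn one_ne_zero) τ hτ).hasDerivWithinAt.const_mul
      _).mul_const _
  -- The action conjugates `P⁻¹V` by `C`, so the trace of its square, and with it the length, is
  -- preserved.
  have h1 : (Cᵀ * γ τ * C)⁻¹ * (Cᵀ * velocity γ τ * C) = C⁻¹ * ((γ τ)⁻¹ * velocity γ τ) * C := by
    rw [Matrix.mul_inv_rev, Matrix.mul_inv_rev]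
    simp only [Matrix.mul_assoc]
    rw [Matrix.nonsing_inv_mul_cancel_left _ _ hCt]
  have h2 : (C⁻¹ * ((γ τ)⁻¹ * velocity γ τ) * C) ^ 2 =
      C⁻¹ * ((γ τ)⁻¹ * velocity γ τ) ^ 2 * C := by
    simp only [pow_two, Matrix.mul_assoc]
    rw [Matrix.mul_nonsing_inv_cancel_left _ _ hCu]
  simp only
  rw [hvel, h1, h2, Matrix.trace_mul_comm, ← Matrix.mul_assoc, Matrix.mul_nonsing_inv _ hCu,
    Matrix.one_mul]

/-- The distance is invariant under the action of matrices of determinant `±1`. -/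
theorem symmDist_congr {P Q C : Matrix (Fin n) (Fin n) ℝ} (hC : C.det ^ 2 = 1) :
    symmDist (Cᵀ * P * C) (Cᵀ * Q * C) = symmDist P Q := by
  have hC0 : C.det ≠ 0 := fun h => by simp [h] at hC
  have hCu : IsUnit C.det := isUnit_iff_ne_zero.2 hC0
  have hCt : IsUnit Cᵀ.det := by rwa [Matrix.det_transpose]
  refine le_antisymm (symmDist_congr_le hC) ?_
  have hinv : ∀ A : Matrix (Fin n) (Fin n) ℝ, (C⁻¹)ᵀ * (Cᵀ * A * C) * C⁻¹ = A := fun A => by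
    rw [Matrix.transpose_nonsing_inv]
    simp only [Matrix.mul_assoc]
    rw [Matrix.mul_nonsing_inv _ hCu, Matrix.mul_one, Matrix.nonsing_inv_mul_cancel_left _ _ hCt]
  have h := symmDist_congr_le (P := Cᵀ * P * C) (Q := Cᵀ * Q * C) (C := C⁻¹)
    (by rw [Matrix.det_nonsing_inv, Ring.inverse_eq_inv', inv_pow, hC, inv_one])
  rwa [hinv, hinv] at h

theorem continuousAt_detNormalize {P : Matrix (Fin n) (Fin n) ℝ} (hP : P.det ≠ 0) :
    ContinuousAt detNormalize P :=
  (continuous_id.matrix_det.continuousAt.rpow_const (Or.inl hP)).smul continuousAt_id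

/-- Along a compact family, positive definiteness is stable under small symmetric
perturbations. -/
theorem eventually_posDef {Y Z : Type*} [TopologicalSpace Y] [CompactSpace Y]
    [TopologicalSpace Z] {M : Z → Y → Matrix (Fin n) (Fin n) ℝ} {z₀ : Z}
    (hM : Continuous fun p : Z × Y => M p.1 p.2) (h0 : ∀ y, (M z₀ y).PosDef) :
    ∀ᶠ z in 𝓝 z₀, ∀ y, (M z y)ᵀ = M z y → (M z y).PosDef := by
  -- By homogeneity positivity need only be tested on unit vectors; together with the parameter they
  -- range over a compact set, so a neighbourhood of `z₀` works uniformly.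
  have hK : IsCompact ((univ : Set Y) ×ˢ Metric.sphere (0 : Fin n → ℝ) 1) :=
    isCompact_univ.prod (isCompact_sphere _ _)
  have hq : Continuous fun p : Z × (Y × (Fin n → ℝ)) => p.2.2 ⬝ᵥ (M p.1 p.2.1 *ᵥ p.2.2) := by
    have h1 : Continuous fun p : Z × (Y × (Fin n → ℝ)) => M p.1 p.2.1 :=
      hM.comp (continuous_fst.prodMk (continuous_fst.comp continuous_snd))
    have h2 : Continuous fun p : Z × (Y × (Fin n → ℝ)) => p.2.2 :=
      continuous_snd.comp continuous_snd
    exact h2.dotProduct (h1.matrix_mulVec h2)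
  have hev := hK.eventually_forall_of_forall_eventually (x₀ := z₀)
    (P := fun z p => 0 < p.2 ⬝ᵥ (M z p.1 *ᵥ p.2)) fun p hp => by
      refine hq.continuousAt.eventually_const_lt ?_
      have hp2 : p.2 ≠ 0 := fun h => by simpa [h] using hp.2
      simpa using (h0 p.1).dotProduct_mulVec_pos hp2
  filter_upwards [hev] with z hz y hsym
  refine Matrix.PosDef.of_dotProduct_mulVec_pos (by simpa [Matrix.IsHermitian] using hsym)
    fun x hx => ?_
  have hx' : 0 < ‖x‖ := norm_pos_iff.2 hx
  have h1 := hz (y, ‖x‖⁻¹ • x) ⟨mem_univ _, by simp [norm_smul, hx'.ne']⟩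
  simp only [Matrix.mulVec_smul, smul_dotProduct, dotProduct_smul, smul_eq_mul] at h1
  rw [← mul_assoc] at h1
  simpa using pos_of_mul_pos_right h1 (by positivity)

/-- Uniformity in `y` by compactness; it controls the speed of a perturbed curve at all parameters
at once. -/
theorem eventually_lt_add_of_compactSpace {Y Z : Type*} [TopologicalSpace Y] [CompactSpace Y]
    [TopologicalSpace Z] {G : Z → Y → ℝ} {z₀ : Z}
    (hG : ∀ y, ContinuousAt (fun p : Z × Y => G p.1 p.2) (z₀, y)) {ε : ℝ} (hε : 0 < ε) :
    ∀ᶠ z in 𝓝 z₀, ∀ y, G z y < G z₀ y + ε := by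
  have h := (isCompact_univ (X := Y)).eventually_forall_of_forall_eventually (x₀ := z₀)
    (P := fun z y => G z y < G z₀ y + ε) fun y _ => by
      have h1 : ContinuousAt (fun p : Z × Y => G z₀ p.2) (z₀, y) :=
        ContinuousAt.comp (g := fun p : Z × Y => G p.1 p.2) (f := fun p : Z × Y => (z₀, p.2))
          (hG y) (continuous_const.prodMk continuous_snd).continuousAt
      exact (hG y).eventually_lt (h1.add continuousAt_const) (by simpa using hε)
  simpa using h

/-- The distance is an upper semicontinuous function of the end points. -/
theorem eventually_symmDist_lt (hn : n ≠ 0) {P Q : Matrix (Fin n) (Fin n) ℝ} {c : ENNReal}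
    (h : symmDist P Q < c) :
    ∀ᶠ p in 𝓝 (P, Q), p.1ᵀ = p.1 → p.2ᵀ = p.2 → p.1.det = 1 → p.2.det = 1 →
      symmDist p.1 p.2 < c := by
  simp only [symmDist, iInf_lt_iff] at h
  obtain ⟨γ, hγ, hlt⟩ := h
  obtain ⟨ε, hε, hltε⟩ : ∃ ε : NNReal, 0 < ε ∧ symmLength γ + ε < c :=
    ENNReal.lt_iff_exists_add_pos_lt.1 hlt
  set V := velocity γ with hVdef
  have hV : ∀ τ ∈ Icc (0 : ℝ) 1, ∀ i j,
      HasDerivWithinAt (fun σ => γ σ i j) (V τ i j) (Icc 0 1) τ := fun τ hτ i j =>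
    (((hγ.smooth i j).differentiableOn one_ne_zero) τ hτ).hasDerivWithinAt
  have hγc : Continuous fun τ : Icc (0 : ℝ) 1 => γ τ :=
    continuous_matrix fun i j => (hγ.smooth i j).continuousOn.domRestrict
  have hVc : Continuous fun τ : Icc (0 : ℝ) 1 => V τ :=
    continuous_matrix fun i j => ((hγ.smooth i j).continuousOn_derivWithin
      (uniqueDiffOn_Icc one_pos) le_rfl).domRestrict
  -- A nearly optimal curve from `P` to `Q` is moved by an affine correction to one with end points
  -- `p.1` and `p.2`. It leaves the determinant-one matrices, but stays positive definite for `p`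
  -- near `(P, Q)` and can be normalized.
  let M : Matrix (Fin n) (Fin n) ℝ × Matrix (Fin n) (Fin n) ℝ → ℝ → Matrix (Fin n) (Fin n) ℝ :=
    fun p τ => γ τ + (1 - τ) • (p.1 - P) + τ • (p.2 - Q)
  let W : Matrix (Fin n) (Fin n) ℝ × Matrix (Fin n) (Fin n) ℝ → ℝ → Matrix (Fin n) (Fin n) ℝ :=
    fun p τ => V τ - (p.1 - P) + (p.2 - Q)
  have hM0 : ∀ τ, M (P, Q) τ = γ τ := fun τ => by simp [M]
  have hW0 : ∀ τ, W (P, Q) τ = V τ := fun τ => by simp [W]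
  have hMc : Continuous fun p : (Matrix (Fin n) (Fin n) ℝ × Matrix (Fin n) (Fin n) ℝ) ×
      Icc (0 : ℝ) 1 => M p.1 p.2 := by
    have := hγc.comp (continuous_snd (X := Matrix (Fin n) (Fin n) ℝ × Matrix (Fin n) (Fin n) ℝ))
    simp only [M]
    refine (this.add ?_).add ?_ <;> fun_prop
  have hWc : Continuous fun p : (Matrix (Fin n) (Fin n) ℝ × Matrix (Fin n) (Fin n) ℝ) ×
      Icc (0 : ℝ) 1 => W p.1 p.2 := by
    have := hVc.comp (continuous_snd (X := Matrix (Fin n) (Fin n) ℝ × Matrix (Fin n) (Fin n) ℝ))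
    simp only [W]
    refine (this.sub ?_).add ?_ <;> fun_prop
  -- The speed of the normalized curve, by `normSq_tracelessPart`. It is written as an explicit
  -- function so that its continuity at `(P, Q)` can be checked.
  let G : Matrix (Fin n) (Fin n) ℝ × Matrix (Fin n) (Fin n) ℝ → ℝ → ℝ := fun p τ =>
    Real.sqrt ((((M p τ)⁻¹ * W p τ) ^ 2).trace - ((M p τ)⁻¹ * W p τ).trace ^ 2 / n)
  have hpos := eventually_posDef (M := fun p (τ : Icc (0 : ℝ) 1) => M p τ) (z₀ := (P, Q)) hMc
    fun τ => by simpa [hM0] using hγ.posDef τ τ.2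
  have hGc : ∀ τ : Icc (0 : ℝ) 1, ContinuousAt (fun p : (Matrix (Fin n) (Fin n) ℝ ×
      Matrix (Fin n) (Fin n) ℝ) × Icc (0 : ℝ) 1 => G p.1 p.2) ((P, Q), τ) := fun τ => by
    have h1 : ContinuousAt (fun p : (Matrix (Fin n) (Fin n) ℝ ×
      Matrix (Fin n) (Fin n) ℝ) × Icc (0 : ℝ) 1 => (M p.1 p.2)⁻¹ * W p.1 p.2) ((P, Q), τ) := by
      refine ContinuousAt.mul ?_ hWc.continuousAt
      refine ContinuousAt.comp (g := fun A : Matrix (Fin n) (Fin n) ℝ => A⁻¹)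
        (continuousAt_matrix_inv _ ?_) hMc.continuousAt
      simp only [hM0, Ring.inverse_eq_inv']
      exact continuousAt_inv₀ (hγ.posDef τ τ.2).det_pos.ne'
    have htr : Continuous fun A : Matrix (Fin n) (Fin n) ℝ => A.trace := continuous_id.matrix_trace
    exact Real.continuous_sqrt.continuousAt.comp
      ((htr.continuousAt.comp (h1.pow 2)).sub (((htr.continuousAt.comp h1).pow 2).div_const _))
  have hGev := eventually_lt_add_of_compactSpace
    (G := fun p (τ : Icc (0 : ℝ) 1) => G p τ) hGc (NNReal.coe_pos.2 hε)
  filter_upwards [hpos, hGev] with p hp hGp hs1 hs2 hd1 hd2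
  have hPs : Pᵀ = P := by
    rw [← hγ.source]; exact (hγ.posDef 0 (by simp)).transpose_eq
  have hQs : Qᵀ = Q := by
    rw [← hγ.target]; exact (hγ.posDef 1 (by simp)).transpose_eq
  have hMpos : ∀ τ ∈ Icc (0 : ℝ) 1, (M p τ).PosDef := fun τ hτ => hp ⟨τ, hτ⟩ <| by
    simp [M, hs1, hs2, hPs, hQs, (hγ.posDef τ hτ).transpose_eq]
  have hMder : ∀ τ ∈ Icc (0 : ℝ) 1, ∀ i j,
      HasDerivWithinAt (fun σ => M p σ i j) (W p τ i j) (Icc 0 1) τ := fun τ hτ i j => by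
    have h1 := ((hV τ hτ i j).add (((hasDerivWithinAt_id τ (Icc 0 1)).const_sub 1).mul_const
      ((p.1 - P) i j))).add ((hasDerivWithinAt_id τ (Icc 0 1)).mul_const ((p.2 - Q) i j))
    refine h1.congr_deriv ?_
    simp [W]
    ring
  have hMsm : ∀ i j, ContDiffOn ℝ 1 (fun τ => M p τ i j) (Icc 0 1) := fun i j =>
    ((hγ.smooth i j).add ((contDiffOn_const.sub contDiffOn_id).mul contDiffOn_const)).add
      (contDiffOn_id.mul contDiffOn_const)
  have hle := symmDist_detNormalize_le hn hMsm hMpos hMder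
  have e0 : M p 0 = p.1 := by simp [M, hγ.source]
  have e1 : M p 1 = p.2 := by simp [M, hγ.target]
  rw [e0, e1, detNormalize_of_det_eq_one hd1, detNormalize_of_det_eq_one hd2] at hle
  refine hle.trans_lt (lt_of_le_of_lt ?_ hltε)
  have hεint : (ε : ENNReal) = ∫⁻ _ in Icc (0 : ℝ) 1, (ε : ENNReal) := by simp
  rw [hεint, symmLength, ← lintegral_add_right _ measurable_const]
  refine setLIntegral_mono' measurableSet_Icc fun τ hτ => ?_
  have hsymW : (W p τ)ᵀ = W p τ :=
    transpose_eq_of_hasDerivWithinAt (uniqueDiffOn_Icc one_pos τ hτ) hτ hMpos (hMder τ hτ)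
  rw [Coord.normSq_tracelessPart hn (hMpos τ hτ) hsymW]
  -- At `(P, Q)` dropping the square of the trace only increases the speed, so the original speed
  -- plus `ε` is an upper bound.
  have h2 : G p τ ≤ Real.sqrt (((γ τ)⁻¹ * velocity γ τ) ^ 2).trace + ε := by
    refine (hGp ⟨τ, hτ⟩).le.trans ?_
    have h3 : 0 ≤ ((γ τ)⁻¹ * V τ).trace ^ 2 / n := by positivity
    refine add_le_add_left (Real.sqrt_le_sqrt ?_) _
    rw [hM0, hW0]
    exact sub_le_self _ h3
  calc ENNReal.ofReal (G p τ) ≤ _ := ENNReal.ofReal_le_ofReal h2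
    _ = _ := by rw [ENNReal.ofReal_add (Real.sqrt_nonneg _) ε.coe_nonneg, ENNReal.ofReal_coe_nnreal]

end SymmetricSpace

/-! ### Gram matrices -/

section Gram

variable {n : ℕ}

/-- The matrix of the bilinear form `B` in the images of the standard basis under `D`. -/
noncomputable def gramMatrix (B : EuclideanSpace ℝ (Fin n) →L[ℝ] EuclideanSpace ℝ (Fin n) →L[ℝ] ℝ)
    (D : EuclideanSpace ℝ (Fin n) →ₗ[ℝ] EuclideanSpace ℝ (Fin n)) : Matrix (Fin n) (Fin n) ℝ :=
  Matrix.of fun i j => B (D (EuclideanSpace.single i 1)) (D (EuclideanSpace.single j 1))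

/-- The matrix of an endomorphism of `ℝⁿ` in the standard basis. -/
noncomputable def stdMatrix (F : EuclideanSpace ℝ (Fin n) →ₗ[ℝ] EuclideanSpace ℝ (Fin n)) :
    Matrix (Fin n) (Fin n) ℝ :=
  LinearMap.toMatrix (EuclideanSpace.basisFun (Fin n) ℝ).toBasis
    (EuclideanSpace.basisFun (Fin n) ℝ).toBasis F

theorem det_stdMatrix (F : EuclideanSpace ℝ (Fin n) →ₗ[ℝ] EuclideanSpace ℝ (Fin n)) :
    (stdMatrix F).det = LinearMap.det F :=
  LinearMap.det_toMatrix _ _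

theorem map_single_eq_sum (F : EuclideanSpace ℝ (Fin n) →ₗ[ℝ] EuclideanSpace ℝ (Fin n))
    (i : Fin n) : F (EuclideanSpace.single i 1) =
      ∑ k, stdMatrix F k i • EuclideanSpace.single k (1 : ℝ) := by
  have h := ((EuclideanSpace.basisFun (Fin n) ℝ).toBasis.sum_repr
    (F (EuclideanSpace.single i 1))).symm
  simpa [stdMatrix, LinearMap.toMatrix_apply] using h

theorem gramMatrix_comp (B : EuclideanSpace ℝ (Fin n) →L[ℝ] EuclideanSpace ℝ (Fin n) →L[ℝ] ℝ)
    (D F : EuclideanSpace ℝ (Fin n) →ₗ[ℝ] EuclideanSpace ℝ (Fin n)) :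
    gramMatrix B (D ∘ₗ F) = (stdMatrix F)ᵀ * gramMatrix B D * stdMatrix F := by
  ext i j
  simp only [gramMatrix, Matrix.of_apply, LinearMap.comp_apply, map_single_eq_sum F, map_sum,
    map_smul, Matrix.mul_apply, Matrix.transpose_apply, _root_.sum_apply,
    _root_.smul_apply, smul_eq_mul, Finset.sum_mul, Finset.mul_sum]
  refine Finset.sum_congr rfl fun k _ => Finset.sum_congr rfl fun l _ => ?_
  ring

theorem posDef_gramMatrix
    {B : EuclideanSpace ℝ (Fin n) →L[ℝ] EuclideanSpace ℝ (Fin n) →L[ℝ] ℝ}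
    {D : EuclideanSpace ℝ (Fin n) →ₗ[ℝ] EuclideanSpace ℝ (Fin n)} (hs : ∀ v w, B v w = B w v)
    (hp : ∀ v, v ≠ 0 → 0 < B v v) (hD : Function.Injective D) : (gramMatrix B D).PosDef := by
  refine Matrix.PosDef.of_dotProduct_mulVec_pos ?_ fun x hx => ?_
  · ext i j
    simp [gramMatrix, hs]
  have hv : D (∑ i, x i • EuclideanSpace.single i (1 : ℝ)) ≠ 0 := by
    rw [map_ne_zero_iff _ hD]
    intro h0
    refine hx (funext fun i => ?_)
    have := congrArg (fun v : EuclideanSpace ℝ (Fin n) => v i) h0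
    simpa [Finset.sum_apply, Pi.single_apply] using this
  refine (hp _ hv).trans_eq ?_
  simp only [gramMatrix, dotProduct, Matrix.mulVec, Finset.mul_sum, _root_.sum_apply, map_sum,
    map_smul, _root_.smul_apply, Matrix.of_apply, star_trivial, smul_eq_mul]
  exact Finset.sum_congr rfl fun j _ => Finset.sum_congr rfl fun i _ => by rw [hs]; ring

end Gram

/-! ### Components of tensors in charts -/

section Charts

variable {n : ℕ} {X : Type*} [TopologicalSpace X] [ChartedSpace (EuclideanSpace ℝ (Fin n)) X]

/-- The differential of the inverse of a chart, all tangent spaces being identified with `ℝⁿ`. -/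
noncomputable def chartDeriv (e : OpenPartialHomeomorph X (EuclideanSpace ℝ (Fin n)))
    (y : EuclideanSpace ℝ (Fin n)) : EuclideanSpace ℝ (Fin n) →L[ℝ] EuclideanSpace ℝ (Fin n) :=
  mfderiv (𝓡 n) (𝓡 n) e.symm y

/-- The value at a point of a tensor field, all tangent spaces being identified with `ℝⁿ`. -/
def tensorAt (T : Cov2Tensor n X) (x : X) :
    EuclideanSpace ℝ (Fin n) →L[ℝ] EuclideanSpace ℝ (Fin n) →L[ℝ] ℝ := T x

theorem components_eq_gramMatrix (e : OpenPartialHomeomorph X (EuclideanSpace ℝ (Fin n)))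
    (T : Cov2Tensor n X) (y : EuclideanSpace ℝ (Fin n)) :
    components e T y = gramMatrix (tensorAt T (e.symm y)) (chartDeriv e y) := rfl

theorem components_transpose (e : OpenPartialHomeomorph X (EuclideanSpace ℝ (Fin n)))
    {T : Cov2Tensor n X} (hT : ∀ (x : X) (v w : TangentSpace (𝓡 n) x), T x v w = T x w v)
    (y : EuclideanSpace ℝ (Fin n)) : (components e T y)ᵀ = components e T y := by
  ext i j
  exact hT _ _ _

theorem continuousOn_sqrt_det {e : OpenPartialHomeomorph X (EuclideanSpace ℝ (Fin n))}
    {h : Cov2Tensor n X}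
    (hc : ∀ i j, ContinuousOn (fun y => components e h y i j) e.target) :
    ContinuousOn (fun y => Real.sqrt (components e h y).det) e.target :=
  Real.continuous_sqrt.comp_continuousOn ((continuous_id.matrix_det).comp_continuousOn
    (continuousOn_pi.2 fun i => continuousOn_pi.2 fun j => hc i j))

variable [IsManifold (𝓡 n) ∞ X]

theorem chartDeriv_injective {e : OpenPartialHomeomorph X (EuclideanSpace ℝ (Fin n))}
    (he : e ∈ atlas (EuclideanSpace ℝ (Fin n)) X) {y : EuclideanSpace ℝ (Fin n)}
    (hy : y ∈ e.target) : Function.Injective (chartDeriv e y) :=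
  (mdifferentiable_of_mem_atlas (I := 𝓡 n) he).symm.mfderiv_injective hy

theorem chartDeriv_surjective {e : OpenPartialHomeomorph X (EuclideanSpace ℝ (Fin n))}
    (he : e ∈ atlas (EuclideanSpace ℝ (Fin n)) X) {y : EuclideanSpace ℝ (Fin n)}
    (hy : y ∈ e.target) : Function.Surjective (chartDeriv e y) :=
  (mdifferentiable_of_mem_atlas (I := 𝓡 n) he).symm.mfderiv_surjective hy

theorem differentiableAt_transition {e e' : OpenPartialHomeomorph X (EuclideanSpace ℝ (Fin n))}
    (he : e ∈ atlas (EuclideanSpace ℝ (Fin n)) X) (he' : e' ∈ atlas (EuclideanSpace ℝ (Fin n)) X)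
    {y : EuclideanSpace ℝ (Fin n)} (hy : y ∈ e.target) (hy' : e.symm y ∈ e'.source) :
    DifferentiableAt ℝ (e' ∘ e.symm) y :=
  (MDifferentiableAt.comp (I := 𝓡 n) (I' := 𝓡 n) (I'' := 𝓡 n) y
    (mdifferentiableAt_atlas he' hy') (mdifferentiableAt_atlas_symm he hy)).differentiableAt

/-- The chain rule for `e⁻¹ = e'⁻¹ ∘ (e' ∘ e⁻¹)`, an identity valid near `y` only. All
transformation laws below rest on it. -/
theorem chartDeriv_eq_comp {e e' : OpenPartialHomeomorph X (EuclideanSpace ℝ (Fin n))}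
    (he : e ∈ atlas (EuclideanSpace ℝ (Fin n)) X) (he' : e' ∈ atlas (EuclideanSpace ℝ (Fin n)) X)
    {y : EuclideanSpace ℝ (Fin n)} (hy : y ∈ e.target) (hy' : e.symm y ∈ e'.source) :
    chartDeriv e y = (chartDeriv e' (e' (e.symm y))).comp (fderiv ℝ (e' ∘ e.symm) y) := by
  have h1 : MDifferentiableAt (𝓡 n) (𝓡 n) (e' ∘ e.symm) y :=
    (differentiableAt_transition he he' hy hy').mdifferentiableAt
  have h2 : MDifferentiableAt (𝓡 n) (𝓡 n) e'.symm ((e' ∘ e.symm) y) :=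
    mdifferentiableAt_atlas_symm he' (e'.map_source hy')
  have h3 := mfderiv_comp y h2 h1
  rw [mfderiv_eq_fderiv] at h3
  have h4 : e.symm =ᶠ[𝓝 y] e'.symm ∘ e' ∘ e.symm := by
    filter_upwards [(e.continuousAt_symm hy).preimage_mem_nhds (e'.open_source.mem_nhds hy')]
      with z hz using (e'.left_inv hz).symm
  have h5 := h4.mfderiv_eq (I := 𝓡 n) (I' := 𝓡 n)
  exact h5.trans h3

/-- The Jacobian matrix of the change of charts from `e` to `e'`. -/
noncomputable def jacobian (e e' : OpenPartialHomeomorph X (EuclideanSpace ℝ (Fin n)))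
    (y : EuclideanSpace ℝ (Fin n)) : Matrix (Fin n) (Fin n) ℝ :=
  stdMatrix (fderiv ℝ (e' ∘ e.symm) y)

theorem components_change {e e' : OpenPartialHomeomorph X (EuclideanSpace ℝ (Fin n))}
    (he : e ∈ atlas (EuclideanSpace ℝ (Fin n)) X) (he' : e' ∈ atlas (EuclideanSpace ℝ (Fin n)) X)
    (T : Cov2Tensor n X) {y : EuclideanSpace ℝ (Fin n)} (hy : y ∈ e.target)
    (hy' : e.symm y ∈ e'.source) :
    components e T y =
      (jacobian e e' y)ᵀ * components e' T (e' (e.symm y)) * jacobian e e' y := by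
  rw [components_eq_gramMatrix, components_eq_gramMatrix, jacobian, ← gramMatrix_comp,
    e'.left_inv hy', chartDeriv_eq_comp he he' hy hy']
  rfl

theorem det_jacobian_ne_zero {e e' : OpenPartialHomeomorph X (EuclideanSpace ℝ (Fin n))}
    (he : e ∈ atlas (EuclideanSpace ℝ (Fin n)) X) (he' : e' ∈ atlas (EuclideanSpace ℝ (Fin n)) X)
    {y : EuclideanSpace ℝ (Fin n)} (hy : y ∈ e.target) (hy' : e.symm y ∈ e'.source) :
    (jacobian e e' y).det ≠ 0 := by
  have h := chartDeriv_injective he hy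
  rw [chartDeriv_eq_comp he he' hy hy'] at h
  have hi : Function.Injective (fderiv ℝ (e' ∘ e.symm) y) := Function.Injective.of_comp h
  rw [jacobian, det_stdMatrix]
  exact (LinearMap.isUnit_iff_isUnit_det _).1
    ((LinearMap.isUnit_iff_ker_eq_bot _).2 (LinearMap.ker_eq_bot.2 hi)) |>.ne_zero

theorem posDef_components {e : OpenPartialHomeomorph X (EuclideanSpace ℝ (Fin n))}
    (he : e ∈ atlas (EuclideanSpace ℝ (Fin n)) X) (h : SmoothMetric n X)
    {y : EuclideanSpace ℝ (Fin n)} (hy : y ∈ e.target) : (components e h.inner y).PosDef :=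
  posDef_gramMatrix (fun v w => h.symm (e.symm y) v w) (fun v hv => h.pos (e.symm y) v hv)
    (chartDeriv_injective he hy)

/-- A finite smooth partition of unity subordinate to charts. -/
theorem exists_partitionOfUnity [T2Space X] [CompactSpace X] :
    ∃ (t : Finset X) (ρ : X → X → ℝ), (∀ i ∈ t, ContMDiff (𝓡 n) 𝓘(ℝ) ∞ (ρ i)) ∧
      (∀ i ∈ t, ∀ x, 0 ≤ ρ i x) ∧ (∀ x, ∑ i ∈ t, ρ i x = 1) ∧
      ∀ i ∈ t, tsupport (ρ i) ⊆ (chartAt (EuclideanSpace ℝ (Fin n)) i).source := by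
  classical
  obtain ⟨t, ht⟩ := isCompact_univ.elim_nhds_subcover
    (fun x : X => (chartAt (EuclideanSpace ℝ (Fin n)) x).source)
    (fun x _ => chart_source_mem_nhds _ x)
  obtain ⟨f, hf⟩ := SmoothPartitionOfUnity.exists_isSubordinate (ι := t) (𝓡 n)
    (isClosed_univ (X := X))
    (fun i : t => (chartAt (EuclideanSpace ℝ (Fin n)) (i : X)).source)
    (fun i => (chartAt _ _).open_source) (by simpa [iUnion_subtype] using ht.2)
  -- The functions are indexed by points of `X`, with value zero off `t`, so that each one is
  -- labelled by the centre of its chart.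
  refine ⟨t, fun i => if hi : i ∈ t then f ⟨i, hi⟩ else 0, fun i hi => ?_, fun i hi x => ?_,
    fun x => ?_, fun i hi => ?_⟩
  · simpa [hi] using (f ⟨i, hi⟩).contMDiff
  · simpa [hi] using f.nonneg ⟨i, hi⟩ x
  · have h1 := f.sum_eq_one (mem_univ x)
    rw [finsum_eq_sum_of_fintype] at h1
    rw [← h1, ← Finset.sum_coe_sort t]
    exact Finset.sum_congr rfl fun i _ => by simp
  · simpa [hi] using hf ⟨i, hi⟩

end Charts

/-! ### The Riemannian measure -/

section Volume

variable {n : ℕ} {X : Type*} [TopologicalSpace X] [ChartedSpace (EuclideanSpace ℝ (Fin n)) X]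
  [MeasurableSpace X]

/-- The Riemannian measure on the domain of a chart. -/
noncomputable def chartVolume (e : OpenPartialHomeomorph X (EuclideanSpace ℝ (Fin n)))
    (h : Cov2Tensor n X) : Measure X :=
  ((volume.restrict e.target).withDensity
      (fun y => ENNReal.ofReal (Real.sqrt (components e h y).det))).map e.symm

theorem riemannianVolume_eq_iSup (h : Cov2Tensor n X) :
    riemannianVolume h = ⨆ e ∈ atlas (EuclideanSpace ℝ (Fin n)) X, chartVolume e h := rfl

theorem chartVolume_le_riemannianVolume {e : OpenPartialHomeomorph X (EuclideanSpace ℝ (Fin n))}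
    (he : e ∈ atlas (EuclideanSpace ℝ (Fin n)) X) (h : Cov2Tensor n X) :
    chartVolume e h ≤ riemannianVolume h :=
  le_iSup₂_of_le (f := fun e _ => chartVolume e h) e he le_rfl

variable [BorelSpace X]

theorem aemeasurable_chart_symm {X : Type*} [TopologicalSpace X] [MeasurableSpace X] [BorelSpace X]
    (e : OpenPartialHomeomorph X (EuclideanSpace ℝ (Fin n)))
    (f : EuclideanSpace ℝ (Fin n) → ENNReal) :
    AEMeasurable e.symm ((volume.restrict e.target).withDensity f) :=
  (e.continuousOn_symm.aemeasurable e.open_target.measurableSet).mono_ac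
    (withDensity_absolutelyContinuous _ _)

/-- The inverse chart is continuous on the target only, so measurability is obtained in the subtype
and transported back. -/
theorem measurableSet_target_inter_preimage {X : Type*} [TopologicalSpace X] [MeasurableSpace X]
    [BorelSpace X]
    (e : OpenPartialHomeomorph X (EuclideanSpace ℝ (Fin n))) {A : Set X} (hA : MeasurableSet A) :
    MeasurableSet (e.symm ⁻¹' A ∩ e.target) := by
  have h1 : Measurable (e.target.domRestrict e.symm) := e.continuousOn_symm.domRestrict.measurable
  have h2 := e.open_target.measurableSet.subtype_image (h1 hA)
  convert h2 using 1
  ext y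
  simp [domRestrict, and_comm]

theorem chartVolume_apply (e : OpenPartialHomeomorph X (EuclideanSpace ℝ (Fin n)))
    (h : Cov2Tensor n X) {A : Set X} (hA : MeasurableSet A) :
    chartVolume e h A = ∫⁻ y in e.symm ⁻¹' A ∩ e.target,
      ENNReal.ofReal (Real.sqrt (components e h y).det) := by
  rw [chartVolume, Measure.map_apply_of_aemeasurable (aemeasurable_chart_symm e _) hA,
    withDensity_apply', Measure.restrict_restrict' e.open_target.measurableSet]

theorem chartVolume_compl_source (e : OpenPartialHomeomorph X (EuclideanSpace ℝ (Fin n)))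
    (h : Cov2Tensor n X) : chartVolume e h e.sourceᶜ = 0 := by
  rw [chartVolume_apply e h e.open_source.measurableSet.compl]
  have : e.symm ⁻¹' e.sourceᶜ ∩ e.target = ∅ := by
    ext y
    simp only [mem_inter_iff, mem_preimage, mem_compl_iff, mem_empty_iff_false, iff_false, not_and]
    intro hy h'
    exact hy (e.map_target h')
  rw [this]
  simp

theorem chartVolume_inter_source (e : OpenPartialHomeomorph X (EuclideanSpace ℝ (Fin n)))
    (h : Cov2Tensor n X) (A : Set X) : chartVolume e h (A ∩ e.source) = chartVolume e h A :=
  measure_inter_conull (chartVolume_compl_source e h)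

variable [IsManifold (𝓡 n) ∞ X]

/-- In the change of variables by `e' ∘ e⁻¹` the factor `|det J|` is absorbed by `det(Jᵀ h J) = (det
J)² det h`. -/
theorem chartVolume_congr {e e' : OpenPartialHomeomorph X (EuclideanSpace ℝ (Fin n))}
    (he : e ∈ atlas (EuclideanSpace ℝ (Fin n)) X) (he' : e' ∈ atlas (EuclideanSpace ℝ (Fin n)) X)
    (h : Cov2Tensor n X) {A : Set X} (hA : MeasurableSet A) (hAe : A ⊆ e.source)
    (hAe' : A ⊆ e'.source) : chartVolume e h A = chartVolume e' h A := by
  rw [chartVolume_apply e h hA, chartVolume_apply e' h hA]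
  have himg : e'.symm ⁻¹' A ∩ e'.target = (e' ∘ e.symm) '' (e.symm ⁻¹' A ∩ e.target) := by
    ext y
    constructor
    · rintro ⟨h1, h2⟩
      refine ⟨e (e'.symm y), ⟨?_, e.map_source (hAe h1)⟩, ?_⟩
      · simpa [e.left_inv (hAe h1)] using h1
      · simp [e.left_inv (hAe h1), e'.right_inv h2]
    · rintro ⟨z, ⟨h1, h2⟩, rfl⟩
      exact ⟨by simpa [e'.left_inv (hAe' h1)] using h1, e'.map_source (hAe' h1)⟩
  have hinj : InjOn (e' ∘ e.symm) (e.symm ⁻¹' A ∩ e.target) := fun y hy z hz hyz =>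
    e.symm.injOn hy.2 hz.2 (e'.injOn (hAe' hy.1) (hAe' hz.1) hyz)
  rw [himg, lintegral_image_eq_lintegral_abs_det_fderiv_mul volume
    (measurableSet_target_inter_preimage e hA) (f' := fun y => fderiv ℝ (e' ∘ e.symm) y)
    (fun y hy => (differentiableAt_transition he he' hy.2
      (hAe' hy.1)).hasFDerivAt.hasFDerivWithinAt) hinj]
  refine setLIntegral_congr_fun (measurableSet_target_inter_preimage e hA) fun y hy => ?_
  have hdet : (fderiv ℝ (e' ∘ e.symm) y).det = (jacobian e e' y).det := by
    rw [jacobian, det_stdMatrix]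
  simp only [Function.comp_apply]
  rw [components_change he he' h hy.2 (hAe' hy.1), hdet, ← ENNReal.ofReal_mul (abs_nonneg _),
    Matrix.det_mul, Matrix.det_mul, Matrix.det_transpose, ← Real.sqrt_sq_eq_abs, ← Real.sqrt_mul
    (sq_nonneg _)]
  congr 2
  ring

/-- The Riemannian measure agrees with `√(det hᵢⱼ) dy` on the domain of each chart. -/
theorem riemannianVolume_apply_of_subset [T2Space X] [CompactSpace X]
    {e : OpenPartialHomeomorph X (EuclideanSpace ℝ (Fin n))}
    (he : e ∈ atlas (EuclideanSpace ℝ (Fin n)) X) (h : Cov2Tensor n X) {A : Set X}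
    (hA : MeasurableSet A) (hAe : A ⊆ e.source) :
    riemannianVolume h A = chartVolume e h A := by
  obtain ⟨t, ρ, hsm, hnn, hsum, hsupp⟩ := exists_partitionOfUnity (n := n) (X := X)
  have hmeas : ∀ i ∈ t, Measurable fun x => ENNReal.ofReal (ρ i x) := fun i hi =>
    (hsm i hi).continuous.measurable.ennreal_ofReal
  have hsum' : ∀ x, ∑ i ∈ t, ENNReal.ofReal (ρ i x) = 1 := fun x => by
    rw [← ENNReal.ofReal_sum_of_nonneg fun i hi => hnn i hi x, hsum, ENNReal.ofReal_one]
  -- A measure glued from the chart measures by the partition of unity. It agrees with each chart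
  -- measure on the domain of that chart, hence dominates them all and therefore their supremum; the
  -- other inequality is built into the supremum.
  set ν : Measure X := ∑ i ∈ t, (chartVolume (chartAt (EuclideanSpace ℝ (Fin n)) i) h).withDensity
    (fun x => ENNReal.ofReal (ρ i x)) with hν
  have hνapply : ∀ {e' : OpenPartialHomeomorph X (EuclideanSpace ℝ (Fin n))}
      (_ : e' ∈ atlas (EuclideanSpace ℝ (Fin n)) X) {B : Set X} (_ : MeasurableSet B)
      (_ : B ⊆ e'.source), ν B = chartVolume e' h B := by
    intro e' he' B hB hBe
    have h1 : ∀ i ∈ t, ((chartVolume (chartAt (EuclideanSpace ℝ (Fin n)) i) h).withDensity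
        (fun x => ENNReal.ofReal (ρ i x))) B =
        ∫⁻ x in B, ENNReal.ofReal (ρ i x) ∂chartVolume e' h := fun i hi => by
      rw [withDensity_apply _ hB]
      set c := chartAt (EuclideanSpace ℝ (Fin n)) i
      have hBc : MeasurableSet (B ∩ c.source) := hB.inter c.open_source.measurableSet
      -- Since `ρ i` vanishes off the domain of `c`, only the overlap of the two charts matters, and
      -- there the two chart measures coincide.
      have hzero : ∀ m : Measure X, ∫⁻ x in B, ENNReal.ofReal (ρ i x) ∂m =
          ∫⁻ x in B ∩ c.source, ENNReal.ofReal (ρ i x) ∂m := fun m => by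
        rw [← lintegral_inter_add_sdiff (fun x => ENNReal.ofReal (ρ i x)) B
          c.open_source.measurableSet]
        rw [setLIntegral_congr_fun (s := B \ c.source) (g := fun _ => 0)
          (hB.diff c.open_source.measurableSet)]
        · simp
        · intro x hx
          have : ρ i x = 0 := by
            by_contra h0
            exact hx.2 (hsupp i hi (subset_tsupport _ h0))
          simp [this]
      have hrestr : (chartVolume c h).restrict (B ∩ c.source) =
          (chartVolume e' h).restrict (B ∩ c.source) := by
        ext S hS
        rw [Measure.restrict_apply hS, Measure.restrict_apply hS]
        exact chartVolume_congr (chart_mem_atlas _ _) he' h (hS.inter hBc)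
          (fun x hx => hx.2.2) (fun x hx => hBe hx.2.1)
      rw [hzero, hzero, hrestr]
    rw [hν, Measure.finsetSum_apply, Finset.sum_congr rfl h1, ← lintegral_finsetSum' _
      fun i hi => (hmeas i hi).aemeasurable]
    simp [hsum']
  have hle : riemannianVolume h ≤ ν := by
    rw [riemannianVolume_eq_iSup]
    refine iSup₂_le fun e' he' => Measure.le_iff.2 fun B hB => ?_
    rw [← chartVolume_inter_source, ← hνapply he' (hB.inter e'.open_source.measurableSet)
      inter_subset_right]
    exact measure_mono inter_subset_left
  refine le_antisymm ((hle A).trans_eq (hνapply he hA hAe)) ?_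
  exact chartVolume_le_riemannianVolume he h A

theorem riemannianVolume_restrict_source [T2Space X] [CompactSpace X]
    {e : OpenPartialHomeomorph X (EuclideanSpace ℝ (Fin n))}
    (he : e ∈ atlas (EuclideanSpace ℝ (Fin n)) X) (h : Cov2Tensor n X) :
    (riemannianVolume h).restrict e.source = chartVolume e h := by
  ext A hA
  rw [Measure.restrict_apply hA, riemannianVolume_apply_of_subset he h
    (hA.inter e.open_source.measurableSet) inter_subset_right, chartVolume_inter_source]

/-- The supports of a finite partition of unity cover `X`, and each is compact in a chart where the
density is continuous. -/
theorem isFiniteMeasure_riemannianVolume [T2Space X] [CompactSpace X] {h : Cov2Tensor n X}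
    (hc : ∀ e ∈ atlas (EuclideanSpace ℝ (Fin n)) X, ∀ i j,
      ContinuousOn (fun y => components e h y i j) e.target) :
    IsFiniteMeasure (riemannianVolume h) := by
  obtain ⟨t, ρ, hsm, hnn, hsum, hsupp⟩ := exists_partitionOfUnity (n := n) (X := X)
  have hcov : (univ : Set X) ⊆ ⋃ i ∈ t, tsupport (ρ i) := fun x _ => by
    obtain ⟨i, hi, h0⟩ := Finset.exists_ne_zero_of_sum_ne_zero ((hsum x).trans_ne one_ne_zero)
    exact mem_biUnion hi (subset_tsupport _ h0)
  refine ⟨(measure_mono hcov).trans_lt ((measure_biUnion_finset_le _ _).trans_lt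
    (ENNReal.sum_lt_top.2 fun i hi => ?_))⟩
  set c := chartAt (EuclideanSpace ℝ (Fin n)) i with hcdef
  have hcm : c ∈ atlas (EuclideanSpace ℝ (Fin n)) X := chart_mem_atlas _ _
  have hK : IsCompact (tsupport (ρ i)) := (isClosed_tsupport _).isCompact
  rw [riemannianVolume_apply_of_subset hcm h (isClosed_tsupport _).measurableSet (hsupp i hi),
    chartVolume_apply c h (isClosed_tsupport _).measurableSet]
  have himg : c.symm ⁻¹' tsupport (ρ i) ∩ c.target = c '' tsupport (ρ i) := by
    rw [c.image_eq_target_inter_inv_preimage (hsupp i hi), inter_comm]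
  rw [himg]
  have hcomp : IsCompact (c '' tsupport (ρ i)) :=
    hK.image_of_continuousOn (c.continuousOn.mono (hsupp i hi))
  exact (((continuousOn_sqrt_det (hc c hcm)).mono (by
    rw [← himg]; exact inter_subset_right)).integrableOn_compact hcomp).lintegral_lt_top

/-- The integral of a function supported in the domain of a chart. -/
theorem integral_riemannianVolume [T2Space X] [CompactSpace X]
    {e : OpenPartialHomeomorph X (EuclideanSpace ℝ (Fin n))}
    (he : e ∈ atlas (EuclideanSpace ℝ (Fin n)) X) {h : Cov2Tensor n X}
    (hc : ∀ i j, ContinuousOn (fun y => components e h y i j) e.target) {φ : X → ℝ}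
    (hφ : AEStronglyMeasurable φ (riemannianVolume h)) (h0 : ∀ x, x ∉ e.source → φ x = 0) :
    ∫ x, φ x ∂riemannianVolume h =
      ∫ y in e.target, Real.sqrt (components e h y).det * φ (e.symm y) := by
  rw [← setIntegral_eq_integral_of_forall_compl_eq_zero h0, riemannianVolume_restrict_source he,
    chartVolume, integral_map (aemeasurable_chart_symm e _), 
    integral_withDensity_eq_integral_toReal_smul₀]
  · refine integral_congr_ae (Eventually.of_forall fun y => ?_)
    simp [ENNReal.toReal_ofReal (Real.sqrt_nonneg _)]
  · exact ((continuousOn_sqrt_det hc).aemeasurable e.open_target.measurableSet).ennreal_ofReal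
  · exact Eventually.of_forall fun y => ENNReal.ofReal_lt_top
  · exact hφ.mono_measure (chartVolume_le_riemannianVolume he h)

end Volume

/-! ### The Laplacian in coordinates -/

namespace Coord

variable {n : ℕ}

/-- The Laplacian `Δf = gⁱʲ f_{;ij}`. -/
noncomputable def laplacian (g : EuclideanSpace ℝ (Fin n) → Matrix (Fin n) (Fin n) ℝ)
    (f : EuclideanSpace ℝ (Fin n) → ℝ) (y : EuclideanSpace ℝ (Fin n)) : ℝ :=
  ∑ i, ∑ j, (g y)⁻¹ i j * hessian g f i j y

/-- The density `√(det g) gⁱʲ ∂ⱼf`. -/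
noncomputable def flux (g : EuclideanSpace ℝ (Fin n) → Matrix (Fin n) (Fin n) ℝ)
    (f : EuclideanSpace ℝ (Fin n) → ℝ) (i : Fin n) (y : EuclideanSpace ℝ (Fin n)) : ℝ :=
  Real.sqrt (g y).det * ∑ j, (g y)⁻¹ i j * pd j f y

theorem pd_eq_of_hasLineDerivAt {F : EuclideanSpace ℝ (Fin n) → ℝ} {y : EuclideanSpace ℝ (Fin n)}
    {k : Fin n} {F' : ℝ} (hF : DifferentiableAt ℝ F y)
    (h : HasLineDerivAt ℝ F F' y (EuclideanSpace.single k 1)) : pd k F y = F' := by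
  rw [pd, ← hF.lineDeriv_eq_fderiv, h.lineDeriv]

theorem hasLineDerivAt_pd {F : EuclideanSpace ℝ (Fin n) → ℝ} {y : EuclideanSpace ℝ (Fin n)}
    (k : Fin n) (hF : DifferentiableAt ℝ F y) :
    HasLineDerivAt ℝ F (pd k F y) y (EuclideanSpace.single k 1) :=
  hF.hasFDerivAt.hasLineDerivAt _

theorem contDiffOn_pd {f : EuclideanSpace ℝ (Fin n) → ℝ} {U : Set (EuclideanSpace ℝ (Fin n))}
    (hU : IsOpen U) (hf : ContDiffOn ℝ ∞ f U) (k : Fin n) : ContDiffOn ℝ ∞ (pd k f) U :=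
  (hf.fderiv_of_isOpen (m := ∞) hU (by simp)).clm_apply contDiffOn_const

theorem contDiffOn_sqrt_det {g : EuclideanSpace ℝ (Fin n) → Matrix (Fin n) (Fin n) ℝ}
    {U : Set (EuclideanSpace ℝ (Fin n))}
    (hg : ∀ i j, ContDiffOn ℝ ∞ (fun z => g z i j) U) (hpos : ∀ z ∈ U, (g z).PosDef) :
    ContDiffOn ℝ ∞ (fun z => Real.sqrt (g z).det) U :=
  (contDiffOn_det hg).sqrt fun z hz => (hpos z hz).det_pos.ne'

theorem contDiffOn_flux {g : EuclideanSpace ℝ (Fin n) → Matrix (Fin n) (Fin n) ℝ}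
    {f : EuclideanSpace ℝ (Fin n) → ℝ} {U : Set (EuclideanSpace ℝ (Fin n))} (hU : IsOpen U)
    (hg : ∀ i j, ContDiffOn ℝ ∞ (fun z => g z i j) U) (hpos : ∀ z ∈ U, (g z).PosDef)
    (hf : ContDiffOn ℝ ∞ f U) (i : Fin n) : ContDiffOn ℝ ∞ (flux g f i) U :=
  (contDiffOn_sqrt_det hg hpos).mul (ContDiffOn.sum fun j _ =>
    (contDiffOn_inv_apply hg (fun z hz => (hpos z hz).det_pos.ne') i j).mul
      (contDiffOn_pd hU hf j))

/-- The algebraic identity behind the divergence form of the Laplacian: `G` is the inverse metric,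
`D` are the derivatives of the metric. -/
theorem divergence_form_identity {G : Matrix (Fin n) (Fin n) ℝ}
    {D : Fin n → Matrix (Fin n) (Fin n) ℝ} (hG : Gᵀ = G) (hD : ∀ k, (D k)ᵀ = D k) (k : Fin n) :
    ∑ i, ∑ j, G i j * (1 / 2 * ∑ l, G k l * (D i j l + D j i l - D l i j)) =
      ∑ i, ((G * D i * G) i k - 1 / 2 * (G * D i).trace * G i k) := by
  have hG' : ∀ i j, G i j = G j i := fun i j => congrFun (congrFun hG.symm i) j
  have hD' : ∀ k i j, D k i j = D k j i := fun k i j => congrFun (congrFun (hD k).symm i) j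
  have h1 : ∑ i, (G * D i * G) i k = ∑ i, ∑ j, ∑ l, G i j * G k l * D i j l := by
    refine Finset.sum_congr rfl fun i _ => ?_
    simp only [Matrix.mul_apply, Finset.sum_mul]
    rw [Finset.sum_comm]
    exact Finset.sum_congr rfl fun j _ => Finset.sum_congr rfl fun l _ => by rw [hG' k l]; ring
  -- The first two terms of the Christoffel symbol have the same contraction with the symmetric `G`.
  have h1' : ∑ i, ∑ j, ∑ l, G i j * G k l * D j i l = ∑ i, ∑ j, ∑ l, G i j * G k l * D i j l := by
    rw [Finset.sum_comm]
    exact Finset.sum_congr rfl fun j _ => Finset.sum_congr rfl fun i _ =>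
      Finset.sum_congr rfl fun l _ => by rw [hG' i j]
  have h2 : ∑ l, (G * D l).trace * G l k = ∑ i, ∑ j, ∑ l, G i j * G k l * D l i j := by
    simp only [Matrix.trace, Matrix.diag, Matrix.mul_apply, Finset.sum_mul]
    rw [Finset.sum_comm]
    refine Finset.sum_congr rfl fun i _ => ?_
    rw [Finset.sum_comm]
    exact Finset.sum_congr rfl fun j _ => Finset.sum_congr rfl fun l _ => by
      rw [hG' k l, hD' l i j]; ring
  have h3 : ∑ i, ∑ j, G i j * (1 / 2 * ∑ l, G k l * (D i j l + D j i l - D l i j)) =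
      1 / 2 * (∑ i, ∑ j, ∑ l, G i j * G k l * D i j l + ∑ i, ∑ j, ∑ l, G i j * G k l * D j i l
        - ∑ i, ∑ j, ∑ l, G i j * G k l * D l i j) := by
    simp only [Finset.mul_sum, ← Finset.sum_add_distrib, ← Finset.sum_sub_distrib]
    exact Finset.sum_congr rfl fun i _ => Finset.sum_congr rfl fun j _ =>
      Finset.sum_congr rfl fun l _ => by ring
  rw [h3, h1', ← h1, ← h2, Finset.sum_sub_distrib]
  simp only [mul_assoc, ← Finset.mul_sum]
  ring

/-- The product rule along the `i`-th coordinate line: `∂√det g = ½ √det g · tr(g⁻¹D)` and `∂g⁻¹ =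
-g⁻¹Dg⁻¹`. -/
theorem pd_flux {g : EuclideanSpace ℝ (Fin n) → Matrix (Fin n) (Fin n) ℝ}
    {f : EuclideanSpace ℝ (Fin n) → ℝ} {U : Set (EuclideanSpace ℝ (Fin n))} (hU : IsOpen U)
    (hg : ∀ i j, ContDiffOn ℝ ∞ (fun z => g z i j) U) (hpos : ∀ z ∈ U, (g z).PosDef)
    (hf : ContDiffOn ℝ ∞ f U) {y : EuclideanSpace ℝ (Fin n)} (hy : y ∈ U)
    {i : Fin n} {D : Matrix (Fin n) (Fin n) ℝ} (hD : ∀ a b, D a b = pd i (fun z => g z a b) y) :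
    pd i (flux g f i) y = Real.sqrt (g y).det *
      ∑ j, ((g y)⁻¹ i j * pd i (pd j f) y - (((g y)⁻¹ * D * (g y)⁻¹) i j
        - 1 / 2 * ((g y)⁻¹ * D).trace * (g y)⁻¹ i j) * pd j f y) := by
  have hdiff : ∀ {F : EuclideanSpace ℝ (Fin n) → ℝ}, ContDiffOn ℝ ∞ F U → DifferentiableAt ℝ F y :=
    fun hF => (hF.contDiffAt (hU.mem_nhds hy)).differentiableAt (by simp)
  have hdet := (hpos y hy).det_pos
  refine pd_eq_of_hasLineDerivAt (hdiff (contDiffOn_flux hU hg hpos hf i)) ?_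
  have hline : ∀ a b, HasDerivWithinAt
      (fun τ : ℝ => g (y + τ • EuclideanSpace.single i (1 : ℝ)) a b) (D a b) univ 0 :=
    fun a b => by
      rw [hD]
      exact (hasLineDerivAt_pd i (hdiff (hg a b))).hasDerivWithinAt
  have h0 : y + (0 : ℝ) • EuclideanSpace.single i (1 : ℝ) = y := by simp
  have hd := (hasDerivWithinAt_det_of_ne_zero hline (by rw [h0]; exact hdet.ne')).sqrt
    (by rw [h0]; exact hdet.ne')
  have hi := fun a b => hasDerivWithinAt_inv_apply hline (by rw [h0]; exact hdet.ne')
    uniqueDiffWithinAt_univ a b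
  have hw : ∀ j, HasDerivWithinAt
      (fun τ : ℝ => pd j f (y + τ • EuclideanSpace.single i (1 : ℝ))) (pd i (pd j f) y) univ 0 :=
    fun j => (hasLineDerivAt_pd i (hdiff (contDiffOn_pd hU hf j))).hasDerivWithinAt
  have hprod := hd.fun_mul
    (HasDerivWithinAt.fun_sum (u := Finset.univ) fun j _ => (hi i j).fun_mul (hw j))
  rw [hasDerivWithinAt_univ] at hprod
  refine hprod.congr_deriv ?_
  rw [h0]
  have hs : Real.sqrt (g y).det ≠ 0 := (Real.sqrt_pos.2 hdet).ne'
  have hs2 : (g y).det * ((g y)⁻¹ * D).trace / (2 * Real.sqrt (g y).det) =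
      Real.sqrt (g y).det * (1 / 2 * ((g y)⁻¹ * D).trace) := by
    field_simp
    rw [Real.sq_sqrt hdet.le, mul_comm]
  rw [hs2, mul_assoc, ← mul_add, Finset.mul_sum, ← Finset.sum_add_distrib]
  congr 1
  exact Finset.sum_congr rfl fun j _ => by ring

theorem laplacian_eq_sub (g : EuclideanSpace ℝ (Fin n) → Matrix (Fin n) (Fin n) ℝ)
    (f : EuclideanSpace ℝ (Fin n) → ℝ) (y : EuclideanSpace ℝ (Fin n)) :
    laplacian g f y = ∑ i, ∑ j, (g y)⁻¹ i j * pd i (pd j f) y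
      - ∑ k, (∑ i, ∑ j, (g y)⁻¹ i j * christoffel g k i j y) * pd k f y := by
  have hswap : ∀ F : Fin n → Fin n → Fin n → ℝ,
      ∑ i, ∑ j, ∑ k, F i j k = ∑ k, ∑ i, ∑ j, F i j k := fun F => by
    rw [Finset.sum_congr rfl fun i _ => Finset.sum_comm, Finset.sum_comm]
  simp only [laplacian, hessian, mul_sub, Finset.sum_sub_distrib]
  congr 1
  simp only [Finset.sum_mul, Finset.mul_sum]
  rw [hswap]
  exact Finset.sum_congr rfl fun k _ => Finset.sum_congr rfl fun i _ =>
    Finset.sum_congr rfl fun j _ => (mul_assoc _ _ _).symm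

/-- The divergence form `√(det g) Δf = ∂ᵢ(√(det g) gⁱʲ ∂ⱼf)` of the Laplacian. -/
theorem sqrt_det_mul_laplacian {g : EuclideanSpace ℝ (Fin n) → Matrix (Fin n) (Fin n) ℝ}
    {f : EuclideanSpace ℝ (Fin n) → ℝ} {U : Set (EuclideanSpace ℝ (Fin n))} (hU : IsOpen U)
    (hg : ∀ i j, ContDiffOn ℝ ∞ (fun z => g z i j) U) (hpos : ∀ z ∈ U, (g z).PosDef)
    (hf : ContDiffOn ℝ ∞ f U) {y : EuclideanSpace ℝ (Fin n)} (hy : y ∈ U) :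
    Real.sqrt (g y).det * laplacian g f y = ∑ i, pd i (flux g f i) y := by
  obtain ⟨D, hD⟩ : ∃ D : Fin n → Matrix (Fin n) (Fin n) ℝ,
      ∀ k a b, D k a b = pd k (fun z => g z a b) y :=
    ⟨fun k => Matrix.of fun a b => _, fun _ _ _ => rfl⟩
  have hDsymm : ∀ k, (D k)ᵀ = D k := fun k => by
    ext a b
    have : (fun z => g z b a) =ᶠ[𝓝 y] fun z => g z a b := by
      filter_upwards [hU.mem_nhds hy] with z hz
      exact congrFun (congrFun (hpos z hz).transpose_eq a) b
    rw [Matrix.transpose_apply, hD, hD, pd, pd, this.fderiv_eq]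
  have hchr : ∀ k, ∑ i, ∑ j, (g y)⁻¹ i j * christoffel g k i j y =
      ∑ i, (((g y)⁻¹ * D i * (g y)⁻¹) i k - 1 / 2 * ((g y)⁻¹ * D i).trace * (g y)⁻¹ i k) :=
    fun k => by
      simp only [christoffel, ← hD]
      exact divergence_form_identity (hpos y hy).inv.transpose_eq hDsymm k
  have hflux : ∀ i, pd i (flux g f i) y = Real.sqrt (g y).det *
      (∑ j, (g y)⁻¹ i j * pd i (pd j f) y - ∑ j, (((g y)⁻¹ * D i * (g y)⁻¹) i j
        - 1 / 2 * ((g y)⁻¹ * D i).trace * (g y)⁻¹ i j) * pd j f y) := fun i => by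
    rw [pd_flux hU hg hpos hf hy (hD i), Finset.sum_sub_distrib]
  simp only [hflux, ← Finset.mul_sum, laplacian_eq_sub, hchr]
  congr 1
  rw [Finset.sum_sub_distrib]
  congr 1
  simp only [Finset.sum_mul]
  exact Finset.sum_comm

/-- At a local maximum the Laplacian is nonpositive. -/
theorem laplacian_nonpos_of_isLocalMax
    {g : EuclideanSpace ℝ (Fin n) → Matrix (Fin n) (Fin n) ℝ}
    {f : EuclideanSpace ℝ (Fin n) → ℝ} {y : EuclideanSpace ℝ (Fin n)} (hpos : (g y).PosDef)
    (hf : ContDiffAt ℝ 2 f y) (hmax : IsLocalMax f y) : laplacian g f y ≤ 0 := by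
  have hd1 : ∀ᶠ z in 𝓝 y, DifferentiableAt ℝ f z :=
    (hf.eventually (by simp)).mono fun z hz => hz.differentiableAt (by simp)
  have hd2 : DifferentiableAt ℝ (fderiv ℝ f) y :=
    (hf.fderiv_right (m := 1) (by norm_num)).differentiableAt (by simp)
  set S := fderiv ℝ (fderiv ℝ f) y with hS
  have hpd1 : ∀ k, pd k f y = 0 := fun k => by simp [pd, hmax.fderiv_eq_zero]
  have hpd2 : ∀ i j, pd i (pd j f) y =
      S (EuclideanSpace.single i 1) (EuclideanSpace.single j 1) := fun i j => by
    have h := hd2.hasFDerivAt.clm_apply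
      (hasFDerivAt_const (EuclideanSpace.single j (1 : ℝ)) y)
    change fderiv ℝ (fun z => fderiv ℝ f z (EuclideanSpace.single j 1)) y _ = _
    rw [h.fderiv]
    simp [hS]
  -- The Hessian is nonpositive in each direction, by restriction to the line through `y` in the
  -- direction `v`.
  have hline : ∀ v, S v v ≤ 0 := fun v => by
    let c : ℝ → EuclideanSpace ℝ (Fin n) := fun τ => y + τ • v
    have hc : ∀ τ, HasDerivAt c v τ := fun τ => by
      exact (((hasDerivAt_id τ).smul_const v).const_add y).congr_deriv (one_smul _ _)
    have hc0 : c 0 = y := by simp [c]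
    have hct : Tendsto c (𝓝 0) (𝓝 y) := by
      simpa [hc0] using (hc 0).continuousAt.tendsto
    have hφ1 : ∀ᶠ τ in 𝓝 (0 : ℝ), deriv (f ∘ c) τ = fderiv ℝ f (c τ) v := by
      filter_upwards [hct.eventually hd1] with τ hτ
      exact (hτ.hasFDerivAt.comp_hasDerivAt τ (hc τ)).deriv
    have hφ2 : deriv (deriv (f ∘ c)) 0 = S v v := by
      rw [EventuallyEq.deriv_eq (f := fun τ => fderiv ℝ f (c τ) v) hφ1]
      have h1 : HasDerivAt (fun τ => fderiv ℝ f (c τ)) (S v) 0 := by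
        have := hd2.hasFDerivAt
        rw [← hc0] at this
        have h2 := this.comp_hasDerivAt (0 : ℝ) (hc 0)
        rwa [hc0] at h2
      have := h1.clm_apply (hasDerivAt_const (0 : ℝ) v)
      simpa using this.deriv
    have hmaxc : IsLocalMax (f ∘ c) 0 := by
      have := hct.eventually hmax
      filter_upwards [this] with τ hτ
      simpa [hc0] using hτ
    -- A positive second derivative would make the maximum also a local minimum, hence the function
    -- locally constant along the line, and the second derivative zero.
    by_contra! hlt
    have hcont : ContinuousAt (f ∘ c) 0 := by
      refine ContinuousAt.comp ?_ (hc 0).continuousAt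
      rw [hc0]; exact hf.continuousAt
    have hmin : IsLocalMin (f ∘ c) 0 :=
      isLocalMin_of_deriv_deriv_pos (by rwa [hφ2]) hmaxc.deriv_eq_zero hcont
    have hconst : (f ∘ c) =ᶠ[𝓝 0] fun _ => (f ∘ c) 0 := by
      filter_upwards [hmaxc, hmin] with τ h1 h2 using le_antisymm h1 h2
    have : deriv (deriv (f ∘ c)) 0 = 0 := by
      have h1 : deriv (f ∘ c) =ᶠ[𝓝 0] fun _ => 0 := by
        simpa using hconst.deriv
      rw [h1.deriv_eq]; simp
    rw [hφ2] at this
    exact hlt.ne' this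
  -- The first derivatives vanish at `y`, so with `g⁻¹ = BᵀB` the Laplacian is the sum of the second
  -- derivatives along the rows of `B`.
  obtain ⟨B, hB⟩ := hpos.inv.exists_transpose_mul_self
  have : laplacian g f y = ∑ k, S (∑ i, B k i • EuclideanSpace.single i (1 : ℝ))
      (∑ j, B k j • EuclideanSpace.single j (1 : ℝ)) := by
    simp only [laplacian, hessian, hpd1, hpd2, mul_zero, Finset.sum_const_zero, sub_zero, hB,
      Matrix.mul_apply, Matrix.transpose_apply, map_sum, map_smul, _root_.sum_apply,
      _root_.smul_apply, smul_eq_mul, Finset.sum_mul, Finset.mul_sum]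
    rw [Finset.sum_congr rfl fun i _ => Finset.sum_comm, Finset.sum_comm]
    refine Finset.sum_congr rfl fun k _ => ?_
    rw [Finset.sum_comm]
    exact Finset.sum_congr rfl fun i _ => Finset.sum_congr rfl fun j _ => by ring
  rw [this]
  exact Finset.sum_nonpos fun k _ => hline _

end Coord

/-! ### The divergence theorem -/

theorem continuous_mul_of_tsupport_subset {E : Type*} [TopologicalSpace E] {ψ G : E → ℝ} {U : Set E}
    (hU : IsOpen U) (hψ : Continuous ψ) (hs : tsupport ψ ⊆ U) (hG : ContinuousOn G U) :
    Continuous fun y => ψ y * G y := by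
  refine continuous_of_tsupport fun y hy => ?_
  have hyU : y ∈ U := hs (tsupport_mul_subset_left hy)
  exact hψ.continuousAt.mul (hG.continuousAt (hU.mem_nhds hyU))

theorem integrable_mul_of_tsupport_subset {n : ℕ} {ψ G : EuclideanSpace ℝ (Fin n) → ℝ}
    {U : Set (EuclideanSpace ℝ (Fin n))} (hU : IsOpen U) (hψ : Continuous ψ)
    (hcs : HasCompactSupport ψ) (hs : tsupport ψ ⊆ U) (hG : ContinuousOn G U) :
    Integrable (fun y => ψ y * G y) :=
  (continuous_mul_of_tsupport_subset hU hψ hs hG).integrable_of_hasCompactSupport hcs.mul_right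

namespace Coord

variable {n : ℕ}

theorem tsupport_pd_subset (ψ : EuclideanSpace ℝ (Fin n) → ℝ) (k : Fin n) :
    tsupport (pd k ψ) ⊆ tsupport ψ :=
  tsupport_fderiv_apply_subset ℝ _

/-- Green's formula in a coordinate domain. -/
theorem integral_mul_laplacian {g : EuclideanSpace ℝ (Fin n) → Matrix (Fin n) (Fin n) ℝ}
    {f ψ : EuclideanSpace ℝ (Fin n) → ℝ} {U : Set (EuclideanSpace ℝ (Fin n))} (hU : IsOpen U)
    (hg : ∀ i j, ContDiffOn ℝ ∞ (fun z => g z i j) U) (hpos : ∀ z ∈ U, (g z).PosDef)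
    (hf : ContDiffOn ℝ ∞ f U) (hψ : ContDiff ℝ ∞ ψ) (hcs : HasCompactSupport ψ)
    (hs : tsupport ψ ⊆ U) :
    ∫ y, ψ y * (Real.sqrt (g y).det * laplacian g f y) =
      -∫ y, ∑ i, pd i ψ y * flux g f i y := by
  have hpdψ : ∀ i, Continuous (pd i ψ) := fun i =>
    (hψ.continuous_fderiv (by simp)).clm_apply continuous_const
  have hflux := contDiffOn_flux hU hg hpos hf
  have hint1 : ∀ i, Integrable fun y => ψ y * pd i (flux g f i) y := fun i =>
    integrable_mul_of_tsupport_subset hU hψ.continuous hcs hs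
      (contDiffOn_pd hU (hflux i) i).continuousOn
  have hint2 : ∀ i, Integrable fun y => pd i ψ y * flux g f i y := fun i =>
    integrable_mul_of_tsupport_subset hU (hpdψ i)
      (hcs.mono' ((subset_tsupport _).trans (tsupport_pd_subset ψ i)))
      ((tsupport_pd_subset ψ i).trans hs) (hflux i).continuousOn
  have hint3 : ∀ i, Integrable fun y => ψ y * flux g f i y := fun i =>
    integrable_mul_of_tsupport_subset hU hψ.continuous hcs hs (hflux i).continuousOn
  have h1 : ∀ y, ψ y * (Real.sqrt (g y).det * laplacian g f y) =
      ∑ i, ψ y * pd i (flux g f i) y := fun y => by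
    by_cases hy : y ∈ U
    · rw [sqrt_det_mul_laplacian hU hg hpos hf hy, Finset.mul_sum]
    · have : ψ y = 0 := image_eq_zero_of_notMem_tsupport fun h => hy (hs h)
      simp [this]
  simp only [h1]
  rw [integral_finsetSum _ fun i _ => hint1 i, integral_finsetSum _ fun i _ => hint2 i,
    ← Finset.sum_neg_distrib]
  refine Finset.sum_congr rfl fun i _ => ?_
  -- With the Laplacian in divergence form, each term is an integration by parts in one coordinate
  -- direction; the compact support of `ψ` in `U` supplies integrability and excludes boundary
  -- terms.
  exact integral_bilinear_fderiv_right_eq_neg_left_of_integrable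
    (B := ContinuousLinearMap.mul ℝ ℝ) (v := EuclideanSpace.single i (1 : ℝ))
    (hint2 i) (hint1 i) (hint3 i) (fun y _ => (hψ.differentiable (by simp)) y)
    (fun y hy => ((hflux i).contDiffAt (hU.mem_nhds (hs hy))).differentiableAt (by simp))

end Coord

/-! ### Gradients of functions in charts and their transformation law -/

section Manifold

variable {n : ℕ} {X : Type*} [TopologicalSpace X] [ChartedSpace (EuclideanSpace ℝ (Fin n)) X]

/-- The partial derivatives of a function on a manifold in a chart. -/
noncomputable def chartGradient (e : OpenPartialHomeomorph X (EuclideanSpace ℝ (Fin n)))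
    (F : X → ℝ) (y : EuclideanSpace ℝ (Fin n)) : Fin n → ℝ :=
  fun k => Coord.pd k (fun z => F (e.symm z)) y

/-- The inner product `⟨∇F, ∇G⟩ = hᵏˡ ∂ₖF ∂ₗG`, computed in a chart. -/
noncomputable def gradInner (e : OpenPartialHomeomorph X (EuclideanSpace ℝ (Fin n)))
    (h : Cov2Tensor n X) (F G : X → ℝ) (y : EuclideanSpace ℝ (Fin n)) : ℝ :=
  chartGradient e F y ⬝ᵥ ((components e h y)⁻¹ *ᵥ chartGradient e G y)

/-- A function on a manifold that is smooth in all charts of the atlas. -/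
def SmoothInCharts (n : ℕ) {X : Type*} [TopologicalSpace X]
    [ChartedSpace (EuclideanSpace ℝ (Fin n)) X] (F : X → ℝ) : Prop :=
  ∀ e ∈ atlas (EuclideanSpace ℝ (Fin n)) X, ContDiffOn ℝ ∞ (fun z => F (e.symm z)) e.target

theorem SmoothInCharts.differentiableAt {F : X → ℝ} (hF : SmoothInCharts n F)
    {e : OpenPartialHomeomorph X (EuclideanSpace ℝ (Fin n))}
    (he : e ∈ atlas (EuclideanSpace ℝ (Fin n)) X) {y : EuclideanSpace ℝ (Fin n)}
    (hy : y ∈ e.target) : DifferentiableAt ℝ (fun z => F (e.symm z)) y :=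
  ((hF e he).contDiffAt (e.open_target.mem_nhds hy)).differentiableAt (by simp)

/-- A function on a manifold is continuous if it is so in all charts of the atlas. -/
theorem continuous_of_charts {Y : Type*} [TopologicalSpace Y] {F : X → Y}
    (hF : ∀ e ∈ atlas (EuclideanSpace ℝ (Fin n)) X,
      ContinuousOn (fun z => F (e.symm z)) e.target) : Continuous F := by
  refine continuous_iff_continuousAt.2 fun x => ?_
  set e := chartAt (EuclideanSpace ℝ (Fin n)) x
  have hx : x ∈ e.source := mem_chart_source _ x
  have h1 : ContinuousAt (fun z => F (e.symm z)) (e x) :=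
    (hF e (chart_mem_atlas _ _)).continuousAt (e.open_target.mem_nhds (e.map_source hx))
  have h2 := ContinuousAt.comp (f := e) h1 (e.continuousAt hx)
  refine h2.congr ?_
  filter_upwards [e.open_source.mem_nhds hx] with x' hx'
  simp [e.left_inv hx']

variable [IsManifold (𝓡 n) ∞ X]

theorem smoothInCharts_of_contMDiff {F : X → ℝ} (hF : ContMDiff (𝓡 n) 𝓘(ℝ) ∞ F) :
    SmoothInCharts n F := fun e he => by
  have h1 : ContMDiffOn (𝓡 n) (𝓡 n) ∞ e.symm e.target :=
    contMDiffOn_symm_of_mem_maximalAtlas (IsManifold.subset_maximalAtlas he)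
  exact (hF.comp_contMDiffOn h1).contDiffOn

theorem chartGradient_change {e e' : OpenPartialHomeomorph X (EuclideanSpace ℝ (Fin n))}
    (he : e ∈ atlas (EuclideanSpace ℝ (Fin n)) X) (he' : e' ∈ atlas (EuclideanSpace ℝ (Fin n)) X)
    {F : X → ℝ} (hF : SmoothInCharts n F) {y : EuclideanSpace ℝ (Fin n)} (hy : y ∈ e.target)
    (hy' : e.symm y ∈ e'.source) :
    chartGradient e F y = (jacobian e e' y)ᵀ *ᵥ chartGradient e' F (e' (e.symm y)) := by
  have h1 : (fun z => F (e.symm z)) =ᶠ[𝓝 y] (fun z => F (e'.symm z)) ∘ (e' ∘ e.symm) := by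
    filter_upwards [(e.continuousAt_symm hy).preimage_mem_nhds (e'.open_source.mem_nhds hy')]
      with z hz
    simp [e'.left_inv hz]
  have h2 : DifferentiableAt ℝ (fun z => F (e'.symm z)) ((e' ∘ e.symm) y) :=
    hF.differentiableAt he' (e'.map_source hy')
  ext k
  rw [chartGradient, Coord.pd, h1.fderiv_eq,
    fderiv_comp y h2 (differentiableAt_transition he he' hy hy'), ContinuousLinearMap.comp_apply]
  have h3 := map_single_eq_sum (fderiv ℝ (e' ∘ e.symm) y : _ →ₗ[ℝ] _) k
  rw [ContinuousLinearMap.coe_coe] at h3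
  rw [h3, map_sum]
  simp only [map_smul, smul_eq_mul]
  rfl

/-- The Jacobians in the two gradients cancel against those in the inverse metric. -/
theorem gradInner_change {e e' : OpenPartialHomeomorph X (EuclideanSpace ℝ (Fin n))}
    (he : e ∈ atlas (EuclideanSpace ℝ (Fin n)) X) (he' : e' ∈ atlas (EuclideanSpace ℝ (Fin n)) X)
    (h : Cov2Tensor n X) {F G : X → ℝ} (hF : SmoothInCharts n F) (hG : SmoothInCharts n G)
    {y : EuclideanSpace ℝ (Fin n)} (hy : y ∈ e.target) (hy' : e.symm y ∈ e'.source) :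
    gradInner e h F G y = gradInner e' h F G (e' (e.symm y)) := by
  have hJ : IsUnit (jacobian e e' y).det :=
    isUnit_iff_ne_zero.2 (det_jacobian_ne_zero he he' hy hy')
  have hJt : IsUnit (jacobian e e' y)ᵀ.det := by rwa [Matrix.det_transpose]
  rw [gradInner, gradInner, chartGradient_change he he' hF hy hy',
    chartGradient_change he he' hG hy hy', components_change he he' h hy hy', Matrix.mul_inv_rev,
    Matrix.mul_inv_rev, Matrix.mulVec_mulVec, Matrix.mul_assoc, Matrix.mul_assoc,
    Matrix.nonsing_inv_mul _ hJt, Matrix.mul_one, Matrix.mulVec_transpose,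
    ← Matrix.dotProduct_mulVec, Matrix.mulVec_mulVec, Matrix.mul_nonsing_inv_cancel_left _ _ hJ]

end Manifold

section DivergenceTheorem

variable {n : ℕ} {X : Type*} [TopologicalSpace X] [ChartedSpace (EuclideanSpace ℝ (Fin n)) X]

theorem flux_dot_chartGradient (e : OpenPartialHomeomorph X (EuclideanSpace ℝ (Fin n)))
    (h : Cov2Tensor n X) (F G : X → ℝ) (y : EuclideanSpace ℝ (Fin n)) :
    ∑ i, chartGradient e F y i * Coord.flux (components e h) (fun z => G (e.symm z)) i y =
      Real.sqrt (components e h y).det * gradInner e h F G y := by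
  simp only [gradInner, dotProduct, Matrix.mulVec, Coord.flux, Finset.mul_sum]
  refine Finset.sum_congr rfl fun i _ => Finset.sum_congr rfl fun j _ => ?_
  simp only [chartGradient]
  ring

/-- The coordinate expression, extended by zero, of a function supported in a chart domain. -/
noncomputable def chartExtend {X : Type*} [TopologicalSpace X]
    (e : OpenPartialHomeomorph X (EuclideanSpace ℝ (Fin n)))
    (F : X → ℝ) : EuclideanSpace ℝ (Fin n) → ℝ :=
  e.target.indicator fun z => F (e.symm z)

theorem chartExtend_eventuallyEq {X : Type*} [TopologicalSpace X]
    (e : OpenPartialHomeomorph X (EuclideanSpace ℝ (Fin n)))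
    (F : X → ℝ) {y : EuclideanSpace ℝ (Fin n)} (hy : y ∈ e.target) :
    chartExtend e F =ᶠ[𝓝 y] fun z => F (e.symm z) := by
  filter_upwards [e.open_target.mem_nhds hy] with z hz
  exact indicator_of_mem hz _

theorem tsupport_chartExtend_subset {X : Type*} [TopologicalSpace X] [CompactSpace X]
    {e : OpenPartialHomeomorph X (EuclideanSpace ℝ (Fin n))} {F : X → ℝ}
    (hF : tsupport F ⊆ e.source) :
    IsCompact (e '' tsupport F) ∧ tsupport (chartExtend e F) ⊆ e '' tsupport F := by
  have hK : IsCompact (e '' tsupport F) :=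
    (isClosed_tsupport F).isCompact.image_of_continuousOn (e.continuousOn.mono hF)
  refine ⟨hK, closure_minimal (fun y hy => ?_) hK.isClosed⟩
  have hyt : y ∈ e.target := by
    by_contra h
    exact hy (indicator_of_notMem h _)
  have : F (e.symm y) ≠ 0 := by
    have h1 : chartExtend e F y = F (e.symm y) := indicator_of_mem hyt _
    rw [← h1]; exact hy
  exact ⟨e.symm y, subset_tsupport _ this, e.right_inv hyt⟩

variable [IsManifold (𝓡 n) ∞ X]

/-- The inner product of the gradients of two functions. -/
noncomputable def gradientInner (h : Cov2Tensor n X) (F G : X → ℝ) (x : X) : ℝ :=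
  gradInner (chartAt (EuclideanSpace ℝ (Fin n)) x) h F G
    (chartAt (EuclideanSpace ℝ (Fin n)) x x)

theorem gradientInner_chart {e : OpenPartialHomeomorph X (EuclideanSpace ℝ (Fin n))}
    (he : e ∈ atlas (EuclideanSpace ℝ (Fin n)) X) (h : Cov2Tensor n X) {F G : X → ℝ}
    (hF : SmoothInCharts n F) (hG : SmoothInCharts n G) {y : EuclideanSpace ℝ (Fin n)}
    (hy : y ∈ e.target) : gradientInner h F G (e.symm y) = gradInner e h F G y :=
  (gradInner_change he (chart_mem_atlas _ _) h hF hG hy (mem_chart_source _ _)).symm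

theorem continuous_gradientInner {h : SmoothMetric n X}
    (hc : ∀ e ∈ atlas (EuclideanSpace ℝ (Fin n)) X, ∀ i j,
      ContDiffOn ℝ ∞ (fun y => components e h.inner y i j) e.target) {F G : X → ℝ}
    (hF : SmoothInCharts n F) (hG : SmoothInCharts n G) :
    Continuous (gradientInner h.inner F G) := by
  refine continuous_of_charts (n := n) fun e he => ?_
  refine ContinuousOn.congr (f := gradInner e h.inner F G) ?_ fun y hy =>
    gradientInner_chart he h.inner hF hG hy
  change ContinuousOn (fun y => ∑ i, chartGradient e F y i *
    ∑ j, (components e h.inner y)⁻¹ i j * chartGradient e G y j) e.target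
  have hpd : ∀ {F : X → ℝ}, SmoothInCharts n F → ∀ k,
      ContinuousOn (fun y => chartGradient e F y k) e.target := fun hF k =>
    (Coord.contDiffOn_pd e.open_target (hF e he) k).continuousOn
  refine continuousOn_finsetSum _ fun i _ => (hpd hF i).mul
    (continuousOn_finsetSum _ fun j _ => ContinuousOn.mul ?_ (hpd hG j))
  exact (contDiffOn_inv_apply (hc e he) (fun z hz => (posDef_components he h hz).det_pos.ne')
    i j).continuousOn

variable [T2Space X] [CompactSpace X] [MeasurableSpace X] [BorelSpace X]

/-- Green's formula for a function supported in a chart domain. -/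
theorem integral_mul_laplacian_of_tsupport_subset {h : SmoothMetric n X}
    (hc : ∀ e ∈ atlas (EuclideanSpace ℝ (Fin n)) X, ∀ i j,
      ContDiffOn ℝ ∞ (fun y => components e h.inner y i j) e.target) {ρ u q : X → ℝ}
    (hu : SmoothInCharts n u) (hρ : SmoothInCharts n ρ) (hρc : Continuous ρ) (hqc : Continuous q)
    {e : OpenPartialHomeomorph X (EuclideanSpace ℝ (Fin n))}
    (he : e ∈ atlas (EuclideanSpace ℝ (Fin n)) X) (hsupp : tsupport ρ ⊆ e.source)
    (hq : ∀ y ∈ e.target,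
      Coord.laplacian (components e h.inner) (fun z => u (e.symm z)) y = q (e.symm y)) :
    ∫ x, ρ x * q x ∂riemannianVolume h.inner =
      -∫ x, gradientInner h.inner ρ u x ∂riemannianVolume h.inner := by
  obtain ⟨hK, hsub⟩ := tsupport_chartExtend_subset hsupp
  have hKt : e '' tsupport ρ ⊆ e.target := by
    rintro _ ⟨x, hx, rfl⟩
    exact e.map_source (hsupp hx)
  have hst := hsub.trans hKt
  have hcs : HasCompactSupport (chartExtend e ρ) := hK.of_isClosed_subset (isClosed_tsupport _) hsub
  have hsm : ContDiff ℝ ∞ (chartExtend e ρ) := by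
    refine contDiff_iff_contDiffAt.2 fun y => ?_
    by_cases hy : y ∈ tsupport (chartExtend e ρ)
    swap
    · exact contDiffAt_const.congr_of_eventuallyEq (notMem_tsupport_iff_eventuallyEq.1 hy)
    exact ((hρ e he).contDiffAt (e.open_target.mem_nhds (hst hy))).congr_of_eventuallyEq
      (chartExtend_eventuallyEq e ρ (hst hy))
  have hpd : ∀ y ∈ e.target, ∀ k,
      Coord.pd k (chartExtend e ρ) y = chartGradient e ρ y k := fun y hy k => by
    rw [Coord.pd, (chartExtend_eventuallyEq e ρ hy).fderiv_eq]; rfl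
  have hzero : ∀ x, x ∉ e.source → ρ x = 0 := fun x hx =>
    image_eq_zero_of_notMem_tsupport fun h => hx (hsupp h)
  have hcont := fun i j => (hc e he i j).continuousOn
  -- `gradientInner` is computed in the preferred chart at `x`, so its vanishing off the domain of
  -- `e` is checked in that chart.
  have hgi0 : ∀ x, x ∉ e.source → gradientInner h.inner ρ u x = 0 := fun x hx => by
    have hx' : x ∉ tsupport ρ := fun h => hx (hsupp h)
    set c := chartAt (EuclideanSpace ℝ (Fin n)) x with hcdef
    have hxc : x ∈ c.source := mem_chart_source _ x
    have h1 : (fun z => ρ (c.symm z)) =ᶠ[𝓝 (c x)] fun _ => 0 := by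
      have h2 : ρ =ᶠ[𝓝 (c.symm (c x))] fun _ => 0 := by
        rw [c.left_inv hxc]
        exact notMem_tsupport_iff_eventuallyEq.1 hx'
      exact (c.continuousAt_symm (c.map_source hxc)).eventually h2
    have h3 : chartGradient c ρ (c x) = 0 := by
      ext k
      rw [chartGradient, Coord.pd, h1.fderiv_eq]; simp
    rw [gradientInner, gradInner, ← hcdef, h3, zero_dotProduct]
  rw [integral_riemannianVolume he hcont (φ := fun x => ρ x * q x)
      (hρc.mul hqc).aestronglyMeasurable (fun x hx => by simp [hzero x hx]),
    integral_riemannianVolume he hcont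
      (continuous_gradientInner hc hρ hu).aestronglyMeasurable hgi0]
  have hgreen := Coord.integral_mul_laplacian e.open_target (hc e he)
    (fun z hz => posDef_components he h hz) (hu e he) hsm hcs hst
  rw [← setIntegral_eq_integral_of_forall_compl_eq_zero (s := e.target),
    ← setIntegral_eq_integral_of_forall_compl_eq_zero (s := e.target) (f := fun y =>
      ∑ i, Coord.pd i (chartExtend e ρ) y * _)] at hgreen
  · convert hgreen using 1
    · refine setIntegral_congr_fun e.open_target.measurableSet fun y hy => ?_
      rw [← hq y hy, chartExtend, indicator_of_mem hy]
      ring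
    · congr 1
      refine setIntegral_congr_fun e.open_target.measurableSet fun y hy => ?_
      simp only [hpd y hy, flux_dot_chartGradient, gradientInner_chart he h.inner hρ hu hy]
  · intro y hy
    refine Finset.sum_eq_zero fun i _ => ?_
    have : Coord.pd i (chartExtend e ρ) y = 0 := image_eq_zero_of_notMem_tsupport fun h =>
      hy (hst (Coord.tsupport_pd_subset _ i h))
    simp [this]
  · intro y hy
    simp [chartExtend, indicator_of_notMem hy]

/-- The integral of a Laplacian over a compact manifold vanishes. -/
theorem integral_laplacian_eq_zero {h : SmoothMetric n X}
    (hc : ∀ e ∈ atlas (EuclideanSpace ℝ (Fin n)) X, ∀ i j,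
      ContDiffOn ℝ ∞ (fun y => components e h.inner y i j) e.target) {u q : X → ℝ}
    (hu : SmoothInCharts n u) (hqc : Continuous q)
    (hq : ∀ e ∈ atlas (EuclideanSpace ℝ (Fin n)) X, ∀ y ∈ e.target,
      Coord.laplacian (components e h.inner) (fun z => u (e.symm z)) y = q (e.symm y)) :
    ∫ x, q x ∂riemannianVolume h.inner = 0 := by
  obtain ⟨t, ρ, hsm, hnn, hsum, hsupp⟩ := exists_partitionOfUnity (n := n) (X := X)
  have := isFiniteMeasure_riemannianVolume (h := h.inner) fun e he i j => (hc e he i j).continuousOn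
  have hInt : ∀ {F : X → ℝ}, Continuous F → Integrable F (riemannianVolume h.inner) := fun hF =>
    hF.integrable_of_hasCompactSupport (HasCompactSupport.of_compactSpace _)
  have hρ := fun i hi => smoothInCharts_of_contMDiff (hsm i hi)
  have h1 : ∀ x, q x = ∑ i ∈ t, ρ i x * q x := fun x => by rw [← Finset.sum_mul, hsum, one_mul]
  rw [integral_congr_ae (Eventually.of_forall h1),
    integral_finsetSum _ fun i hi => hInt ((hsm i hi).continuous.fun_mul hqc),
    Finset.sum_congr rfl fun i hi => integral_mul_laplacian_of_tsupport_subset hc hu (hρ i hi)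
      (hsm i hi).continuous hqc (chart_mem_atlas _ _) (hsupp i hi) (hq _ (chart_mem_atlas _ _)),
    Finset.sum_neg_distrib,
    ← integral_finsetSum _ fun i hi => hInt (continuous_gradientInner hc (hρ i hi) hu)]
  -- The gradients of a partition of unity sum to the gradient of the constant one.
  have h2 : ∀ x, ∑ i ∈ t, gradientInner h.inner (ρ i) u x = 0 := fun x => by
    set c := chartAt (EuclideanSpace ℝ (Fin n)) x with hcdef
    have hcm : c ∈ atlas (EuclideanSpace ℝ (Fin n)) X := chart_mem_atlas _ _
    have hxc : x ∈ c.source := mem_chart_source _ x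
    have h3 : ∑ i ∈ t, chartGradient c (ρ i) (c x) = 0 := by
      ext k
      have h4 := HasFDerivAt.fun_sum (u := t) fun i hi =>
        ((hρ i hi).differentiableAt hcm (c.map_source hxc)).hasFDerivAt
      simp only [hsum] at h4
      have h5 := congrArg (fun A => A (EuclideanSpace.single k (1 : ℝ)))
        (h4.unique (hasFDerivAt_const (1 : ℝ) (c x)))
      simpa [chartGradient, Coord.pd] using h5
    simp only [gradientInner, gradInner, ← hcdef]
    rw [← sum_dotProduct, h3, zero_dotProduct]
  simp [h2]

end DivergenceTheorem

/-! ### Expanding CMC Einstein flows in the Hubble time -/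

section Flow

variable {n : ℕ} {X : Type*} [TopologicalSpace X] [ChartedSpace (EuclideanSpace ℝ (Fin n)) X]
  [IsManifold (𝓡 n) ∞ X] {I : Set ℝ} {L : ℝ → X → ℝ} {h : ℝ → SmoothMetric n X}
  {K : ℝ → Cov2Tensor n X} {H : ℝ → ℝ}

namespace IsExpandingCMCEinsteinFlow

theorem uniqueDiffOn (hflow : IsExpandingCMCEinsteinFlow I L h K H) : UniqueDiffOn ℝ I := by
  obtain ⟨t₀, rfl | rfl⟩ := hflow.half_line
  · exact uniqueDiffOn_Ici t₀
  · exact uniqueDiffOn_Ioi t₀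

theorem mem_of_le (hflow : IsExpandingCMCEinsteinFlow I L h K H) {s t : ℝ} (hs : s ∈ I)
    (hst : s ≤ t) : t ∈ I := by
  obtain ⟨t₀, rfl | rfl⟩ := hflow.half_line
  · exact le_trans hs hst
  · exact lt_of_lt_of_le hs hst

theorem nonempty (hflow : IsExpandingCMCEinsteinFlow I L h K H) : I.Nonempty := by
  obtain ⟨t₀, rfl | rfl⟩ := hflow.half_line
  · exact nonempty_Ici
  · exact nonempty_Ioi

/-- In dimension zero the Hubble time would vanish at every time of `I`, although `I` contains two
distinct times. -/
theorem dim_ne_zero (hflow : IsExpandingCMCEinsteinFlow I L h K H)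
    (hubble : ∀ t ∈ I, t = -(n : ℝ) / H t) : n ≠ 0 := by
  rintro rfl
  obtain ⟨s, hs⟩ := hflow.nonempty
  have h1 := hubble s hs
  have h2 := hubble (s + 1) (hflow.mem_of_le hs (by linarith))
  simp at h1 h2
  linarith

theorem pos_of_mem (hflow : IsExpandingCMCEinsteinFlow I L h K H)
    (hubble : ∀ t ∈ I, t = -(n : ℝ) / H t) {t : ℝ} (ht : t ∈ I) : 0 < t := by
  have hn : 0 < (n : ℝ) := Nat.cast_pos.2 (Nat.pos_of_ne_zero (hflow.dim_ne_zero hubble))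
  rw [hubble t ht]
  exact div_pos_of_neg_of_neg (by linarith) (hflow.neg t ht)

theorem mean_curvature_eq (hflow : IsExpandingCMCEinsteinFlow I L h K H)
    (hubble : ∀ t ∈ I, t = -(n : ℝ) / H t) {t : ℝ} (ht : t ∈ I) : H t = -(n : ℝ) / t := by
  have h1 := hubble t ht
  have h2 := (hflow.neg t ht).ne
  have h3 := (hflow.pos_of_mem hubble ht).ne'
  rw [eq_div_iff h2] at h1
  rw [eq_div_iff h3, ← h1, mul_comm]

theorem contDiffOn_metric (hflow : IsExpandingCMCEinsteinFlow I L h K H) {t : ℝ} (ht : t ∈ I) :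
    ∀ e ∈ atlas (EuclideanSpace ℝ (Fin n)) X, ∀ i j,
      ContDiffOn ℝ ∞ (fun y => components e (h t).inner y i j) e.target := fun e he i j =>
  (hflow.smooth_h e he i j).comp (f := fun y => (t, y)) (contDiffOn_const.prodMk contDiffOn_id)
    fun _ hy => ⟨ht, hy⟩

theorem smoothInCharts_lapse (hflow : IsExpandingCMCEinsteinFlow I L h K H) {t : ℝ} (ht : t ∈ I) :
    SmoothInCharts n (L t) := fun e he =>
  (hflow.smooth_L e he).comp (f := fun y => (t, y)) (contDiffOn_const.prodMk contDiffOn_id)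
    fun _ hy => ⟨ht, hy⟩

/-- The lapse equation `ΔL = L |K⁰|² - (n / t²) (1 - L)`. -/
theorem lapse_equation (hflow : IsExpandingCMCEinsteinFlow I L h K H)
    (hubble : ∀ t ∈ I, t = -(n : ℝ) / H t)
    {e : OpenPartialHomeomorph X (EuclideanSpace ℝ (Fin n))}
    (he : e ∈ atlas (EuclideanSpace ℝ (Fin n)) X) {t : ℝ} (ht : t ∈ I)
    {y : EuclideanSpace ℝ (Fin n)} (hy : y ∈ e.target) :
    Coord.laplacian (components e (h t).inner) (fun z => L t (e.symm z)) y =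
      L t (e.symm y) * Coord.normSq (components e (h t).inner y)
        (Coord.tracelessPart (components e (h t).inner y) (components e (K t) y))
      - n / t ^ 2 * (1 - L t (e.symm y)) := by
  have hn : (n : ℝ) ≠ 0 := Nat.cast_ne_zero.2 (hflow.dim_ne_zero hubble)
  have ht0 : t ≠ 0 := (hflow.pos_of_mem hubble ht).ne'
  have hpos := posDef_components he (h t) hy
  have hu := hflow.uniqueDiffOn t ht
  set g := components e (h t).inner y with hg
  set k := components e (K t) y with hk
  set l := L t (e.symm y) with hl
  have hksymm : kᵀ = k := components_transpose e (hflow.symm t ht) y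
  have hh : ∀ i j, HasDerivWithinAt (fun τ => components e (h τ).inner y i j)
      (((-2 * l) • k) i j) I t := fun i j => by
    simpa [mul_assoc] using hflow.evolution_h e he t ht y hy i j
  have hinv := hasDerivWithinAt_inv_apply hh hpos.det_pos.ne' hu
  -- The derivative of the mean curvature is computed twice: from the evolution equations, where
  -- unification supplies its value, and from `H = -n/t`.
  have htr : HasDerivWithinAt
      (fun τ => Coord.tr (components e (h τ).inner y) (components e (K τ) y)) _ I t :=
    HasDerivWithinAt.fun_sum (u := Finset.univ) fun i _ =>
      HasDerivWithinAt.fun_sum (u := Finset.univ) fun j _ =>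
        (hinv i j).fun_mul (hflow.evolution_K e he t ht y hy i j)
  have hH : HasDerivWithinAt
      (fun τ => Coord.tr (components e (h τ).inner y) (components e (K τ) y)) (n / t ^ 2) I t := by
    have h1 : HasDerivWithinAt (fun τ : ℝ => -(n : ℝ) / τ) (n / t ^ 2) I t := by
      have := ((hasDerivAt_inv ht0).const_mul (-(n : ℝ))).hasDerivWithinAt (s := I)
      refine this.congr_deriv ?_
      field_simp
    refine h1.congr (fun τ hτ => ?_) ?_
    · rw [hflow.cmc e he τ hτ y hy, hflow.mean_curvature_eq hubble hτ]
    · rw [hflow.cmc e he t ht y hy, hflow.mean_curvature_eq hubble ht]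
  have hder := hu.eq_deriv _ htr hH
  simp only [← hg, ← hk, ← hl] at hder
  have htrH : Coord.tr g k = -(n : ℝ) / t := by
    rw [hflow.cmc e he t ht y hy, hflow.mean_curvature_eq hubble ht]
  have hham := hflow.hamiltonian_constraint e he t ht y hy
  rw [← hg, ← hk, htrH] at hham
  -- Both sides are `|K|²`. One arises from the derivative of `h⁻¹`, the other from the quadratic
  -- term in the evolution of `K`; their contributions `±2L|K|²` cancel.
  have hS : ∑ i, ∑ j, (g⁻¹ * k * g⁻¹) i j * k i j =
      ∑ i, ∑ j, g⁻¹ i j * ∑ a, ∑ b, g⁻¹ a b * k i a * k b j := by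
    have h1 : ∑ i, ∑ j, (g⁻¹ * k * g⁻¹) i j * k i j = (g⁻¹ * k * g⁻¹ * kᵀ).trace := by
      simp [Matrix.trace, Matrix.mul_apply]
    have h2 : ∑ i, ∑ j, g⁻¹ i j * ∑ a, ∑ b, g⁻¹ a b * k i a * k b j =
        (g⁻¹ * (k * g⁻¹ * k)ᵀ).trace := by
      simp only [Matrix.trace, Matrix.diag]
      refine Finset.sum_congr rfl fun i _ => ?_
      rw [Matrix.mul_apply]
      refine Finset.sum_congr rfl fun j _ => ?_
      rw [Matrix.transpose_apply, Matrix.mul_apply]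
      simp only [Matrix.mul_apply, Finset.sum_mul]
      rw [Finset.sum_comm]
      congr 1
      exact Finset.sum_congr rfl fun b _ => Finset.sum_congr rfl fun a _ => by ring
    rw [h1, h2]
    simp only [Matrix.transpose_mul, hksymm, hpos.inv.transpose_eq, Matrix.mul_assoc]
  have hexp : ∑ i, ∑ j, (-(g⁻¹ * (-2 * l) • k * g⁻¹) i j * k i j + g⁻¹ i j *
      (l * Coord.tr g k * k i j - 2 * l * ∑ a, ∑ b, g⁻¹ a b * k i a * k b j
        - Coord.hessian (components e (h t).inner) (fun z => L t (e.symm z)) i j y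
        + l * Coord.ricci (components e (h t).inner) i j y)) =
      2 * l * ∑ i, ∑ j, (g⁻¹ * k * g⁻¹) i j * k i j + l * Coord.tr g k * Coord.tr g k
      - 2 * l * ∑ i, ∑ j, g⁻¹ i j * ∑ a, ∑ b, g⁻¹ a b * k i a * k b j
      - Coord.laplacian (components e (h t).inner) (fun z => L t (e.symm z)) y
      + l * Coord.scalarCurv (components e (h t).inner) y := by
    rw [show Coord.laplacian (components e (h t).inner) (fun z => L t (e.symm z)) y =
      ∑ i, ∑ j, g⁻¹ i j * Coord.hessian (components e (h t).inner) (fun z => L t (e.symm z)) i j y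
      from rfl, show Coord.scalarCurv (components e (h t).inner) y =
      ∑ i, ∑ j, g⁻¹ i j * Coord.ricci (components e (h t).inner) i j y from rfl]
    have : l * Coord.tr g k * Coord.tr g k =
        ∑ i, ∑ j, l * Coord.tr g k * (g⁻¹ i j * k i j) := by
      simp only [← Finset.mul_sum]; rfl
    rw [this]
    simp only [Finset.mul_sum (s := Finset.univ) (a := 2 * l), Finset.mul_sum (a := l),
      ← Finset.sum_add_distrib, ← Finset.sum_sub_distrib]
    refine Finset.sum_congr rfl fun i _ => Finset.sum_congr rfl fun j _ => ?_
    simp only [Matrix.mul_smul, Matrix.smul_mul, Matrix.smul_apply, smul_eq_mul]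
    simp only [← Finset.mul_sum]
    ring
  have key := hexp.symm.trans hder
  rw [hS, htrH] at key
  -- The Hamiltonian constraint eliminates the scalar curvature; what remains of the mean curvature
  -- terms is `L H²/n = L n/t²`.
  have hR : Coord.scalarCurv (components e (h t).inner) y =
      Coord.normSq g (Coord.tracelessPart g k) - (1 - 1 / (n : ℝ)) * (-(n : ℝ) / t) ^ 2 := by
    linarith
  rw [hR] at key
  have h2 : l * (-(n : ℝ) / t) * (-(n : ℝ) / t) - l * ((1 - 1 / (n : ℝ)) * (-(n : ℝ) / t) ^ 2) =
      l * (n / t ^ 2) := by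
    field_simp
    ring
  linarith [key, h2]

theorem continuous_lapse (hflow : IsExpandingCMCEinsteinFlow I L h K H) {t : ℝ} (ht : t ∈ I) :
    Continuous (L t) :=
  continuous_of_charts (n := n) fun e he => (hflow.smoothInCharts_lapse ht e he).continuousOn

/-- By the maximum principle, the lapse function is at most one. -/
theorem lapse_le_one [CompactSpace X] (hflow : IsExpandingCMCEinsteinFlow I L h K H)
    (hubble : ∀ t ∈ I, t = -(n : ℝ) / H t) {t : ℝ} (ht : t ∈ I) (x : X) : L t x ≤ 1 := by
  obtain ⟨x₀, -, hx₀⟩ := isCompact_univ.exists_isMaxOn ⟨x, mem_univ x⟩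
    (hflow.continuous_lapse ht).continuousOn
  refine (hx₀ (mem_univ x)).trans ?_
  set e := chartAt (EuclideanSpace ℝ (Fin n)) x₀
  have he : e ∈ atlas (EuclideanSpace ℝ (Fin n)) X := chart_mem_atlas _ _
  have hxs : x₀ ∈ e.source := mem_chart_source _ x₀
  have hy : e x₀ ∈ e.target := e.map_source hxs
  have hpos := posDef_components he (h t) hy
  have hmax : IsLocalMax (fun z => L t (e.symm z)) (e x₀) := Eventually.of_forall fun z => by
    simp only [e.left_inv hxs]
    exact hx₀ (mem_univ _)
  have h1 := Coord.laplacian_nonpos_of_isLocalMax hpos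
    (((hflow.smoothInCharts_lapse ht e he).contDiffAt (e.open_target.mem_nhds hy)).of_le
      (by simpa using (ENat.LEInfty.out : (2 : WithTop ℕ∞) ≤ ∞))) hmax
  rw [hflow.lapse_equation hubble he ht hy, e.left_inv hxs] at h1
  have h2 := mul_nonneg (hflow.lapse_nonneg t ht x₀) (Coord.normSq_nonneg hpos
    (Coord.tracelessPart (components e (h t).inner (e x₀)) (components e (K t) (e x₀))))
  have hn : 0 < (n : ℝ) := Nat.cast_pos.2 (Nat.pos_of_ne_zero (hflow.dim_ne_zero hubble))
  have ht0 := hflow.pos_of_mem hubble ht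
  -- If `L > 1` at the maximum, both terms on the right of the lapse equation would make the
  -- Laplacian positive there.
  by_contra! hlt
  have : (n : ℝ) / t ^ 2 * (1 - L t x₀) < 0 := mul_neg_of_pos_of_neg (by positivity) (by linarith)
  linarith

end IsExpandingCMCEinsteinFlow

/-- The function `|K⁰|²`. -/
noncomputable def shearSq (g : SmoothMetric n X) (k : Cov2Tensor n X) (x : X) : ℝ :=
  let e := chartAt (EuclideanSpace ℝ (Fin n)) x
  Coord.normSq (components e g.inner (e x))
    (Coord.tracelessPart (components e g.inner (e x)) (components e k (e x)))

theorem shearSq_nonneg (g : SmoothMetric n X) (k : Cov2Tensor n X) (x : X) : 0 ≤ shearSq g k x :=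
  Coord.normSq_nonneg (posDef_components (chart_mem_atlas _ _) g
    ((chartAt (EuclideanSpace ℝ (Fin n)) x).map_source (mem_chart_source _ x))) _

/-- `shearSq` uses the preferred chart at each point; tensoriality allows any chart of the atlas,
which gives continuity and the link with the coordinate equations. -/
theorem shearSq_chart {e : OpenPartialHomeomorph X (EuclideanSpace ℝ (Fin n))}
    (he : e ∈ atlas (EuclideanSpace ℝ (Fin n)) X) (hn : n ≠ 0) (g : SmoothMetric n X)
    {k : Cov2Tensor n X} (hk : ∀ (x : X) (v w : TangentSpace (𝓡 n) x), k x v w = k x w v)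
    {y : EuclideanSpace ℝ (Fin n)} (hy : y ∈ e.target) :
    shearSq g k (e.symm y) = Coord.normSq (components e g.inner y)
      (Coord.tracelessPart (components e g.inner y) (components e k y)) := by
  set c := chartAt (EuclideanSpace ℝ (Fin n)) (e.symm y) with hc
  have hcm : c ∈ atlas (EuclideanSpace ℝ (Fin n)) X := chart_mem_atlas _ _
  have hys : e.symm y ∈ c.source := mem_chart_source _ _
  rw [components_change he hcm g.inner hy hys, components_change he hcm k hy hys,
    Coord.normSq_tracelessPart_congr hn (posDef_components hcm g (c.map_source hys))
      (components_transpose c hk _) (det_jacobian_ne_zero he hcm hy hys)]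
  rfl

/-- Joint continuity of a time-dependent function can be checked in charts. -/
theorem continuousOn_prod_of_charts {X : Type*} [TopologicalSpace X]
    [ChartedSpace (EuclideanSpace ℝ (Fin n)) X] {F : ℝ → X → ℝ}
    (hF : ∀ e ∈ atlas (EuclideanSpace ℝ (Fin n)) X, ContinuousOn
      (fun p : ℝ × EuclideanSpace ℝ (Fin n) => F p.1 (e.symm p.2)) (I ×ˢ e.target)) :
    ContinuousOn (fun p : ℝ × X => F p.1 p.2) (I ×ˢ univ) := by
  rintro ⟨t, x⟩ ⟨ht, -⟩
  set e := chartAt (EuclideanSpace ℝ (Fin n)) x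
  have hx : x ∈ e.source := mem_chart_source _ x
  have hs : univ ×ˢ e.source ∈ 𝓝 (t, x) :=
    (isOpen_univ.prod e.open_source).mem_nhds ⟨mem_univ _, hx⟩
  rw [← continuousWithinAt_inter hs]
  have h1 : ContinuousOn (fun p : ℝ × X => (p.1, e p.2)) (I ×ˢ e.source) :=
    continuousOn_fst.prodMk (e.continuousOn.comp continuousOn_snd fun p hp => hp.2)
  have h2 := (hF e (chart_mem_atlas _ _)).comp h1 fun p hp => ⟨hp.1, e.map_source hp.2⟩
  refine ((h2.congr fun p hp => ?_) (t, x) ⟨ht, hx⟩).mono fun p hp => ⟨hp.1.1, hp.2.2⟩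
  simp [e.left_inv hp.2]

namespace IsExpandingCMCEinsteinFlow

theorem continuousOn_lapse (hflow : IsExpandingCMCEinsteinFlow I L h K H) :
    ContinuousOn (fun p : ℝ × X => L p.1 p.2) (I ×ˢ univ) :=
  continuousOn_prod_of_charts (n := n) fun e he => (hflow.smooth_L e he).continuousOn

theorem continuousOn_shearSq (hflow : IsExpandingCMCEinsteinFlow I L h K H)
    (hubble : ∀ t ∈ I, t = -(n : ℝ) / H t) :
    ContinuousOn (fun p : ℝ × X => shearSq (h p.1) (K p.1) p.2) (I ×ˢ univ) := by
  refine continuousOn_prod_of_charts (n := n) (F := fun t x => shearSq (h t) (K t) x) fun e he => ?_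
  refine ContinuousOn.congr ?_ fun p hp => shearSq_chart he (hflow.dim_ne_zero hubble) (h p.1)
    (hflow.symm p.1 hp.1) hp.2
  have hg := fun i j => (hflow.smooth_h e he i j).continuousOn
  have hk := fun i j => (hflow.smooth_K e he i j).continuousOn
  have hinv : ∀ i j, ContinuousOn (fun p : ℝ × EuclideanSpace ℝ (Fin n) =>
      (components e (h p.1).inner p.2)⁻¹ i j) (I ×ˢ e.target) := fun i j =>
    (contDiffOn_inv_apply (hflow.smooth_h e he)
      (fun p hp => (posDef_components he (h p.1) hp.2).det_pos.ne') i j).continuousOn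
  have htl : ∀ i j, ContinuousOn (fun p : ℝ × EuclideanSpace ℝ (Fin n) =>
      Coord.tracelessPart (components e (h p.1).inner p.2) (components e (K p.1) p.2) i j)
      (I ×ˢ e.target) := fun i j =>
    (hk i j).sub (ContinuousOn.mul (ContinuousOn.div_const (continuousOn_finsetSum _ fun a _ =>
      continuousOn_finsetSum _ fun b _ => (hinv a b).mul (hk a b)) _) (hg i j))
  exact continuousOn_finsetSum _ fun a _ => continuousOn_finsetSum _ fun b _ =>
    continuousOn_finsetSum _ fun c _ => continuousOn_finsetSum _ fun d _ =>
      (((hinv a c).mul (hinv b d)).mul (htl a b)).mul (htl c d)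

theorem continuous_shearSq (hflow : IsExpandingCMCEinsteinFlow I L h K H)
    (hubble : ∀ t ∈ I, t = -(n : ℝ) / H t) {t : ℝ} (ht : t ∈ I) :
    Continuous (shearSq (h t) (K t)) :=
  continuousOn_univ.1 <| (hflow.continuousOn_shearSq hubble).comp (f := fun x => (t, x))
    (by fun_prop) fun _ _ => ⟨ht, mem_univ _⟩

variable [T2Space X] [CompactSpace X] [MeasurableSpace X] [BorelSpace X]

theorem isFiniteMeasure_volume (hflow : IsExpandingCMCEinsteinFlow I L h K H) {t : ℝ}
    (ht : t ∈ I) : IsFiniteMeasure (riemannianVolume (h t).inner) :=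
  isFiniteMeasure_riemannianVolume fun e he i j =>
    (hflow.contDiffOn_metric ht e he i j).continuousOn

/-- The integrated lapse equation. -/
theorem lintegral_lapse_mul_shearSq (hflow : IsExpandingCMCEinsteinFlow I L h K H)
    (hubble : ∀ t ∈ I, t = -(n : ℝ) / H t) {t : ℝ} (ht : t ∈ I) :
    ∫⁻ x, ENNReal.ofReal (t * L t x * shearSq (h t) (K t) x) ∂riemannianVolume (h t).inner =
      ∫⁻ x, ENNReal.ofReal (n / t * (1 - L t x)) ∂riemannianVolume (h t).inner := by
  have := hflow.isFiniteMeasure_volume ht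
  have ht0 := hflow.pos_of_mem hubble ht
  have hInt : ∀ {F : X → ℝ}, Continuous F → Integrable F (riemannianVolume (h t).inner) := fun hF =>
    hF.integrable_of_hasCompactSupport (HasCompactSupport.of_compactSpace _)
  have hL := hflow.continuous_lapse ht
  have hS := hflow.continuous_shearSq hubble ht
  have hc1 : Continuous fun x => t * L t x * shearSq (h t) (K t) x := by fun_prop
  have hc2 : Continuous fun x => n / t * (1 - L t x) := by fun_prop
  have h0 := integral_laplacian_eq_zero (hflow.contDiffOn_metric ht) (hflow.smoothInCharts_lapse ht)
    (q := fun x => L t x * shearSq (h t) (K t) x - n / t ^ 2 * (1 - L t x)) (by fun_prop)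
    fun e he y hy => by
      rw [hflow.lapse_equation hubble he ht hy,
        shearSq_chart he (hflow.dim_ne_zero hubble) (h t) (hflow.symm t ht) hy]
  rw [← ofReal_integral_eq_lintegral_ofReal (hInt hc1), ← ofReal_integral_eq_lintegral_ofReal
    (hInt hc2)]
  · congr 1
    rw [← sub_eq_zero, ← integral_sub (hInt hc1) (hInt hc2)]
    -- The difference of the two integrands is `t` times the Laplacian of `L`.
    rw [← mul_zero t, ← h0, ← integral_const_mul]
    refine integral_congr_ae (Eventually.of_forall fun x => ?_)
    simp only
    field_simp
  · exact Eventually.of_forall fun x => mul_nonneg (by positivity)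
      (sub_nonneg.2 (hflow.lapse_le_one hubble ht x))
  · exact Eventually.of_forall fun x => mul_nonneg (mul_nonneg ht0.le (hflow.lapse_nonneg t ht x))
      (shearSq_nonneg _ _ _)

end IsExpandingCMCEinsteinFlow

end Flow

/-! ### Exponential decay with a variable rate -/

section Decay

variable {X : Type*} [TopologicalSpace X]

/-- The solution of `f' = -θ f`, `f(T) = 1`. -/
noncomputable def decay (θ : ℝ → X → ℝ) (T t : ℝ) (x : X) : ℝ :=
  Real.exp (-∫ τ in T..t, θ τ x)

theorem decay_pos {X : Type*} (θ : ℝ → X → ℝ) (T t : ℝ) (x : X) : 0 < decay θ T t x :=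
  Real.exp_pos _

theorem decay_self {X : Type*} (θ : ℝ → X → ℝ) (T : ℝ) (x : X) : decay θ T T x = 1 := by
  simp [decay]

variable {θ : ℝ → X → ℝ}

theorem continuous_rate_left (hθ : Continuous fun p : ℝ × X => θ p.1 p.2)
    (x : X) : Continuous fun τ => θ τ x :=
  hθ.comp (Continuous.prodMk_left x)

theorem continuous_decay (hθ : Continuous fun p : ℝ × X => θ p.1 p.2)
    (T : ℝ) : Continuous fun p : ℝ × X => decay θ T p.1 p.2 := by
  refine Real.continuous_exp.comp (Continuous.neg ?_)
  exact intervalIntegral.continuous_parametric_intervalIntegral_of_continuous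
    (f := fun (p : ℝ × X) τ => θ τ p.2) (by
      exact hθ.comp (continuous_snd.prodMk (continuous_snd.comp continuous_fst))) continuous_fst

theorem continuous_decay_right (hθ : Continuous fun p : ℝ × X => θ p.1 p.2)
    (T t : ℝ) : Continuous (decay θ T t) :=
  (continuous_decay hθ T).comp (Continuous.prodMk_right t)

theorem hasDerivAt_decay (hθ : Continuous fun p : ℝ × X => θ p.1 p.2)
    (T t : ℝ) (x : X) :
    HasDerivAt (fun τ => decay θ T τ x) (-(θ t x * decay θ T t x)) t := by
  have h1 := ((continuous_rate_left hθ x).integral_hasStrictDerivAt T t).hasDerivAt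
  refine h1.fun_neg.exp.congr_deriv ?_
  rw [decay]; ring

theorem antitone_decay (hθ : Continuous fun p : ℝ × X => θ p.1 p.2)
    (h0 : ∀ τ x, 0 ≤ θ τ x) (T : ℝ) (x : X) : Antitone fun t => decay θ T t x :=
  antitone_of_deriv_nonpos (fun t => (hasDerivAt_decay hθ T t x).differentiableAt) fun t => by
    rw [(hasDerivAt_decay hθ T t x).deriv]
    exact neg_nonpos.2 (mul_nonneg (h0 t x) (decay_pos θ T t x).le)

theorem decay_le_one (hθ : Continuous fun p : ℝ × X => θ p.1 p.2)
    (h0 : ∀ τ x, 0 ≤ θ τ x) {T t : ℝ} (hTt : T ≤ t) (x : X) : decay θ T t x ≤ 1 :=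
  (antitone_decay hθ h0 T x hTt).trans_eq (decay_self θ T x)

/-- The integrand is minus the derivative of the decay factor, so the rate of loss integrates to the
loss. -/
theorem lintegral_rate_mul_decay (hθ : Continuous fun p : ℝ × X => θ p.1 p.2)
    (h0 : ∀ τ x, 0 ≤ θ τ x) (T : ℝ) {s S : ℝ} (hsS : s ≤ S) (x : X) :
    ∫⁻ τ in Icc s S, ENNReal.ofReal (θ τ x * decay θ T τ x) =
      ENNReal.ofReal (decay θ T s x - decay θ T S x) := by
  have hc : Continuous fun τ => θ τ x * decay θ T τ x :=
    (continuous_rate_left hθ x).mul ((continuous_decay hθ T).comp (Continuous.prodMk_left x))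
  rw [← ofReal_integral_eq_lintegral_ofReal]
  · congr 1
    rw [integral_Icc_eq_integral_Ioc, ← intervalIntegral.integral_of_le hsS]
    have := intervalIntegral.integral_eq_sub_of_hasDerivAt (a := s) (b := S)
      (fun t _ => (hasDerivAt_decay hθ T t x).fun_neg)
      (by simpa using hc.intervalIntegrable s S)
    simp only [neg_neg] at this
    rw [this]; ring
  · exact hc.continuousOn.integrableOn_compact isCompact_Icc
  · exact Eventually.of_forall fun τ => mul_nonneg (h0 τ x) (decay_pos θ T τ x).le

/-- The limit of the decay factor. -/
theorem tendsto_decay (hθ : Continuous fun p : ℝ × X => θ p.1 p.2)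
    (h0 : ∀ τ x, 0 ≤ θ τ x) (T : ℝ) (x : X) :
    Tendsto (fun t => decay θ T t x) atTop (𝓝 (⨅ t, decay θ T t x)) :=
  tendsto_atTop_ciInf (antitone_decay hθ h0 T x)
    ⟨0, by rintro _ ⟨t, rfl⟩; exact (decay_pos θ T t x).le⟩

end Decay

/-! ### Evolution of the volume -/

section VolumeEvolution

variable {n : ℕ} {X : Type*} [TopologicalSpace X] [ChartedSpace (EuclideanSpace ℝ (Fin n)) X]

theorem setLIntegral_chartVolume [MeasurableSpace X] [BorelSpace X]
    {e : OpenPartialHomeomorph X (EuclideanSpace ℝ (Fin n))} {h : Cov2Tensor n X}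
    (hc : ∀ i j, ContinuousOn (fun y => components e h y i j) e.target) {F : X → ENNReal}
    (hF : Measurable F) {A : Set X} (hA : MeasurableSet A) :
    ∫⁻ x in A, F x ∂chartVolume e h = ∫⁻ y in e.symm ⁻¹' A ∩ e.target,
      ENNReal.ofReal (Real.sqrt (components e h y).det) * F (e.symm y) := by
  have hm := aemeasurable_chart_symm e
    fun y => ENNReal.ofReal (Real.sqrt (components e h y).det)
  have hsymm : AEMeasurable e.symm (volume.restrict e.target) :=
    e.continuousOn_symm.aemeasurable e.open_target.measurableSet
  have hd : AEMeasurable (fun y => ENNReal.ofReal (Real.sqrt (components e h y).det))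
      (volume.restrict e.target) :=
    ((continuousOn_sqrt_det hc).aemeasurable e.open_target.measurableSet).ennreal_ofReal
  have hFA : Measurable (A.indicator F) := hF.indicator hA
  rw [← lintegral_indicator hA, chartVolume, lintegral_map' hFA.aemeasurable hm,
    lintegral_withDensity_eq_lintegral_mul₀ hd (g := fun y => A.indicator F (e.symm y))
      (hFA.comp_aemeasurable hsymm), ← lintegral_indicator e.open_target.measurableSet,
    ← lintegral_indicator (measurableSet_target_inter_preimage e hA)]
  refine lintegral_congr fun y => ?_
  by_cases hy : y ∈ e.target <;> by_cases hyA : e.symm y ∈ A <;> simp [hyA, hy]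

variable [IsManifold (𝓡 n) ∞ X] {I : Set ℝ} {L : ℝ → X → ℝ} {h : ℝ → SmoothMetric n X}
  {K : ℝ → Cov2Tensor n X} {H : ℝ → ℝ}

/-- The rate `(n / t) (1 - L)` at which the normalized volume decreases, frozen before time `T`. -/
noncomputable def volumeRate {X : Type*} (n : ℕ) (L : ℝ → X → ℝ) (T τ : ℝ) (x : X) : ℝ :=
  n / max τ T * (1 - L (max τ T) x)

theorem volumeRate_of_le {X : Type*} (n : ℕ) (L : ℝ → X → ℝ) {T τ : ℝ} (hτ : T ≤ τ) (x : X) :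
    volumeRate n L T τ x = n / τ * (1 - L τ x) := by
  simp [volumeRate, max_eq_left hτ]

namespace IsExpandingCMCEinsteinFlow

theorem max_mem (hflow : IsExpandingCMCEinsteinFlow I L h K H) {T : ℝ} (hT : T ∈ I) (τ : ℝ) :
    max τ T ∈ I :=
  hflow.mem_of_le hT (le_max_right _ _)

/-- The flow is controlled on `I` only; freezing at `max τ T` gives a rate continuous on all of `ℝ ×
X`, as the lemmas on `decay` require. -/
theorem continuous_volumeRate (hflow : IsExpandingCMCEinsteinFlow I L h K H)
    (hubble : ∀ t ∈ I, t = -(n : ℝ) / H t) {T : ℝ} (hT : T ∈ I) :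
    Continuous fun p : ℝ × X => volumeRate n L T p.1 p.2 := by
  have h1 : Continuous fun p : ℝ × X => L (max p.1 T) p.2 :=
    continuousOn_univ.1 <| hflow.continuousOn_lapse.comp (f := fun p : ℝ × X => (max p.1 T, p.2))
      (by fun_prop) fun p _ => ⟨hflow.max_mem hT _, mem_univ _⟩
  refine (continuous_const.div (by fun_prop) fun p => ?_).mul (continuous_const.sub h1)
  exact (hflow.pos_of_mem hubble (hflow.max_mem hT _)).ne'

theorem volumeRate_nonneg [CompactSpace X] (hflow : IsExpandingCMCEinsteinFlow I L h K H)
    (hubble : ∀ t ∈ I, t = -(n : ℝ) / H t) {T : ℝ} (hT : T ∈ I) (τ : ℝ) (x : X) :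
    0 ≤ volumeRate n L T τ x :=
  mul_nonneg (div_nonneg n.cast_nonneg (hflow.pos_of_mem hubble (hflow.max_mem hT _)).le)
    (sub_nonneg.2 (hflow.lapse_le_one hubble (hflow.max_mem hT _) x))

/-- The evolution of the volume density. -/
theorem sqrt_det_eq (hflow : IsExpandingCMCEinsteinFlow I L h K H)
    (hubble : ∀ t ∈ I, t = -(n : ℝ) / H t) {T : ℝ} (hT : T ∈ I)
    {e : OpenPartialHomeomorph X (EuclideanSpace ℝ (Fin n))}
    (he : e ∈ atlas (EuclideanSpace ℝ (Fin n)) X) {y : EuclideanSpace ℝ (Fin n)}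
    (hy : y ∈ e.target) {t : ℝ} (hTt : T ≤ t) :
    (t ^ n)⁻¹ * Real.sqrt (components e (h t).inner y).det =
      (T ^ n)⁻¹ * (Real.sqrt (components e (h T).inner y).det *
        decay (volumeRate n L T) T t (e.symm y)) := by
  set θ := volumeRate n L T with hθdef
  have hθ := hflow.continuous_volumeRate hubble hT
  set x := e.symm y with hx
  -- The rescaled volume density divided by the decay factor; the two logarithmic derivatives
  -- cancel, so it is constant from `T` on.
  let w : ℝ → ℝ := fun τ => (τ ^ n)⁻¹ * Real.sqrt (components e (h τ).inner y).det *
    (decay θ T τ x)⁻¹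
  have hw : ∀ τ, T ≤ τ → HasDerivWithinAt w 0 I τ := fun τ hτ => by
    have hτI := hflow.mem_of_le hT hτ
    have hτ0 := hflow.pos_of_mem hubble hτI
    have hpos := posDef_components he (h τ) hy
    have hsymm : (components e (K τ) y)ᵀ = components e (K τ) y :=
      components_transpose e (hflow.symm τ hτI) y
    have hh : ∀ i j, HasDerivWithinAt (fun σ => components e (h σ).inner y i j)
        (((-2 * L τ x) • components e (K τ) y) i j) I τ := fun i j => by
      simpa [mul_assoc] using hflow.evolution_h e he τ hτI y hy i j
    have h1 := (hasDerivWithinAt_det_of_ne_zero hh hpos.det_pos.ne').sqrt hpos.det_pos.ne'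
    have htr : ((components e (h τ).inner y)⁻¹ * (-2 * L τ x) • components e (K τ) y).trace =
        2 * L τ x * (n / τ) := by
      rw [Matrix.mul_smul, Matrix.trace_smul, ← Coord.tr_of_symm _ hsymm, hflow.cmc e he τ hτI y hy,
        hflow.mean_curvature_eq hubble hτI, smul_eq_mul]
      ring
    rw [htr] at h1
    have h2 : HasDerivWithinAt (fun σ : ℝ => (σ ^ n)⁻¹) (-(n / τ) * (τ ^ n)⁻¹) I τ := by
      refine ((hasDerivAt_pow n τ).fun_inv (by positivity)).hasDerivWithinAt.congr_deriv ?_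
      have hn := Nat.pos_of_ne_zero (hflow.dim_ne_zero hubble)
      -- The derivative of `σ ^ n` contains the truncated exponent `n - 1`.
      obtain ⟨m, rfl⟩ : ∃ m, n = m + 1 := ⟨n - 1, by omega⟩
      simp only [Nat.add_sub_cancel]
      field_simp
      ring
    have h3 := ((hasDerivAt_decay hθ T τ x).fun_inv (decay_pos θ T τ x).ne').hasDerivWithinAt
      (s := I)
    refine ((h2.fun_mul h1).fun_mul h3).congr_deriv ?_
    have hs := Real.sqrt_pos.2 hpos.det_pos
    have hsq := Real.sq_sqrt hpos.det_pos.le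
    set S := Real.sqrt (components e (h τ).inner y).det with hS
    have hd := decay_pos (volumeRate n L T) T τ x
    rw [← hsq, volumeRate_of_le n L hτ]
    field_simp
    ring
  have hconst := constant_of_has_deriv_right_zero (f := w) (a := T) (b := t)
    (fun τ hτ => (hw τ hτ.1).continuousWithinAt.mono fun σ hσ => hflow.mem_of_le hT hσ.1)
    (fun τ hτ => (hw τ hτ.1).mono fun σ hσ => hflow.mem_of_le hT (hτ.1.trans hσ)) t
    (right_mem_Icc.2 hTt)
  simp only [w, decay_self, inv_one, mul_one] at hconst
  rw [← mul_assoc, ← hconst, mul_assoc, inv_mul_cancel₀ (decay_pos θ T t x).ne', mul_one]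

variable [T2Space X] [CompactSpace X] [MeasurableSpace X] [BorelSpace X]

/-- The normalized volume at time `t` in terms of that at an earlier time `T`. -/
theorem smul_riemannianVolume_eq (hflow : IsExpandingCMCEinsteinFlow I L h K H)
    (hubble : ∀ t ∈ I, t = -(n : ℝ) / H t) {T : ℝ} (hT : T ∈ I) {t : ℝ} (hTt : T ≤ t) :
    ENNReal.ofReal ((t ^ n)⁻¹) • riemannianVolume (h t).inner =
      (ENNReal.ofReal ((T ^ n)⁻¹) • riemannianVolume (h T).inner).withDensity
        fun x => ENNReal.ofReal (decay (volumeRate n L T) T t x) := by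
  have hθ := hflow.continuous_volumeRate hubble hT
  have hf : Measurable fun x => ENNReal.ofReal (decay (volumeRate n L T) T t x) :=
    (continuous_decay_right hθ T t).measurable.ennreal_ofReal
  have htI := hflow.mem_of_le hT hTt
  have ht0 := hflow.pos_of_mem hubble htI
  have hT0 := hflow.pos_of_mem hubble hT
  obtain ⟨F, hF⟩ := isCompact_univ.elim_nhds_subcover
    (fun x : X => (chartAt (EuclideanSpace ℝ (Fin n)) x).source)
    (fun x _ => chart_source_mem_nhds _ x)
  -- Equality of measures is local: it is enough to compare densities in the charts of a finite
  -- cover.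
  refine (Measure.ext_iff_of_biUnion_eq_univ (S := (F : Set X))
    (s := fun x => (chartAt (EuclideanSpace ℝ (Fin n)) x).source) F.countable_toSet
    (univ_subset_iff.1 hF.2)).2 fun i _ => ?_
  set e := chartAt (EuclideanSpace ℝ (Fin n)) i
  have he : e ∈ atlas (EuclideanSpace ℝ (Fin n)) X := chart_mem_atlas _ _
  rw [restrict_withDensity e.open_source.measurableSet, Measure.restrict_smul,
    Measure.restrict_smul, riemannianVolume_restrict_source he,
    riemannianVolume_restrict_source he]
  ext A hA
  rw [withDensity_apply _ hA, Measure.restrict_smul, lintegral_smul_measure, Measure.smul_apply,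
    chartVolume_apply e _ hA, setLIntegral_chartVolume
      (fun i j => (hflow.contDiffOn_metric hT e he i j).continuousOn) hf hA, smul_eq_mul,
    smul_eq_mul, ← lintegral_const_mul' _ _ ENNReal.ofReal_ne_top,
    ← lintegral_const_mul' _ _ ENNReal.ofReal_ne_top]
  refine setLIntegral_congr_fun (measurableSet_target_inter_preimage e hA) fun y hy => ?_
  rw [← ENNReal.ofReal_mul (by positivity), ← ENNReal.ofReal_mul (by positivity),
    ← ENNReal.ofReal_mul (by positivity), hflow.sqrt_det_eq hubble hT he hy.2 hTt]

end IsExpandingCMCEinsteinFlow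

end VolumeEvolution

/-! ### The distance in coordinates -/

section Distance

variable {n : ℕ}

/-- The constant is `(det C)² ^ (-1/(2n))`. The sign of `det C` is free, so the rescaled matrix has
determinant `±1`, which is why invariance of the distance is stated with a square. -/
theorem detNormalize_congr (hn : n ≠ 0) {C : Matrix (Fin n) (Fin n) ℝ}
    (hC : C.det ≠ 0) : ∃ c : ℝ, ((c • C).det) ^ 2 = 1 ∧
      ∀ Q : Matrix (Fin n) (Fin n) ℝ, Q.PosDef →
        detNormalize (Cᵀ * Q * C) = (c • C)ᵀ * detNormalize Q * (c • C) := by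
  have hn' : (n : ℝ) ≠ 0 := Nat.cast_ne_zero.2 hn
  have hC2 : 0 < C.det ^ 2 := by positivity
  refine ⟨(C.det ^ 2) ^ (-(1 / (2 * n : ℝ))), ?_, fun Q hQ => ?_⟩
  · rw [Matrix.det_smul, Fintype.card_fin, mul_pow, ← pow_mul, ← Real.rpow_natCast,
      ← Real.rpow_mul hC2.le, ← Real.rpow_add_one hC2.ne']
    push_cast
    field_simp
    simp
  · have hdet : (Cᵀ * Q * C).det = C.det ^ 2 * Q.det := by
      rw [Matrix.det_mul, Matrix.det_mul, Matrix.det_transpose]; ring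
    have hc : (C.det ^ 2) ^ (-(1 / (2 * n : ℝ))) * (C.det ^ 2) ^ (-(1 / (2 * n : ℝ))) =
        (C.det ^ 2) ^ (-(1 / (n : ℝ))) := by
      rw [← Real.rpow_add hC2]
      congr 1
      field_simp
      norm_num
    rw [detNormalize, detNormalize, hdet, Real.mul_rpow hC2.le hQ.det_pos.le, ← hc,
      Matrix.transpose_smul, Matrix.smul_mul, Matrix.smul_mul, Matrix.mul_smul, Matrix.mul_smul,
      Matrix.smul_mul, smul_smul, smul_smul]

/-- The matrix of an endomorphism in an orthonormal basis is related to the Gram matrices of the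
two inner products that it relates. -/
theorem cosetPoint_toMatrix {g k : EuclideanSpace ℝ (Fin n) →L[ℝ] EuclideanSpace ℝ (Fin n) →L[ℝ] ℝ}
    {A : EuclideanSpace ℝ (Fin n) →ₗ[ℝ] EuclideanSpace ℝ (Fin n)}
    {b : Module.Basis (Fin n) ℝ (EuclideanSpace ℝ (Fin n))}
    (hb : ∀ i j, g (b i) (b j) = if i = j then 1 else 0) (hk : ∀ v w, k v w = g (A v) (A w))
    (c : ℝ) (i j : Fin n) :
    cosetPoint (LinearMap.toMatrix b b (c • A)) i j = c ^ 2 * k (b i) (b j) := by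
  have h1 : ∀ i, (c • A) (b i) = ∑ m, LinearMap.toMatrix b b (c • A) m i • b m := fun i => by
    rw [← b.sum_repr ((c • A) (b i))]
    simp [LinearMap.toMatrix_apply]
  have h2 : c ^ 2 * k (b i) (b j) = g ((c • A) (b i)) ((c • A) (b j)) := by
    rw [hk]
    simp only [LinearMap.smul_apply, map_smul, _root_.smul_apply, smul_eq_mul]
    ring
  rw [h2, h1, h1, cosetPoint, Matrix.mul_apply]
  simp only [map_sum, map_smul, _root_.sum_apply, _root_.smul_apply, smul_eq_mul, hb,
    Matrix.transpose_apply]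
  simp only [mul_ite, mul_one, mul_zero, Finset.sum_ite_eq', Finset.mem_univ, if_true]
  exact Finset.sum_congr rfl fun m _ => mul_comm _ _

/-- In the basis `b` the points `GᵀG` and `1` are the normalized Gram matrices of `k` and `g`.
Passing to the images of the standard basis under `D` is a congruence, an isometry after rescaling
to determinant `±1`. The constant `c` stands for `s⁻²`. -/
theorem symmDist_cosetPoint (hn : n ≠ 0)
    {g k : EuclideanSpace ℝ (Fin n) →L[ℝ] EuclideanSpace ℝ (Fin n) →L[ℝ] ℝ}
    {A D : EuclideanSpace ℝ (Fin n) →ₗ[ℝ] EuclideanSpace ℝ (Fin n)}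
    {b : Module.Basis (Fin n) ℝ (EuclideanSpace ℝ (Fin n))} {c : ℝ} (hc : 0 < c)
    (hb : ∀ i j, c * g (b i) (b j) = if i = j then 1 else 0)
    (hk : ∀ v w, k v w = g (A v) (A w)) (hA : 0 < LinearMap.det A)
    (hD : Function.Bijective D) (hgD : (gramMatrix g D).PosDef) (hkD : (gramMatrix k D).PosDef) :
    symmDist (cosetPoint (LinearMap.toMatrix b b (unimodularPart n A))) 1 =
      symmDist (detNormalize (gramMatrix k D)) (detNormalize (gramMatrix g D)) := by
  have hn' : (n : ℝ) ≠ 0 := Nat.cast_ne_zero.2 hn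
  set a : ℝ := LinearMap.det A ^ (-(1 / (n : ℝ))) with ha
  have ha0 : 0 < a := Real.rpow_pos_of_pos hA _
  let Eb : EuclideanSpace ℝ (Fin n) ≃ₗ[ℝ] EuclideanSpace ℝ (Fin n) :=
    (EuclideanSpace.basisFun (Fin n) ℝ).toBasis.equiv b (Equiv.refl _)
  have hEb : ∀ i, Eb (EuclideanSpace.single i 1) = b i := fun i => by
    have := (EuclideanSpace.basisFun (Fin n) ℝ).toBasis.equiv_apply i b (Equiv.refl _)
    simpa using this
  let De := LinearEquiv.ofBijective D hD
  -- The matrix `C` of `F = D⁻¹ ∘ Eb` is the change of basis from the vectors `D eᵢ` to the basis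
  -- `b`.
  let F : EuclideanSpace ℝ (Fin n) ≃ₗ[ℝ] EuclideanSpace ℝ (Fin n) := Eb.trans De.symm
  have hDF : D ∘ₗ (F : EuclideanSpace ℝ (Fin n) →ₗ[ℝ] _) = Eb := by
    ext1 v
    exact De.apply_symm_apply (Eb v)
  set C := stdMatrix (F : EuclideanSpace ℝ (Fin n) →ₗ[ℝ] _) with hCdef
  have hC : C.det ≠ 0 := by
    rw [hCdef, det_stdMatrix]
    exact (LinearEquiv.isUnit_det' F).ne_zero
  have hgram : ∀ B, gramMatrix B (Eb : EuclideanSpace ℝ (Fin n) →ₗ[ℝ] _) =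
      Cᵀ * gramMatrix B D * C := fun B => by rw [← hDF, gramMatrix_comp]
  have hpos : ∀ {P : Matrix (Fin n) (Fin n) ℝ}, P.PosDef → (Cᵀ * P * C).PosDef := fun hP => by
    simpa using hP.conjTranspose_mul_mul_same (B := C) (Matrix.mulVec_injective_of_isUnit
      ((Matrix.isUnit_iff_isUnit_det _).2 (isUnit_iff_ne_zero.2 hC)))
  have hg1 : c • (Cᵀ * gramMatrix g D * C) = 1 := by
    rw [← hgram]
    ext i j
    simp [gramMatrix, hEb, hb, Matrix.one_apply]
  have hk1 : cosetPoint (LinearMap.toMatrix b b (unimodularPart n A)) =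
      (a ^ 2 * c) • (Cᵀ * gramMatrix k D * C) := by
    rw [← hgram]
    ext i j
    have h1 := cosetPoint_toMatrix (g := c • g) (k := c • k) (A := A) (b := b)
      (fun i j => by simpa using hb i j) (fun v w => by simp [hk]) a i j
    rw [unimodularPart, ← ha, h1]
    simp [gramMatrix, hEb]
    ring
  have hkdet : (cosetPoint (LinearMap.toMatrix b b (unimodularPart n A))).det = 1 := by
    rw [cosetPoint, Matrix.det_mul, Matrix.det_transpose, LinearMap.det_toMatrix, unimodularPart,
      LinearMap.det_smul, finrank_euclideanSpace_fin, ← Real.rpow_natCast, ← Real.rpow_mul hA.le]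
    have : (LinearMap.det A ^ (-(1 / (n : ℝ)) * n)) * LinearMap.det A = 1 := by
      rw [← Real.rpow_add_one hA.ne']
      field_simp
      simp
    rw [this, one_mul]
  obtain ⟨r, hr, hcongr⟩ := detNormalize_congr hn hC
  have e1 : (1 : Matrix (Fin n) (Fin n) ℝ) =
      (r • C)ᵀ * detNormalize (gramMatrix g D) * (r • C) := by
    rw [← hcongr _ hgD, ← detNormalize_smul hn (hpos hgD) hc, hg1,
      detNormalize_of_det_eq_one Matrix.det_one]
  have e2 : cosetPoint (LinearMap.toMatrix b b (unimodularPart n A)) =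
      (r • C)ᵀ * detNormalize (gramMatrix k D) * (r • C) := by
    rw [← hcongr _ hkD, ← detNormalize_smul hn (hpos hkD) (c := a ^ 2 * c) (by positivity), ← hk1,
      detNormalize_of_det_eq_one hkdet]
  rw [e2, e1, symmDist_congr hr]

end Distance

/-! ### The distance along the flow: bound by the energy, and measurability -/

section FlowDistance

variable {n : ℕ} {X : Type*} [TopologicalSpace X] [ChartedSpace (EuclideanSpace ℝ (Fin n)) X]
  [IsManifold (𝓡 n) ∞ X] {I : Set ℝ} {L : ℝ → X → ℝ} {h : ℝ → SmoothMetric n X}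
  {K : ℝ → Cov2Tensor n X} {H : ℝ → ℝ}

/-- The distance of the unimodular part of the endomorphism relating `h(s)` and `h(Λs)` from the
base point, in a chart. -/
theorem symmDist_relates (hn : n ≠ 0) {s Λ : ℝ} (hs : 0 < s)
    {e : OpenPartialHomeomorph X (EuclideanSpace ℝ (Fin n))}
    (he : e ∈ atlas (EuclideanSpace ℝ (Fin n)) X) {y : EuclideanSpace ℝ (Fin n)}
    (hy : y ∈ e.target)
    {A : TangentSpace (𝓡 n) (e.symm y) →ₗ[ℝ] TangentSpace (𝓡 n) (e.symm y)}
    {b : Module.Basis (Fin n) ℝ (TangentSpace (𝓡 n) (e.symm y))}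
    (hA : Relates (rescaledMetric h s 1 (e.symm y)) (rescaledMetric h s Λ (e.symm y)) A)
    (hb : IsOrthonormalBasis (rescaledMetric h s 1 (e.symm y)) b) :
    symmDist (cosetPoint (LinearMap.toMatrix b b (unimodularPart n A))) 1 =
      symmDist (detNormalize (components e (h (s * Λ)).inner y))
        (detNormalize (components e (h s).inner y)) := by
  have hs2 : 0 < (s ^ 2)⁻¹ := by positivity
  refine symmDist_cosetPoint hn (g := tensorAt (h s).inner (e.symm y))
    (k := tensorAt (h (s * Λ)).inner (e.symm y)) (D := chartDeriv e y) hs2 (fun i j => ?_)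
    (fun v w => ?_) hA.2 ⟨chartDeriv_injective he hy, chartDeriv_surjective he hy⟩
    (posDef_components he (h s) hy) (posDef_components he (h (s * Λ)) hy)
  · have := hb i j
    rw [rescaledMetric, mul_one] at this
    exact this
  · have := hA.1 v w
    rw [rescaledMetric, rescaledMetric, mul_one] at this
    exact mul_left_cancel₀ hs2.ne' this

theorem normSq_tracelessPart_smul (g T : Matrix (Fin n) (Fin n) ℝ) (c : ℝ) :
    Coord.normSq g (Coord.tracelessPart g (c • T)) =
      c ^ 2 * Coord.normSq g (Coord.tracelessPart g T) := by
  have h1 : Coord.tr g (c • T) = c * Coord.tr g T := by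
    simp only [Coord.tr, Finset.mul_sum, Matrix.smul_apply, smul_eq_mul]
    exact Finset.sum_congr rfl fun i _ => Finset.sum_congr rfl fun j _ => by ring
  have h2 : Coord.tracelessPart g (c • T) = c • Coord.tracelessPart g T := by
    rw [Coord.tracelessPart, Coord.tracelessPart, h1, smul_sub, smul_smul, mul_div_assoc]
  rw [h2]
  simp only [Coord.normSq, Finset.mul_sum, Matrix.smul_apply, smul_eq_mul]
  exact Finset.sum_congr rfl fun i _ => Finset.sum_congr rfl fun j _ =>
    Finset.sum_congr rfl fun k _ => Finset.sum_congr rfl fun l _ => by ring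

namespace IsExpandingCMCEinsteinFlow

/-- The distance between the conformal classes of `h(s)` and `h(S)` at a point. -/
theorem symmDist_metric_le (hflow : IsExpandingCMCEinsteinFlow I L h K H)
    (hubble : ∀ t ∈ I, t = -(n : ℝ) / H t) {s S : ℝ} (hs : s ∈ I) (hsS : s < S)
    {e : OpenPartialHomeomorph X (EuclideanSpace ℝ (Fin n))}
    (he : e ∈ atlas (EuclideanSpace ℝ (Fin n)) X) {y : EuclideanSpace ℝ (Fin n)}
    (hy : y ∈ e.target) :
    symmDist (detNormalize (components e (h S).inner y))
        (detNormalize (components e (h s).inner y)) ≤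
      ∫⁻ τ in Icc s S, ENNReal.ofReal
        (2 * L τ (e.symm y) * Real.sqrt (shearSq (h τ) (K τ) (e.symm y))) := by
  have hn := hflow.dim_ne_zero hubble
  -- Time runs backwards from `S` to `s`, so the curve starts at the later metric, matching the
  -- order of the arguments of `symmDist`.
  let σ : ℝ → ℝ := fun u => S - (S - s) * u
  have hd : 0 < S - s := sub_pos.2 hsS
  have hσder : ∀ u A, HasDerivWithinAt σ (-(S - s)) A u := fun u A => by
    simpa using (((hasDerivAt_id u).const_mul (S - s)).const_sub S).hasDerivWithinAt (s := A)
  have hσmem : ∀ u ∈ Icc (0 : ℝ) 1, σ u ∈ Icc s S := fun u hu => by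
    constructor <;> simp only [σ] <;> nlinarith [hu.1, hu.2]
  have hσI : ∀ u ∈ Icc (0 : ℝ) 1, σ u ∈ I := fun u hu => hflow.mem_of_le hs (hσmem u hu).1
  have hσimg : σ '' Icc 0 1 = Icc s S := by
    ext τ
    constructor
    · rintro ⟨u, hu, rfl⟩; exact hσmem u hu
    · intro hτ
      refine ⟨(S - τ) / (S - s), ⟨div_nonneg (by linarith [hτ.2]) hd.le,
        (div_le_one hd).2 (by linarith [hτ.1])⟩, ?_⟩
      simp only [σ]
      field_simp
      ring
  have hσinj : InjOn σ (Icc 0 1) := fun u _ v _ huv => by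
    simp only [σ] at huv
    have : (S - s) * u = (S - s) * v := by linarith
    exact mul_left_cancel₀ hd.ne' this
  have hγ : ∀ i j, ContDiffOn ℝ 1 (fun u => components e (h (σ u)).inner y i j) (Icc 0 1) :=
    fun i j => ((hflow.smooth_h e he i j).of_le (by simp)).comp (f := fun u => (σ u, y))
      ((contDiffOn_const.sub (contDiffOn_const.mul contDiffOn_id)).prodMk contDiffOn_const)
      fun u hu => ⟨hσI u hu, hy⟩
  have hV : ∀ u ∈ Icc (0 : ℝ) 1, ∀ i j, HasDerivWithinAt
      (fun v => components e (h (σ v)).inner y i j)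
      (((2 * (S - s) * L (σ u) (e.symm y)) • components e (K (σ u)) y) i j) (Icc 0 1) u :=
    fun u hu i j => by
      have h1 := (hflow.evolution_h e he (σ u) (hσI u hu) y hy i j).scomp u
        (hσder u (Icc 0 1)) (fun v hv => hσI v hv)
      refine h1.congr_deriv ?_
      simp only [Matrix.smul_apply, smul_eq_mul]
      ring
  have hle := symmDist_detNormalize_le hn (γ := fun u => components e (h (σ u)).inner y) hγ
    (fun u hu => posDef_components he (h (σ u)) hy) hV
  have e0 : σ 0 = S := by simp [σ]
  have e1 : σ 1 = s := by simp [σ]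
  simp only [e0, e1] at hle
  refine hle.trans (le_of_eq ?_)
  rw [← hσimg, lintegral_image_eq_lintegral_abs_deriv_mul measurableSet_Icc
    (fun u hu => hσder u _) hσinj]
  refine setLIntegral_congr_fun measurableSet_Icc fun u hu => ?_
  have hL := hflow.lapse_nonneg (σ u) (hσI u hu) (e.symm y)
  rw [normSq_tracelessPart_smul, Real.sqrt_mul (sq_nonneg _), Real.sqrt_sq (by positivity),
    shearSq_chart he hn (h (σ u)) (hflow.symm _ (hσI u hu)) hy, abs_neg, abs_of_pos hd,
    ← ENNReal.ofReal_mul hd.le]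
  congr 1
  ring

/-- The square of the distance is bounded by the energy. -/
theorem sq_symmDist_metric_le [CompactSpace X] (hflow : IsExpandingCMCEinsteinFlow I L h K H)
    (hubble : ∀ t ∈ I, t = -(n : ℝ) / H t) {s Λ : ℝ} (hs : s ∈ I) (hΛ : 1 < Λ)
    {e : OpenPartialHomeomorph X (EuclideanSpace ℝ (Fin n))}
    (he : e ∈ atlas (EuclideanSpace ℝ (Fin n)) X) {y : EuclideanSpace ℝ (Fin n)}
    (hy : y ∈ e.target) :
    symmDist (detNormalize (components e (h (s * Λ)).inner y))
        (detNormalize (components e (h s).inner y)) ^ 2 ≤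
      ENNReal.ofReal (4 * Real.log Λ) * ∫⁻ τ in Icc s (s * Λ), ENNReal.ofReal
        (τ * L τ (e.symm y) * shearSq (h τ) (K τ) (e.symm y)) := by
  have hs0 := hflow.pos_of_mem hubble hs
  have hsS : s < s * Λ := by nlinarith
  set x := e.symm y
  have hsub : ∀ τ ∈ Icc s (s * Λ), τ ∈ I := fun τ hτ => hflow.mem_of_le hs hτ.1
  have hpos : ∀ τ ∈ Icc s (s * Λ), 0 < τ := fun τ hτ => hs0.trans_le hτ.1
  have hLc : ContinuousOn (fun τ => L τ x) (Icc s (s * Λ)) :=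
    hflow.continuousOn_lapse.comp (f := fun τ => (τ, x)) (by fun_prop)
      fun τ hτ => ⟨hsub τ hτ, mem_univ _⟩
  have hSc : ContinuousOn (fun τ => shearSq (h τ) (K τ) x) (Icc s (s * Λ)) :=
    (hflow.continuousOn_shearSq hubble).comp (f := fun τ => (τ, x)) (by fun_prop)
      fun τ hτ => ⟨hsub τ hτ, mem_univ _⟩
  -- Cauchy–Schwarz for `2L|K⁰| = (2/√τ) · (√τ L|K⁰|)`: the square of the first factor is `4/τ`,
  -- with integral `4 log Λ` over `[s, Λs]`.
  let f : ℝ → ENNReal := fun τ => ENNReal.ofReal (2 / Real.sqrt τ)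
  let g : ℝ → ENNReal := fun τ =>
    ENNReal.ofReal (Real.sqrt τ * L τ x * Real.sqrt (shearSq (h τ) (K τ) x))
  have hf : AEMeasurable f (volume.restrict (Icc s (s * Λ))) :=
    (ContinuousOn.aemeasurable (ContinuousOn.div continuousOn_const
      Real.continuous_sqrt.continuousOn fun τ hτ => (Real.sqrt_pos.2 (hpos τ hτ)).ne')
      measurableSet_Icc).ennreal_ofReal
  have hg : AEMeasurable g (volume.restrict (Icc s (s * Λ))) :=
    (ContinuousOn.aemeasurable ((Real.continuous_sqrt.continuousOn.mul hLc).mul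
      (Real.continuous_sqrt.comp_continuousOn hSc)) measurableSet_Icc).ennreal_ofReal
  have hfg : ∫⁻ τ in Icc s (s * Λ), ENNReal.ofReal
      (2 * L τ x * Real.sqrt (shearSq (h τ) (K τ) x)) = ∫⁻ τ in Icc s (s * Λ), (f * g) τ := by
    refine setLIntegral_congr_fun measurableSet_Icc fun τ hτ => ?_
    have := Real.sqrt_pos.2 (hpos τ hτ)
    simp only [Pi.mul_apply, f, g]
    rw [← ENNReal.ofReal_mul (by positivity)]
    congr 1
    field_simp
  have hf2 : ∫⁻ τ in Icc s (s * Λ), f τ ^ (2 : ℝ) = ENNReal.ofReal (4 * Real.log Λ) := by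
    have h1 : ∫⁻ τ in Icc s (s * Λ), f τ ^ (2 : ℝ) =
        ∫⁻ τ in Icc s (s * Λ), ENNReal.ofReal (4 * τ⁻¹) := by
      refine setLIntegral_congr_fun measurableSet_Icc fun τ hτ => ?_
      simp only [f]
      rw [ENNReal.ofReal_rpow_of_nonneg (by positivity) (by norm_num)]
      congr 1
      rw [Real.rpow_two, div_pow, Real.sq_sqrt (hpos τ hτ).le]
      ring
    rw [h1, ← ofReal_integral_eq_lintegral_ofReal]
    · congr 1
      rw [integral_Icc_eq_integral_Ioc, ← intervalIntegral.integral_of_le hsS.le,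
        intervalIntegral.integral_const_mul, integral_inv_of_pos hs0 (by positivity),
        mul_div_cancel_left₀ _ hs0.ne']
    · exact (continuousOn_const.mul (continuousOn_id.inv₀ fun τ hτ =>
        (hpos τ hτ).ne')).integrableOn_compact isCompact_Icc
    · refine (ae_restrict_iff' measurableSet_Icc).2 (Eventually.of_forall fun τ hτ => ?_)
      have := hpos τ hτ
      simp only [Pi.zero_apply]
      positivity
  have hg2 : ∫⁻ τ in Icc s (s * Λ), g τ ^ (2 : ℝ) ≤ ∫⁻ τ in Icc s (s * Λ), ENNReal.ofReal
        (τ * L τ x * shearSq (h τ) (K τ) x) := by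
    refine setLIntegral_mono' measurableSet_Icc fun τ hτ => ?_
    have hL0 := hflow.lapse_nonneg τ (hsub τ hτ) x
    have hL1 := hflow.lapse_le_one hubble (hsub τ hτ) x
    have hS0 := shearSq_nonneg (h τ) (K τ) x
    have hτ0 := hpos τ hτ
    simp only [g]
    rw [ENNReal.ofReal_rpow_of_nonneg (by positivity) (by norm_num)]
    refine ENNReal.ofReal_le_ofReal ?_
    rw [Real.rpow_two, mul_pow, mul_pow, Real.sq_sqrt hτ0.le, Real.sq_sqrt hS0]
    -- What remains is `L² ≤ L`, from `0 ≤ L ≤ 1`.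
    gcongr
    nlinarith
  have hCS := ENNReal.lintegral_mul_le_Lp_mul_Lq (volume.restrict (Icc s (s * Λ)))
    Real.HolderConjugate.two_two hf hg
  rw [← hfg] at hCS
  have hle := (hflow.symmDist_metric_le hubble hs hsS he hy).trans hCS
  refine (pow_le_pow_left' hle 2).trans ?_
  rw [mul_pow, ← ENNReal.rpow_natCast, ← ENNReal.rpow_natCast, ← ENNReal.rpow_mul,
    ← ENNReal.rpow_mul]
  have h2 : (1 / 2 : ℝ) * ((2 : ℕ) : ℝ) = 1 := by norm_num
  rw [h2, ENNReal.rpow_one, ENNReal.rpow_one, hf2]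
  gcongr

/-- The distance between conformal classes, computed in charts, is a measurable function. -/
theorem measurable_of_eq_symmDist [MeasurableSpace X] [BorelSpace X]
    (hflow : IsExpandingCMCEinsteinFlow I L h K H) (hn : n ≠ 0) {s S : ℝ} (hs : s ∈ I)
    (hS : S ∈ I) {D : X → ENNReal}
    (hD : ∀ e ∈ atlas (EuclideanSpace ℝ (Fin n)) X, ∀ y ∈ e.target,
      D (e.symm y) = symmDist (detNormalize (components e (h S).inner y))
        (detNormalize (components e (h s).inner y))) : Measurable D := by
  -- Upper semicontinuity suffices: the sets where `D < c` are open.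
  refine measurable_of_Iio fun c => IsOpen.measurableSet (isOpen_iff_eventually.2 fun x hx => ?_)
  set e := chartAt (EuclideanSpace ℝ (Fin n)) x
  have he : e ∈ atlas (EuclideanSpace ℝ (Fin n)) X := chart_mem_atlas _ _
  have hxs : x ∈ e.source := mem_chart_source _ x
  have hxt := e.map_source hxs
  have hDx : ∀ z ∈ e.source, D z = symmDist (detNormalize (components e (h S).inner (e z)))
      (detNormalize (components e (h s).inner (e z))) := fun z hz => by
    rw [← hD e he (e z) (e.map_source hz), e.left_inv hz]
  have hcont : ∀ {t}, t ∈ I →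
      ContinuousAt (fun z => detNormalize (components e (h t).inner (e z))) x :=
    fun {t} ht => by
      have h1 : ContinuousAt (components e (h t).inner) (e x) :=
        continuousAt_pi.2 fun i => continuousAt_pi.2 fun j =>
          (hflow.contDiffOn_metric ht e he i j).continuousOn.continuousAt
            (e.open_target.mem_nhds hxt)
      exact ContinuousAt.comp (g := detNormalize) (continuousAt_detNormalize
        (posDef_components he (h t) hxt).det_pos.ne') (h1.comp (e.continuousAt hxs))
  have hx' : D x < c := hx
  rw [hDx x hxs] at hx'
  have hev := ((hcont hS).prodMk_nhds (hcont hs)).eventually (eventually_symmDist_lt hn hx')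
  filter_upwards [hev, e.open_source.mem_nhds hxs] with z hz hzs
  have hzt := e.map_source hzs
  have hp1 := posDef_components he (h S) hzt
  have hp2 := posDef_components he (h s) hzt
  change D z < c
  rw [hDx z hzs]
  exact hz (posDef_detNormalize hp1).transpose_eq (posDef_detNormalize hp2).transpose_eq
    (det_detNormalize hn hp1) (det_detNormalize hn hp2)

end IsExpandingCMCEinsteinFlow

end FlowDistance

/-! ### The limit of the rescaled volumes -/

/-- If `f ≤ d` and the integrals of `dE` and `dG` agree on each slice, then the integral of `E`
against the density `f` is at most that of `dG`. -/
theorem lintegral_withDensity_slices_le {X : Type*} [MeasurableSpace X] {μ : Measure X} [SFinite μ]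
    {E d G : X × ℝ → ENNReal} {f : X → ENNReal} (hE : Measurable E) (hd : Measurable d)
    (hG : Measurable G) (hf : Measurable f) (hfd : ∀ x τ, f x ≤ d (x, τ)) {J : Set ℝ}
    (hJ : MeasurableSet J)
    (h : ∀ τ ∈ J, ∫⁻ x, d (x, τ) * E (x, τ) ∂μ = ∫⁻ x, d (x, τ) * G (x, τ) ∂μ) :
    ∫⁻ x, (∫⁻ τ in J, E (x, τ)) ∂μ.withDensity f ≤ ∫⁻ x, (∫⁻ τ in J, d (x, τ) * G (x, τ)) ∂μ := by
  calc ∫⁻ x, (∫⁻ τ in J, E (x, τ)) ∂μ.withDensity f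
      = ∫⁻ x, f x * (∫⁻ τ in J, E (x, τ)) ∂μ :=
        lintegral_withDensity_eq_lintegral_mul _ hf hE.lintegral_prod_right'
    _ ≤ ∫⁻ x, (∫⁻ τ in J, d (x, τ) * E (x, τ)) ∂μ := by
        refine lintegral_mono fun x => ?_
        have hEx : Measurable fun τ => E (x, τ) := hE.comp measurable_prodMk_left
        rw [← lintegral_const_mul _ hEx]
        exact lintegral_mono fun τ => mul_le_mul_left (hfd x τ) _
    _ = ∫⁻ τ in J, ∫⁻ x, d (x, τ) * E (x, τ) ∂μ :=
        lintegral_lintegral_swap (hd.mul hE).aemeasurable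
    _ = ∫⁻ τ in J, ∫⁻ x, d (x, τ) * G (x, τ) ∂μ := setLIntegral_congr_fun hJ h
    _ = ∫⁻ x, (∫⁻ τ in J, d (x, τ) * G (x, τ)) ∂μ :=
        (lintegral_lintegral_swap (hd.mul hG).aemeasurable).symm

section LimitVolume

variable {n : ℕ} {X : Type*} [TopologicalSpace X] [ChartedSpace (EuclideanSpace ℝ (Fin n)) X]
  [IsManifold (𝓡 n) ∞ X] [MeasurableSpace X] {I : Set ℝ} {L : ℝ → X → ℝ}
  {h : ℝ → SmoothMetric n X} {K : ℝ → Cov2Tensor n X} {H : ℝ → ℝ}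

/-- The rescaled volume `t⁻ⁿ dvol(X, h(t))`. -/
noncomputable def scaledVolume (h : ℝ → SmoothMetric n X) (t : ℝ) : Measure X :=
  ENNReal.ofReal ((t ^ n)⁻¹) • riemannianVolume (h t).inner

/-- The limit of the rescaled volumes, by its density with respect to the one at time `T`. -/
noncomputable def limitVolume (L : ℝ → X → ℝ) (h : ℝ → SmoothMetric n X) (T : ℝ) : Measure X :=
  (scaledVolume h T).withDensity fun x => ENNReal.ofReal (⨅ t, decay (volumeRate n L T) T t x)

namespace IsExpandingCMCEinsteinFlow

variable [CompactSpace X] [BorelSpace X]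

theorem isFiniteMeasure_scaledVolume [T2Space X] (hflow : IsExpandingCMCEinsteinFlow I L h K H)
    {t : ℝ} (ht : t ∈ I) : IsFiniteMeasure (scaledVolume h t) := by
  have := hflow.isFiniteMeasure_volume ht
  exact Measure.smul_finite _ ENNReal.ofReal_ne_top

/-- The infimum over uncountably many times is, by monotonicity, the limit along the integers. -/
theorem measurable_iInf_decay (hflow : IsExpandingCMCEinsteinFlow I L h K H)
    (hubble : ∀ t ∈ I, t = -(n : ℝ) / H t) {T : ℝ} (hT : T ∈ I) :
    Measurable fun x => ⨅ t, decay (volumeRate n L T) T t x := by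
  have hθ := hflow.continuous_volumeRate hubble hT
  refine measurable_of_tendsto_metrizable
    (f := fun (k : ℕ) x => decay (volumeRate n L T) T k x)
    (fun k => (continuous_decay_right hθ T k).measurable) (tendsto_pi_nhds.2 fun x => ?_)
  exact (tendsto_decay hθ (hflow.volumeRate_nonneg hubble hT) T x).comp tendsto_natCast_atTop_atTop

theorem isLimitVolume_limitVolume [T2Space X] (hflow : IsExpandingCMCEinsteinFlow I L h K H)
    (hubble : ∀ t ∈ I, t = -(n : ℝ) / H t) {T : ℝ} (hT : T ∈ I) :
    IsLimitVolume h (limitVolume L h T) := by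
  intro A hA
  have hθ := hflow.continuous_volumeRate hubble hT
  have h0 := hflow.volumeRate_nonneg hubble hT
  have := hflow.isFiniteMeasure_scaledVolume hT
  rw [limitVolume, withDensity_apply _ hA]
  have hev : (fun t => ∫⁻ x in A, ENNReal.ofReal (decay (volumeRate n L T) T t x)
      ∂scaledVolume h T) =ᶠ[atTop]
      fun t => ENNReal.ofReal ((t ^ n)⁻¹) * riemannianVolume (h t).inner A := by
    filter_upwards [eventually_ge_atTop T] with t ht
    rw [← withDensity_apply _ hA, scaledVolume, ← hflow.smul_riemannianVolume_eq hubble hT ht,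
      Measure.smul_apply, smul_eq_mul]
  refine Tendsto.congr' hev ?_
  -- The decay factors are at most one from time `T` on, and the measure at time `T` is finite.
  refine tendsto_lintegral_filter_of_dominated_convergence (fun _ => 1)
    (Eventually.of_forall fun t => (continuous_decay_right hθ T t).measurable.ennreal_ofReal)
    ?_ (by simp) (Eventually.of_forall fun x => ?_)
  · filter_upwards [eventually_ge_atTop T] with t ht
    refine Eventually.of_forall fun x => ?_
    exact ENNReal.ofReal_le_one.2 (decay_le_one hθ h0 ht x)
  · exact (ENNReal.continuous_ofReal.tendsto _).comp (tendsto_decay hθ h0 T x)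

/-- The space integral of the energy at a fixed time. -/
theorem lintegral_decay_mul_energy [T2Space X] (hflow : IsExpandingCMCEinsteinFlow I L h K H)
    (hubble : ∀ t ∈ I, t = -(n : ℝ) / H t) {T τ : ℝ} (hT : T ∈ I) (hTτ : T ≤ τ) :
    ∫⁻ x, ENNReal.ofReal (decay (volumeRate n L T) T τ x) *
        ENNReal.ofReal (τ * L τ x * shearSq (h τ) (K τ) x) ∂scaledVolume h T =
      ∫⁻ x, ENNReal.ofReal (decay (volumeRate n L T) T τ x) *
        ENNReal.ofReal (n / τ * (1 - L τ x)) ∂scaledVolume h T := by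
  have hτ := hflow.mem_of_le hT hTτ
  have hd : Measurable fun x => ENNReal.ofReal (decay (volumeRate n L T) T τ x) :=
    (continuous_decay_right (hflow.continuous_volumeRate hubble hT) T τ).measurable.ennreal_ofReal
  -- The decay weight turns the rescaled volume at time `T` into that at time `τ`, where the
  -- integrated lapse equation applies.
  have key : ∀ {F : X → ENNReal}, Measurable F →
      ∫⁻ x, ENNReal.ofReal (decay (volumeRate n L T) T τ x) * F x ∂scaledVolume h T =
        ENNReal.ofReal ((τ ^ n)⁻¹) * ∫⁻ x, F x ∂riemannianVolume (h τ).inner := fun {F} hF => by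
    have h1 := lintegral_withDensity_eq_lintegral_mul (scaledVolume h T) hd hF
    rw [scaledVolume, ← hflow.smul_riemannianVolume_eq hubble hT hTτ, lintegral_smul_measure] at h1
    exact h1.symm
  have hL := hflow.continuous_lapse hτ
  have hS := hflow.continuous_shearSq hubble hτ
  have h1 : Measurable fun x => τ * L τ x * shearSq (h τ) (K τ) x :=
    ((continuous_const.mul hL).mul hS).measurable
  have h2 : Measurable fun x => n / τ * (1 - L τ x) :=
    (continuous_const.mul (continuous_const.sub hL)).measurable
  rw [key h1.ennreal_ofReal, key h2.ennreal_ofReal,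
    hflow.lintegral_lapse_mul_shearSq hubble hτ]

/-- The energy against the limit of the volumes is bounded by the loss of rescaled volume. -/
theorem lintegral_energy_le [T2Space X] (hflow : IsExpandingCMCEinsteinFlow I L h K H)
    (hubble : ∀ t ∈ I, t = -(n : ℝ) / H t) {T : ℝ} (hT : T ∈ I) {s S : ℝ} (hTs : T ≤ s)
    (hsS : s ≤ S) :
    ∫⁻ x, (∫⁻ τ in Icc s S, ENNReal.ofReal (τ * L τ x * shearSq (h τ) (K τ) x))
        ∂limitVolume L h T ≤
      ∫⁻ x, ENNReal.ofReal (decay (volumeRate n L T) T s x - decay (volumeRate n L T) T S x)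
        ∂scaledVolume h T := by
  -- Second countability makes continuous functions on `X × ℝ` measurable for the product σ-algebra,
  -- as Tonelli's theorem requires.
  have : SecondCountableTopology X :=
    ChartedSpace.secondCountable_of_sigmaCompact (EuclideanSpace ℝ (Fin n)) X
  have := hflow.isFiniteMeasure_scaledVolume hT
  have hθ := hflow.continuous_volumeRate hubble hT
  have h0 := hflow.volumeRate_nonneg hubble hT
  -- The energy density, frozen before `T` to be jointly continuous everywhere; on `[s, S]` it is
  -- the true one.
  let E : X × ℝ → ℝ := fun p =>
    max p.2 T * L (max p.2 T) p.1 * shearSq (h (max p.2 T)) (K (max p.2 T)) p.1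
  have hmaps : MapsTo (fun p : X × ℝ => (max p.2 T, p.1)) univ (I ×ˢ univ) :=
    fun p _ => ⟨hflow.max_mem hT _, mem_univ _⟩
  have hL : Continuous fun p : X × ℝ => L (max p.2 T) p.1 :=
    continuousOn_univ.1 <| hflow.continuousOn_lapse.comp
      (f := fun p : X × ℝ => (max p.2 T, p.1)) (by fun_prop) hmaps
  have hS : Continuous fun p : X × ℝ => shearSq (h (max p.2 T)) (K (max p.2 T)) p.1 :=
    continuousOn_univ.1 <| (hflow.continuousOn_shearSq hubble).comp
      (f := fun p : X × ℝ => (max p.2 T, p.1)) (by fun_prop) hmaps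
  have hE : Continuous E := ((continuous_snd.max continuous_const).mul hL).mul hS
  have hIcc : ∀ τ ∈ Icc s S, max τ T = τ := fun τ hτ => max_eq_left (hTs.trans hτ.1)
  have hleft : ∀ x, ∫⁻ τ in Icc s S, ENNReal.ofReal (τ * L τ x * shearSq (h τ) (K τ) x) =
      ∫⁻ τ in Icc s S, ENNReal.ofReal (E (x, τ)) := fun x =>
    setLIntegral_congr_fun measurableSet_Icc fun τ hτ => by simp only [E, hIcc τ hτ]
  have hright : ∀ x, ENNReal.ofReal
      (decay (volumeRate n L T) T s x - decay (volumeRate n L T) T S x) =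
      ∫⁻ τ in Icc s S, ENNReal.ofReal (decay (volumeRate n L T) T τ x) *
        ENNReal.ofReal (volumeRate n L T τ x) := fun x => by
    rw [← lintegral_rate_mul_decay hθ h0 T hsS x]
    refine lintegral_congr fun τ => ?_
    rw [ENNReal.ofReal_mul (h0 τ x), mul_comm]
  simp only [hleft, hright]
  refine lintegral_withDensity_slices_le hE.measurable.ennreal_ofReal
    ((continuous_decay hθ T).comp continuous_swap).measurable.ennreal_ofReal
    (hθ.comp continuous_swap).measurable.ennreal_ofReal
    (hflow.measurable_iInf_decay hubble hT).ennreal_ofReal (fun x τ => ?_) measurableSet_Icc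
    fun τ hτ => ?_
  -- The limit density lies below the density at each time `τ`.
  · exact ENNReal.ofReal_le_ofReal
      (ciInf_le ⟨0, by rintro _ ⟨t, rfl⟩; exact (decay_pos _ T t x).le⟩ τ)
  · have hTτ : T ≤ τ := hTs.trans hτ.1
    have h1 := hflow.lintegral_decay_mul_energy hubble hT hTτ
    simp only [E, hIcc τ hτ]
    exact h1.trans (lintegral_congr fun x => by
      simp only [Function.comp_apply, Prod.swap, volumeRate_of_le n L hTτ])

/-- The rescaled volume lost between the times `s` and `Λs` tends to zero. -/
theorem tendsto_volume_loss [T2Space X] (hflow : IsExpandingCMCEinsteinFlow I L h K H)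
    (hubble : ∀ t ∈ I, t = -(n : ℝ) / H t) {T : ℝ} (hT : T ∈ I) {Λ : ℝ} (hΛ : 1 < Λ) :
    Tendsto (fun s => ∫⁻ x, ENNReal.ofReal
      (decay (volumeRate n L T) T s x - decay (volumeRate n L T) T (s * Λ) x) ∂scaledVolume h T)
      atTop (𝓝 0) := by
  have hθ := hflow.continuous_volumeRate hubble hT
  have h0 := hflow.volumeRate_nonneg hubble hT
  have := hflow.isFiniteMeasure_scaledVolume hT
  rw [← lintegral_zero (μ := scaledVolume h T)]
  refine tendsto_lintegral_filter_of_dominated_convergence (fun _ => 1)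
    (Eventually.of_forall fun t => ((continuous_decay_right hθ T t).sub
      (continuous_decay_right hθ T (t * Λ))).measurable.ennreal_ofReal)
    ?_ (by simp) (Eventually.of_forall fun x => ?_)
  · filter_upwards [eventually_ge_atTop T] with t ht
    refine Eventually.of_forall fun x => ENNReal.ofReal_le_one.2 ?_
    linarith [decay_le_one hθ h0 ht x, decay_pos (volumeRate n L T) T (t * Λ) x]
  -- At each point the decay factors at `s` and at `Λs` have the same limit.
  · have h1 := tendsto_decay hθ h0 T x
    have h2 := h1.sub (h1.comp (tendsto_id.atTop_mul_const (zero_lt_one.trans hΛ)))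
    rw [sub_self] at h2
    have h3 := (ENNReal.continuous_ofReal.tendsto _).comp h2
    rw [ENNReal.ofReal_zero] at h3
    exact h3

end IsExpandingCMCEinsteinFlow

end LimitVolume

/-! ### Convergence in `L²` -/

theorem eLpNorm_two_eq {X : Type*} [MeasurableSpace X] (D : X → ENNReal) (μ : Measure X) :
    eLpNorm D 2 μ = (∫⁻ x, D x ^ 2 ∂μ) ^ (1 / 2 : ℝ) := by
  rw [eLpNorm_eq_lintegral_rpow_enorm_toReal two_ne_zero ENNReal.ofNat_ne_top]
  simp

theorem proposition1p42 (n : ℕ) (X : Type*) [TopologicalSpace X]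
    [ChartedSpace (EuclideanSpace ℝ (Fin n)) X] [IsManifold (𝓡 n) ∞ X]
    [T2Space X] [CompactSpace X] [ConnectedSpace X] [MeasurableSpace X] [BorelSpace X]
    (I : Set ℝ) (L : ℝ → X → ℝ) (h : ℝ → SmoothMetric n X) (K : ℝ → Cov2Tensor n X) (H : ℝ → ℝ)
    (hflow : IsExpandingCMCEinsteinFlow I L h K H)
    -- the time parameter is the Hubble time
    (hubble : ∀ t ∈ I, t = -(n : ℝ) / H t) :
    ∃ dvolInf : Measure X, IsLimitVolume h dvolInf ∧
      ∀ Λ : ℝ, 1 < Λ →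
      -- any choice, for all large `s`, of the endomorphisms `H_{s,Λ}(x)` and of orthonormal
      -- bases of `(T_x X, h_s(x,1))`
      ∀ (A : ℝ → ∀ x : X, TangentSpace (𝓡 n) x →ₗ[ℝ] TangentSpace (𝓡 n) x)
        (b : ℝ → ∀ x : X, Module.Basis (Fin n) ℝ (TangentSpace (𝓡 n) x)),
      (∀ᶠ s in atTop, ∀ x,
        Relates (rescaledMetric h s 1 x) (rescaledMetric h s Λ x) (A s x) ∧
        IsOrthonormalBasis (rescaledMetric h s 1 x) (b s x)) →
      -- the function `x ↦ d_symm(H¹_{s,Λ}(x), I_n)` lies in `L²` and tends to `0` there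
      (∀ᶠ s in atTop, MemLp (fun x : X => symmDist
        (cosetPoint (LinearMap.toMatrix (b s x) (b s x) (unimodularPart n (A s x)))) 1)
        2 dvolInf) ∧
      Tendsto (fun s => eLpNorm (fun x : X => symmDist
        (cosetPoint (LinearMap.toMatrix (b s x) (b s x) (unimodularPart n (A s x)))) 1)
        2 dvolInf) atTop (𝓝 0) := by

  -- Any time of the flow serves as base time for the density of the limit measure.
  obtain ⟨T, hT⟩ := hflow.nonempty
  have hn := hflow.dim_ne_zero hubble
  refine ⟨limitVolume L h T, hflow.isLimitVolume_limitVolume hubble hT, fun Λ hΛ A b hAb => ?_⟩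
  have := hflow.isFiniteMeasure_scaledVolume hT
  set D : ℝ → X → ENNReal := fun s x => symmDist
    (cosetPoint (LinearMap.toMatrix (b s x) (b s x) (unimodularPart n (A s x)))) 1
  let Φ : ℝ → ENNReal := fun s => ∫⁻ x, ENNReal.ofReal
    (decay (volumeRate n L T) T s x - decay (volumeRate n L T) T (s * Λ) x) ∂scaledVolume h T
  have hΦ : Tendsto Φ atTop (𝓝 0) := hflow.tendsto_volume_loss hubble hT hΛ
  -- The squared `L²` norm is at most `4 log Λ` times the rescaled volume lost between `s` and `Λs`;
  -- its finiteness for large `s` and its convergence to zero both follow from this.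
  have hbound : ∀ᶠ s in atTop, Measurable (D s) ∧
      ∫⁻ x, D s x ^ 2 ∂limitVolume L h T ≤ ENNReal.ofReal (4 * Real.log Λ) * Φ s := by
    filter_upwards [hAb, eventually_ge_atTop T] with s hs hTs
    have hsI := hflow.mem_of_le hT hTs
    have hs0 := hflow.pos_of_mem hubble hsI
    have hsΛ : s ≤ s * Λ := le_mul_of_one_le_right hs0.le hΛ.le
    have hD : ∀ e ∈ atlas (EuclideanSpace ℝ (Fin n)) X, ∀ y ∈ e.target,
        D s (e.symm y) = symmDist (detNormalize (components e (h (s * Λ)).inner y))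
          (detNormalize (components e (h s).inner y)) := fun e he y hy =>
      symmDist_relates hn hs0 he hy (hs _).1 (hs _).2
    have hDle : ∀ x, D s x ^ 2 ≤ ENNReal.ofReal (4 * Real.log Λ) *
        ∫⁻ τ in Icc s (s * Λ), ENNReal.ofReal (τ * L τ x * shearSq (h τ) (K τ) x) := fun x => by
      have hx := mem_chart_source (EuclideanSpace ℝ (Fin n)) x
      have he := chart_mem_atlas (EuclideanSpace ℝ (Fin n)) x
      have hy := (chartAt (EuclideanSpace ℝ (Fin n)) x).map_source hx
      have h1 := hflow.sq_symmDist_metric_le hubble hsI hΛ he hy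
      rwa [← hD _ he _ hy, (chartAt (EuclideanSpace ℝ (Fin n)) x).left_inv hx] at h1
    refine ⟨hflow.measurable_of_eq_symmDist hn hsI (hflow.mem_of_le hsI hsΛ) hD, ?_⟩
    refine (lintegral_mono hDle).trans ?_
    rw [lintegral_const_mul' _ _ ENNReal.ofReal_ne_top]
    gcongr
    exact hflow.lintegral_energy_le hubble hT hTs hsΛ
  have hlim : Tendsto (fun s => (ENNReal.ofReal (4 * Real.log Λ) * Φ s) ^ (1 / 2 : ℝ)) atTop
      (𝓝 0) := by
    have h1 := ENNReal.Tendsto.const_mul (a := ENNReal.ofReal (4 * Real.log Λ)) hΦ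
      (Or.inr ENNReal.ofReal_ne_top)
    rw [mul_zero] at h1
    have h2 := (ENNReal.continuous_rpow_const (y := (1 / 2 : ℝ))).continuousAt.tendsto.comp h1
    rwa [ENNReal.zero_rpow_of_pos (by norm_num)] at h2
  have hnorm : ∀ᶠ s in atTop, Measurable (D s) ∧ eLpNorm (D s) 2 (limitVolume L h T) ≤
      (ENNReal.ofReal (4 * Real.log Λ) * Φ s) ^ (1 / 2 : ℝ) := by
    filter_upwards [hbound] with s hs
    refine ⟨hs.1, ?_⟩
    rw [eLpNorm_two_eq]
    exact ENNReal.rpow_le_rpow hs.2 (by norm_num)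
  refine ⟨?_, tendsto_of_tendsto_of_tendsto_of_le_of_le' tendsto_const_nhds hlim
    (Eventually.of_forall fun _ => zero_le) (hnorm.mono fun _ hs => hs.2)⟩
  filter_upwards [hnorm, hlim.eventually_lt_const ENNReal.zero_lt_top] with s hs hfin
  exact ⟨hs.1.aestronglyMeasurable, hs.2.trans_lt hfin⟩
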